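/- Let $d\ge 1$ be an integer and $s\ge 0$ a real number. For a tempered distribution $f\in\mathscr S'(\mathbb R^d)$ whose Fourier transform $\widehat f$ (in the sense of distributions, normalized by $\widehat f(\xi)=\int_{\mathbb R^d} f(x)e^{-2\pi i x\cdot\xi}\,dx$ for $f\in L^1$) is a function, put $\upsilon_{f,s}=\int_{\mathbb R^d}|\xi|^s|\widehat f(\xi)|\,d\xi$, and let $$\mathscr B^s(\mathbb R^d)=\{f\in\mathscr S'(\mathbb R^d):\ \|f\|_{\mathscr B^s}:=\upsilon_{f,0}+\upsilon_{f,s}<\infty\}$$ be the spectral Barron space. For $1\le p<\infty$ and $\alpha>0$ let $W^\alpha_p(\mathbb R^d)$ be the Sobolev space: for integer $\alpha$ its norm is $\sum_{n\le\alpha}\|\nabla^n f\|_{L^p}$ (weak derivatives), and for non-integer $\alpha$ it consists of the $f\in W^{\lfloor\alpha\rfloor}_p(\mathbb R^d)$ with finite norm $$\|f\|_{W^\alpha_p}=\|f\|_{W^{\lfloor\alpha\rfloor}_p}+\Big(\iint_{\mathbb R^d\times\mathbb R^d}\frac{|\nabla^{\lfloor\alpha\rfloor}f(x)-\nabla^{\lfloor\alpha\rfloor}f(y)|^p}{|x-y|^{d+(\alpha-\lfloor\alpha\rfloor)p}}\,dx\,dy\Big)^{1/p},$$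 where $W^0_p=L^p$. Let $C^s(\mathbb R^d)$ be the space of functions whose derivatives up to order $\lfloor s\rfloor$ exist and are bounded and uniformly continuous and, if $s$ is not an integer, whose derivatives of order $\lfloor s\rfloor$ are moreover Hölder continuous on $\mathbb R^d$ with exponent $s-\lfloor s\rfloor$; its norm is the sum of the sup norms of the derivatives up to order $\lfloor s\rfloor$ plus, if $s$ is not an integer, the Hölder seminorm of the derivatives of order $\lfloor s\rfloor$. We write $X\hookrightarrow Y$ if $X\subseteq Y$ and there is a constant $C$ with $\|f\|_Y\le C\|f\|_X$ for all $f\in X$ (functions being identified with the tempered distributions they define). 1. If $1\le p\le 2$ and $\alpha>s+d/p$, then $$W^\alpha_p(\mathbb R^d)\hookrightarrow\mathscr B^s(\mathbb R^d)\hookrightarrow C^s(\mathbb R^d).$$ 2. If $s$ is not an integer, or if $s$ is an integer and $d\ge 2$, then $$W^{s+d}_1(\mathbb R^d)\hookrightarrow\mathscr B^s(\mathbb R^d).$$ -/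

import Mathlib

open MeasureTheory FourierTransform LineDeriv
open scoped ENNReal NNReal SchwartzMap TemperedDistribution

noncomputable section

namespace SpectralBarron

/-- The Euclidean space `ℝ^d`. -/
abbrev Eu (d : ℕ) : Type := EuclideanSpace ℝ (Fin d)

/-- The tempered distribution `f` is the regular distribution given by the locally integrable
function `u`, i.e. `⟨f, φ⟩ = ∫ u φ` for all Schwartz functions `φ`. Such a `u` is unique up to
equality almost everywhere, see `IsRegular.ae_eq`. -/
def IsRegular {d : ℕ} (f : 𝓢'(Eu d, ℂ)) (u : Eu d → ℂ) : Prop :=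
  LocallyIntegrable u ∧
    ∀ φ : 𝓢(Eu d, ℂ), Integrable (fun x => φ x * u x) ∧ f φ = ∫ x, φ x * u x

theorem IsRegular.ae_eq {d : ℕ} {f : 𝓢'(Eu d, ℂ)} {u v : Eu d → ℂ}
    (hu : IsRegular f u) (hv : IsRegular f v) : ∀ᵐ x, u x = v x := by
  refine ae_eq_of_integral_contDiff_smul_eq hu.1 hv.1 fun g hg hgs => ?_
  have hc : HasCompactSupport (fun x => (g x : ℂ)) :=
    hgs.comp_left (g := fun r : ℝ => (r : ℂ)) Complex.ofReal_zero
  have hs : ContDiff ℝ (⊤ : ℕ∞) (fun x => (g x : ℂ)) :=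
    Complex.ofRealCLM.contDiff.comp hg
  have h1 := (hu.2 (hc.toSchwartzMap hs)).2
  have h2 := (hv.2 (hc.toSchwartzMap hs)).2
  simpa [Complex.real_smul] using h1.symm.trans h2

/-! ### The spectral Barron space -/

/-- `υ_{f,s} = ∫ |ξ|^s |f̂(ξ)| dξ`, where the distributional Fourier transform `f̂` (normalized with
`e^{-2π i x·ξ}`) has to be a function; the value is `∞` if it is not. -/
def spectralNorm {d : ℕ} (s : ℝ) (f : 𝓢'(Eu d, ℂ)) : ℝ≥0∞ :=
  ⨅ (g : Eu d → ℂ) (_ : IsRegular (𝓕 f) g), ∫⁻ ξ, ‖ξ‖ₑ ^ s * ‖g ξ‖ₑ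

/-- The norm `υ_{f,0} + υ_{f,s}`. -/
def barronNorm {d : ℕ} (s : ℝ) (f : 𝓢'(Eu d, ℂ)) : ℝ≥0∞ :=
  spectralNorm 0 f + spectralNorm s f

/-- The spectral Barron space `𝓑^s(ℝ^d)`. -/
def barronSpace (d : ℕ) (s : ℝ) : Set 𝓢'(Eu d, ℂ) :=
  {f | barronNorm s f < ∞}

/-! ### Sobolev spaces of integer and fractional order -/

/-- The function `G` is the `n`-th weak gradient `∇ⁿf`, the tensor of all partial derivatives
`∂_{i₁} ⋯ ∂_{iₙ} f` of order `n`; its values carry the Euclidean norm. -/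
def IsWeakGradient {d : ℕ} (n : ℕ) (f : 𝓢'(Eu d, ℂ))
    (G : Eu d → EuclideanSpace ℂ (Fin n → Fin d)) : Prop :=
  ∀ i : Fin n → Fin d,
    IsRegular (∂^{fun j => EuclideanSpace.single (i j) (1 : ℝ)} f) (fun x => G x i)

/-- `‖∇ⁿf‖_{L^p}`, which is `∞` if `∇ⁿf` is not a function. -/
def gradientLpNorm {d : ℕ} (n : ℕ) (p : ℝ) (f : 𝓢'(Eu d, ℂ)) : ℝ≥0∞ :=
  ⨅ (G : Eu d → EuclideanSpace ℂ (Fin n → Fin d)) (_ : IsWeakGradient n f G),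
    eLpNorm G (ENNReal.ofReal p) volume

/-- `(∬ |∇ⁿf(x) - ∇ⁿf(y)|^p / |x - y|^{d + θp} dx dy)^{1/p}`. -/
def gagliardoSeminorm {d : ℕ} (n : ℕ) (θ p : ℝ) (f : 𝓢'(Eu d, ℂ)) : ℝ≥0∞ :=
  ⨅ (G : Eu d → EuclideanSpace ℂ (Fin n → Fin d)) (_ : IsWeakGradient n f G),
    (∫⁻ x, ∫⁻ y, ‖G x - G y‖ₑ ^ p / ‖x - y‖ₑ ^ ((d : ℝ) + θ * p)) ^ (1 / p)

/-- The real number `a` is an integer. -/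
def IsInteger (a : ℝ) : Prop := ∃ k : ℤ, (k : ℝ) = a

open Classical in
/-- The norm of `W^α_p(ℝ^d)`: the sum of `‖∇ⁿf‖_{L^p}` over `n ≤ ⌊α⌋`, to which for non-integer `α`
the Gagliardo seminorm of `∇^{⌊α⌋}f` of order `α - ⌊α⌋` is added. -/
def sobolevNorm {d : ℕ} (α p : ℝ) (f : 𝓢'(Eu d, ℂ)) : ℝ≥0∞ :=
  (∑ n ∈ Finset.range (⌊α⌋₊ + 1), gradientLpNorm n p f) +
    if IsInteger α then 0 else gagliardoSeminorm ⌊α⌋₊ (α - ⌊α⌋₊) p f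

/-- The Sobolev space `W^α_p(ℝ^d)`. -/
def sobolevSpace (d : ℕ) (α p : ℝ) : Set 𝓢'(Eu d, ℂ) :=
  {f | sobolevNorm α p f < ∞}

/-! ### The classical spaces `C^s` -/

open Classical in
/-- For a function `u` of class `C^{⌊s⌋}`: the sum of the sup norms of its derivatives of order
at most `⌊s⌋`, to which for non-integer `s` the Hölder seminorm of exponent `s - ⌊s⌋` of the
derivative of order `⌊s⌋` is added. -/
def classicalNorm {d : ℕ} (s : ℝ) (u : Eu d → ℂ) : ℝ≥0∞ :=
  (∑ n ∈ Finset.range (⌊s⌋₊ + 1), ⨆ x, ‖iteratedFDeriv ℝ n u x‖ₑ) +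
    if IsInteger s then 0 else
      ⨆ (x : Eu d) (y : Eu d) (_ : x ≠ y),
        ‖iteratedFDeriv ℝ ⌊s⌋₊ u x - iteratedFDeriv ℝ ⌊s⌋₊ u y‖ₑ / ‖x - y‖ₑ ^ (s - ⌊s⌋₊)

/-- The distribution `f` is (given by) the function `u`, which is of class `C^{⌊s⌋}` with uniformly
continuous derivatives up to the order `⌊s⌋`. -/
def IsClassicalFunction {d : ℕ} (s : ℝ) (f : 𝓢'(Eu d, ℂ)) (u : Eu d → ℂ) : Prop :=
  IsRegular f u ∧ ContDiff ℝ ⌊s⌋₊ u ∧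
    ∀ n ≤ ⌊s⌋₊, UniformContinuous (iteratedFDeriv ℝ n u)

/-- The norm of `C^s(ℝ^d)`, which is `∞` on distributions that are not given by a function of
class `C^{⌊s⌋}` with uniformly continuous derivatives. -/
def holderNorm {d : ℕ} (s : ℝ) (f : 𝓢'(Eu d, ℂ)) : ℝ≥0∞ :=
  ⨅ (u : Eu d → ℂ) (_ : IsClassicalFunction s f u), classicalNorm s u

/-- The space `C^s(ℝ^d)`: for an integer `s`, functions all of whose derivatives up to the order
`s` are bounded and uniformly continuous; for non-integer `s`, the Hölder space. -/
def holderSpace (d : ℕ) (s : ℝ) : Set 𝓢'(Eu d, ℂ) :=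
  {f | holderNorm s f < ∞}

/-! ### Continuous embeddings -/

/-- `X ↪ Y` for two spaces of tempered distributions with norms `normX` and `normY`: `X ⊆ Y`, and
the inclusion is bounded. -/
def ContinuouslyEmbeds {d : ℕ} (X : Set 𝓢'(Eu d, ℂ)) (normX : 𝓢'(Eu d, ℂ) → ℝ≥0∞)
    (Y : Set 𝓢'(Eu d, ℂ)) (normY : 𝓢'(Eu d, ℂ) → ℝ≥0∞) : Prop :=
  X ⊆ Y ∧ ∃ C : ℝ≥0, ∀ f ∈ X, normY f ≤ C * normX f

end SpectralBarron

end

/-!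
Everything is done on the Fourier side. Write `g = f̂`; the norm of `𝓑^s` is comparable to
`∫_{|ξ| < 1} |g| + ∫_{|ξ| ≥ 1} |ξ|^s |g|` (`barronNorm_le`).

*The Barron space embeds into `C^s`.* The function `f` is the Fourier integral of the integrable
function `g (-ξ)`, which has all moments of order at most `s`. Differentiating under the integral
bounds the derivatives of order at most `⌊s⌋`, and the Hölder continuity of characters bounds the
Hölder seminorm (`barron_continuouslyEmbeds_holder`).

*The Sobolev space embeds into the Barron space.* Instead of the Hausdorff–Young inequality only the
following consequence is needed: for `1 ≤ p ≤ 2` the integral of `|û|` over a ball of radius `R` is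
at most `C R^{d/p} ‖u‖_p` (`setLIntegral_ball_hasFourier_le`). It follows from the cases `p = 1` and
`p = 2` by splitting `u` at a suitable height. It settles the low frequencies. Applied to the
differences `u (x + h) - u x`, averaged over the translations `h` of size comparable to `1 / R`, it
bounds `∫ |û|` over the annulus `R ≤ |ξ| < 2R` by `R^{d/p}` times the `L^p` modulus of continuity of
`u` at the scale `1 / R` (`setLIntegral_annulus_hasFourier_le`). For the derivatives of order `⌊α⌋`
and dyadic `R`, the modulus of continuity is controlled by the Gagliardo seminorm. If `α > s + d/p`
the sum over the dyadic scales is geometric (`sobolev_continuouslyEmbeds_barron`). If `p = 1`,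
`α = s + d` and `s` is not an integer, the powers of `R` cancel exactly, but the parts of the
Gagliardo double integral that belong to the different scales are disjoint, and their sum is again
bounded by the seminorm (`sobolev_one_continuouslyEmbeds_barron_of_not_isInteger`).

*The integer endpoint.* For an integer `s` and `d ≥ 2` the derivatives of order `s + d - 1` lie in
`W¹₁`, and the claim follows from the Hardy type inequality
`∫ |ξ|^{1-d} |Ĝ(ξ)| dξ ≤ C ‖∇G‖₁` (`lintegral_weight_fourier_le_weak`). By mollification and Fatou's
lemma `G` may be taken of class `C¹`, real and vanishing at infinity. Then `G` is cut into the layers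
`v_a` between the levels `a` and `4a`, for dyadic `a` (`layer`). On the one hand `v_a` is bounded by a
multiple of `a`, whence `‖v_a (x + h) - v_a x‖₂² ≤ C a |h| ‖∇v_a‖₁`, which gives a mean square decay
of its Fourier transform; on the other hand `|v̂_a| ≤ ‖v_a‖₁ ≤ C a |E_a|` with `E_a = {|G| ≥ a}`. Using
the latter for `|ξ| < R`, the former for `|ξ| ≥ R` (here `d ≥ 2` makes the dyadic sum converge), and
optimizing in `R` gives `∫ |ξ|^{1-d} |v̂_a| ≤ C (a |E_a|^{1-1/d} + ‖∇v_a‖₁)`. By the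
Gagliardo–Nirenberg–Sobolev inequality for `v_{a/4}`, `a |E_a|^{1-1/d}` is at most
`C ‖∇v_{a/4}‖₁` (`measure_superlevel_le`). The gradients of the layers add up to at most `|∇G|`, so
the estimates can be summed over all levels (`lintegral_weight_fourier_le_fderiv`).
-/

namespace SpectralBarron

open scoped Convolution

variable {d : ℕ}

/-! ### The distributional Fourier transform of functions -/

/-- The function `g` is the Fourier transform of the function `u` in the sense of distributions:
`∫ φ g = ∫ φ̂ u` for all Schwartz functions `φ`. The integrability of both integrands is part of the
notion, so that none of the integrals is a junk value. -/
structure HasFourier (u g : Eu d → ℂ) : Prop where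
  locallyIntegrable : LocallyIntegrable g
  integrable_left : ∀ φ : 𝓢(Eu d, ℂ), Integrable (fun x => φ x * u x)
  integrable_right : ∀ φ : 𝓢(Eu d, ℂ), Integrable (fun x => φ x * g x)
  integral_eq : ∀ φ : 𝓢(Eu d, ℂ), ∫ x, (𝓕 φ) x * u x = ∫ x, φ x * g x

theorem HasFourier.ae_eq {u g₁ g₂ : Eu d → ℂ} (h₁ : HasFourier u g₁) (h₂ : HasFourier u g₂) :
    g₁ =ᵐ[volume] g₂ := by
  refine ae_eq_of_integral_contDiff_smul_eq h₁.1 h₂.1 fun g hg hgs => ?_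
  have hc : HasCompactSupport (fun x => (g x : ℂ)) :=
    hgs.comp_left (g := fun r : ℝ => (r : ℂ)) Complex.ofReal_zero
  have hs : ContDiff ℝ (⊤ : ℕ∞) (fun x => (g x : ℂ)) :=
    Complex.ofRealCLM.contDiff.comp hg
  have h3 := h₁.integral_eq (hc.toSchwartzMap hs)
  have h4 := h₂.integral_eq (hc.toSchwartzMap hs)
  simpa [Complex.real_smul] using h3.symm.trans h4

theorem HasFourier.add {u₁ u₂ g₁ g₂ : Eu d → ℂ} (h₁ : HasFourier u₁ g₁) (h₂ : HasFourier u₂ g₂) :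
    HasFourier (u₁ + u₂) (g₁ + g₂) where
  locallyIntegrable := h₁.1.add h₂.1
  integrable_left φ := by
    simp only [Pi.add_apply, mul_add]
    exact (h₁.integrable_left φ).add (h₂.integrable_left φ)
  integrable_right φ := by
    simp only [Pi.add_apply, mul_add]
    exact (h₁.integrable_right φ).add (h₂.integrable_right φ)
  integral_eq φ := by
    simp only [Pi.add_apply, mul_add]
    rw [integral_add (h₁.integrable_left _) (h₂.integrable_left _),
      integral_add (h₁.integrable_right _) (h₂.integrable_right _), h₁.integral_eq,
      h₂.integral_eq]

theorem HasFourier.neg {u g : Eu d → ℂ} (h : HasFourier u g) : HasFourier (-u) (-g) where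
  locallyIntegrable := h.1.neg
  integrable_left φ := by simpa using (h.integrable_left φ).neg
  integrable_right φ := by simpa using (h.integrable_right φ).neg
  integral_eq φ := by
    simp only [Pi.neg_apply, mul_neg, integral_neg, h.integral_eq]

theorem HasFourier.sub {u₁ u₂ g₁ g₂ : Eu d → ℂ} (h₁ : HasFourier u₁ g₁) (h₂ : HasFourier u₂ g₂) :
    HasFourier (u₁ - u₂) (g₁ - g₂) := by
  rw [sub_eq_add_neg, sub_eq_add_neg]
  exact h₁.add h₂.neg

/-- On integrable functions the distributional Fourier transform is the Fourier integral. -/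
theorem hasFourier_of_integrable {u : Eu d → ℂ} (hu : Integrable u) : HasFourier u (𝓕 u) := by
  have hcont : Continuous (𝓕 u) :=
    VectorFourier.fourierIntegral_continuous Real.continuous_fourierChar
      (innerSL ℝ).continuous₂ hu
  have hbd : ∀ x, ‖𝓕 u x‖ ≤ ∫ y, ‖u y‖ := fun x =>
    VectorFourier.norm_fourierIntegral_le_integral_norm _ _ _ _ _
  refine ⟨hcont.locallyIntegrable, fun φ => ?_, fun φ => ?_, fun φ => ?_⟩
  · refine hu.bdd_mul (c := (SchwartzMap.seminorm ℝ 0 0) φ) φ.continuous.aestronglyMeasurable ?_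
    exact Filter.Eventually.of_forall fun x => φ.norm_le_seminorm ℝ x
  · exact φ.integrable.mul_bdd (c := ∫ y, ‖u y‖) hcont.aestronglyMeasurable
      (Filter.Eventually.of_forall hbd)
  · have := VectorFourier.integral_fourierIntegral_smul_eq_flip (μ := volume) (ν := volume)
      (L := innerₗ (Eu d)) (f := φ) (g := u) Real.continuous_fourierChar
      (by exact continuous_inner) φ.integrable hu
    rw [flip_innerₗ] at this
    exact this

/-- On square integrable functions the distributional Fourier transform is the `L²` Fourier
transform, and it is isometric. -/
theorem exists_hasFourier_of_memLp_two {u : Eu d → ℂ} (hu : MemLp u 2) :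
    ∃ g, HasFourier u g ∧ MemLp g 2 ∧ eLpNorm g 2 = eLpNorm u 2 := by
  have hint : ∀ (v : Eu d → ℂ), MemLp v 2 → ∀ φ : 𝓢(Eu d, ℂ), Integrable (fun x => φ x * v x) :=
    fun v hv φ => (φ.memLp 2).integrable_mul hv
  let U := hu.toLp u
  have hU : (U : Eu d → ℂ) =ᵐ[volume] u := hu.coeFn_toLp
  refine ⟨(𝓕 U : Lp ℂ 2 (volume : Measure (Eu d))), ⟨?_, hint u hu, hint _ (Lp.memLp _), ?_⟩,
    Lp.memLp _, ?_⟩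
  · exact (Lp.memLp _).locallyIntegrable (by norm_num)
  · intro φ
    have h := congrArg (fun T => T φ) (Lp.fourier_toTemperedDistribution_eq U)
    simp only [TemperedDistribution.fourier_apply, Lp.toTemperedDistribution_apply,
      smul_eq_mul] at h
    rw [← h]
    refine integral_congr_ae ?_
    filter_upwards [hU] with x hx
    rw [hx]
  · have h := Lp.norm_fourier_eq U
    rw [Lp.norm_def, Lp.norm_def] at h
    rw [(ENNReal.toReal_eq_toReal_iff' (Lp.memLp _).2.ne (Lp.memLp _).2.ne).1 h]
    exact eLpNorm_congr_ae hU

/-- Translations turn into modulations. -/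
theorem HasFourier.comp_add_right {u g : Eu d → ℂ} (h : HasFourier u g) (a : Eu d) :
    HasFourier (fun x => u (x + a)) (fun ξ => (Real.fourierChar (inner ℝ a ξ) : ℂ) * g ξ) := by
  have hcont : Continuous (fun ξ : Eu d => (Real.fourierChar (inner ℝ a ξ) : ℂ)) := by
    fun_prop
  have key : ∀ (φ : 𝓢(Eu d, ℂ)) (ξ : Eu d),
      (𝓕⁻ (SchwartzMap.compSubConstCLM ℝ a (𝓕 φ))) ξ =
        (Real.fourierChar (inner ℝ a ξ) : ℂ) * φ ξ := by
    intro φ ξ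
    have h1 : φ ξ = (𝓕⁻ (𝓕 φ)) ξ := by rw [fourierInv_fourier_eq]
    rw [h1, SchwartzMap.fourierInv_coe, SchwartzMap.fourierInv_coe, Real.fourierInv_eq,
      Real.fourierInv_eq, ← integral_const_mul, ← integral_add_right_eq_self _ a]
    refine integral_congr_ae (Filter.Eventually.of_forall fun x => ?_)
    simp [inner_add_left, AddChar.map_add_eq_mul, Circle.smul_def]
    ring
  have hmeas : ∀ ξ, ‖(Real.fourierChar (inner ℝ a ξ) : ℂ)‖ = 1 := fun ξ => Circle.norm_coe _
  refine ⟨?_, fun φ => ?_, fun φ => ?_, fun φ => ?_⟩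
  · rw [locallyIntegrable_iff]
    intro k hk
    refine Integrable.bdd_mul (c := 1) (h.1.integrableOn_isCompact hk)
      hcont.aestronglyMeasurable ?_
    exact Filter.Eventually.of_forall fun x => (hmeas x).le
  · have := (h.integrable_left (SchwartzMap.compSubConstCLM ℝ a φ)).comp_add_right a
    simpa using this
  · have := h.integrable_right (𝓕⁻ (SchwartzMap.compSubConstCLM ℝ a (𝓕 φ)))
    refine this.congr (Filter.Eventually.of_forall fun x => ?_)
    simp only [key]
    ring
  · have := h.integral_eq (𝓕⁻ (SchwartzMap.compSubConstCLM ℝ a (𝓕 φ)))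
    rw [fourier_fourierInv_eq, ← integral_add_right_eq_self _ a] at this
    simp only [SchwartzMap.compSubConstCLM_apply, add_sub_cancel_right] at this
    rw [this]
    refine integral_congr_ae (Filter.Eventually.of_forall fun x => ?_)
    simp only [key]
    ring

theorem HasFourier.isRegular {f : 𝓢'(Eu d, ℂ)} {u g : Eu d → ℂ} (h : HasFourier u g)
    (hf : IsRegular f u) : IsRegular (𝓕 f) g := by
  refine ⟨h.1, fun φ => ⟨h.integrable_right φ, ?_⟩⟩
  rw [TemperedDistribution.fourier_apply, (hf.2 _).2, h.integral_eq]

theorem IsRegular.hasFourier {f : 𝓢'(Eu d, ℂ)} {u g : Eu d → ℂ} (hf : IsRegular f u)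
    (hg : IsRegular (𝓕 f) g) : HasFourier u g := by
  refine ⟨hg.1, fun φ => (hf.2 φ).1, fun φ => (hg.2 φ).1, fun φ => ?_⟩
  rw [← (hf.2 _).2, ← (hg.2 _).2, TemperedDistribution.fourier_apply]

/-- Derivatives turn into multiplication by the coordinates. -/
theorem IsRegular.fourier_lineDerivOp {f : 𝓢'(Eu d, ℂ)} {g : Eu d → ℂ}
    (hg : IsRegular (𝓕 f) g) (m : Eu d) :
    IsRegular (𝓕 (∂_{m} f)) (fun ξ => (2 * Real.pi * Complex.I * (inner ℝ ξ m : ℝ)) * g ξ) := by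
  have hT : (fun ξ : Eu d => ((inner ℝ ξ m : ℝ) : ℂ)).HasTemperateGrowth := by fun_prop
  have hc : Continuous (fun ξ : Eu d => (2 * Real.pi * Complex.I * (inner ℝ ξ m : ℝ) : ℂ)) := by
    fun_prop
  refine ⟨?_, fun φ => ?_⟩
  · rw [locallyIntegrable_iff]
    intro k hk
    exact (hg.1.integrableOn_isCompact hk).continuousOn_mul hc.continuousOn hk
  · have h := hg.2 (SchwartzMap.smulLeftCLM ℂ (fun ξ : Eu d => ((inner ℝ ξ m : ℝ) : ℂ)) φ)
    have heq : (fun ξ => φ ξ * ((2 * Real.pi * Complex.I * (inner ℝ ξ m : ℝ)) * g ξ)) = fun ξ =>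
        (2 * Real.pi * Complex.I) *
        ((SchwartzMap.smulLeftCLM ℂ (fun ξ : Eu d => ((inner ℝ ξ m : ℝ) : ℂ)) φ) ξ * g ξ) := by
      ext ξ
      rw [SchwartzMap.smulLeftCLM_apply_apply hT]
      simp only [smul_eq_mul]
      ring
    rw [heq]
    refine ⟨h.1.const_mul _, ?_⟩
    rw [integral_const_mul, ← h.2, TemperedDistribution.fourier_lineDerivOp_eq]
    rfl

theorem IsRegular.fourier_iteratedLineDerivOp {f : 𝓢'(Eu d, ℂ)} {g : Eu d → ℂ}
    (hg : IsRegular (𝓕 f) g) {n : ℕ} (m : Fin n → Eu d) :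
    IsRegular (𝓕 (∂^{m} f))
      (fun ξ => (∏ j, (2 * Real.pi * Complex.I * (inner ℝ ξ (m j) : ℝ))) * g ξ) := by
  induction n with
  | zero => simpa using hg
  | succ n ih =>
    have := (ih (Fin.tail m)).fourier_lineDerivOp (m 0)
    rw [iteratedLineDerivOp_succ_left]
    convert this using 2 with ξ
    rw [Fin.prod_univ_succ, mul_assoc]
    rfl

/-! ### The Fourier transform on `L^p`, `1 ≤ p ≤ 2` -/

theorem ennreal_rpow_anti {x y : ℝ≥0∞} {z : ℝ} (hxy : x ≤ y) (hz : z ≤ 0) : y ^ z ≤ x ^ z := by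
  rw [← neg_neg z, ENNReal.rpow_neg y, ENNReal.rpow_neg x, ENNReal.inv_le_inv]
  exact ENNReal.rpow_le_rpow hxy (by linarith)

theorem ofReal_two_pow (j : ℕ) : ENNReal.ofReal (2 ^ j) = 2 ^ j := by
  rw [ENNReal.ofReal_pow (by norm_num), ENNReal.ofReal_ofNat]

theorem volume_ball_eq (x : Eu d) {R : ℝ} (hR : 0 < R) :
    volume (Metric.ball x R) = ENNReal.ofReal R ^ d * volume (Metric.ball (0 : Eu d) 1) := by
  rw [Measure.addHaar_ball_of_pos _ _ hR, ENNReal.ofReal_pow hR.le]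
  simp

theorem setLIntegral_enorm_le_eLpNorm_two {g : Eu d → ℂ} (hg : AEStronglyMeasurable g)
    (S : Set (Eu d)) :
    ∫⁻ ξ in S, ‖g ξ‖ₑ ≤ volume S ^ (1 / 2 : ℝ) * eLpNorm g 2 := by
  have h := eLpNorm_le_eLpNorm_mul_rpow_measure_univ (p := 1) (q := 2) (μ := volume.restrict S)
    (by norm_num) hg.restrict
  rw [eLpNorm_one_eq_lintegral_enorm, Measure.restrict_apply_univ] at h
  norm_num at h
  rw [mul_comm]
  refine h.trans ?_
  norm_num
  gcongr
  exact Measure.restrict_le_self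

theorem eLpNorm_two_sq {F : Type*} [NormedAddCommGroup F] (g : Eu d → F) :
    eLpNorm g 2 ^ 2 = ∫⁻ x, ‖g x‖ₑ ^ 2 := by
  have h := eLpNorm_nnreal_pow_eq_lintegral (f := g) (μ := volume) (p := 2) (by norm_num)
  norm_num at h
  exact_mod_cast h

theorem eLpNorm_two_eq {F : Type*} [NormedAddCommGroup F] (g : Eu d → F) :
    eLpNorm g 2 = (∫⁻ x, ‖g x‖ₑ ^ 2) ^ (1 / 2 : ℝ) := by
  rw [← eLpNorm_two_sq, ← ENNReal.rpow_natCast, ← ENNReal.rpow_mul]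
  simp

theorem enorm_fourier_le {F : Type*} [NormedAddCommGroup F] [NormedSpace ℂ F] (u : Eu d → F)
    (ξ : Eu d) : ‖𝓕 u ξ‖ₑ ≤ ∫⁻ x, ‖u x‖ₑ := by
  rw [Real.fourier_eq]
  refine (enorm_integral_le_lintegral_enorm _).trans (le_of_eq (lintegral_congr fun x => ?_))
  rw [← ofReal_norm, ← ofReal_norm, Circle.norm_smul]

theorem continuous_fourier {F : Type*} [NormedAddCommGroup F] [NormedSpace ℂ F] {u : Eu d → F}
    (hu : Integrable u) : Continuous (𝓕 u) :=
  VectorFourier.fourierIntegral_continuous Real.continuous_fourierChar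
    (innerSL ℝ).continuous₂ hu

theorem eLpNorm_ofReal_rpow {F : Type*} [NormedAddCommGroup F] (g : Eu d → F) {p : ℝ}
    (hp : 0 < p) : eLpNorm g (ENNReal.ofReal p) ^ p = ∫⁻ x, ‖g x‖ₑ ^ p := by
  rw [eLpNorm_eq_lintegral_rpow_enorm_toReal (by simpa using hp) (by simp),
    ENNReal.toReal_ofReal hp.le, ← ENNReal.rpow_mul, one_div, inv_mul_cancel₀ hp.ne',
    ENNReal.rpow_one]

/-- Splitting `u ∈ L^p`, `1 ≤ p ≤ 2`, at the height `l` into an integrable and a square integrable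
part shows that `û` is a function and controls it on every set of finite measure. -/
theorem exists_hasFourier_of_split {u : Eu d → ℂ} {p : ℝ} (hp1 : 1 ≤ p) (hp2 : p ≤ 2)
    (hu : AEStronglyMeasurable u) (hA : ∫⁻ x, ‖u x‖ₑ ^ p ≠ ∞) {l : ℝ≥0∞} (hl0 : l ≠ 0)
    (hl : l ≠ ∞) :
    ∃ g, HasFourier u g ∧ ∀ S : Set (Eu d), ∫⁻ ξ in S, ‖g ξ‖ₑ ≤
      volume S * (l ^ (1 - p) * ∫⁻ x, ‖u x‖ₑ ^ p) +
        volume S ^ (1 / 2 : ℝ) * (l ^ (2 - p) * ∫⁻ x, ‖u x‖ₑ ^ p) ^ (1 / 2 : ℝ) := by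
  set E : Set (Eu d) := {x | l < ‖u x‖ₑ} with hE
  have hEm : NullMeasurableSet E := nullMeasurableSet_lt aemeasurable_const hu.enorm
  have hs1 : AEStronglyMeasurable (E.indicator u) := hu.indicator₀ hEm
  have hs2 : AEStronglyMeasurable (Eᶜ.indicator u) := hu.indicator₀ hEm.compl
  have hb1 : ∫⁻ x, ‖E.indicator u x‖ₑ ≤ l ^ (1 - p) * ∫⁻ x, ‖u x‖ₑ ^ p := by
    rw [← lintegral_const_mul' _ _ (ENNReal.rpow_ne_top_of_ne_zero hl0 hl)]
    refine lintegral_mono fun x => ?_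
    by_cases hx : x ∈ E
    · have hx' : l < ‖u x‖ₑ := hx
      have h0 : ‖u x‖ₑ ≠ 0 := (bot_lt_of_lt hx').ne'
      rw [Set.indicator_of_mem hx]
      calc ‖u x‖ₑ = ‖u x‖ₑ ^ (1 - p) * ‖u x‖ₑ ^ p := by
            rw [← ENNReal.rpow_add _ _ h0 enorm_ne_top]; simp
        _ ≤ _ := by
            exact mul_le_mul_left (ennreal_rpow_anti hx'.le (by linarith)) _
    · simp [Set.indicator_of_notMem hx]
  have hb2 : ∫⁻ x, ‖Eᶜ.indicator u x‖ₑ ^ 2 ≤ l ^ (2 - p) * ∫⁻ x, ‖u x‖ₑ ^ p := by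
    rw [← lintegral_const_mul' _ _ (ENNReal.rpow_ne_top_of_ne_zero hl0 hl)]
    refine lintegral_mono fun x => ?_
    by_cases hx : x ∈ E
    · simp [hx]
    · have hx' : ‖u x‖ₑ ≤ l := not_lt.1 hx
      rw [Set.indicator_of_mem (show x ∈ Eᶜ from hx)]
      calc ‖u x‖ₑ ^ 2 = ‖u x‖ₑ ^ (2 - p) * ‖u x‖ₑ ^ p := by
            rw [← ENNReal.rpow_add_of_nonneg _ _ (by linarith) (by linarith)]; simp
        _ ≤ _ := by
            gcongr
  have hm1 : Integrable (E.indicator u) :=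
    ⟨hs1, hb1.trans_lt (ENNReal.mul_lt_top (ENNReal.rpow_ne_top_of_ne_zero hl0 hl).lt_top
      hA.lt_top)⟩
  have hsq := eLpNorm_two_sq (Eᶜ.indicator u)
  have hm2 : MemLp (Eᶜ.indicator u) 2 := by
    refine ⟨hs2, ?_⟩
    have : eLpNorm (Eᶜ.indicator u) 2 ^ 2 < ∞ := by
      rw [hsq]
      exact hb2.trans_lt (ENNReal.mul_lt_top (ENNReal.rpow_ne_top_of_ne_zero hl0 hl).lt_top
        hA.lt_top)
    exact (ENNReal.pow_lt_top_iff.1 this).resolve_right (by norm_num)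
  obtain ⟨g₂, hg₂, hg₂m, hg₂n⟩ := exists_hasFourier_of_memLp_two hm2
  refine ⟨𝓕 (E.indicator u) + g₂, ?_, fun S => ?_⟩
  · have := (hasFourier_of_integrable hm1).add hg₂
    rwa [Set.indicator_self_add_compl] at this
  · have hc : AEMeasurable (fun ξ => ‖𝓕 (E.indicator u) ξ‖ₑ) (volume.restrict S) :=
      (continuous_fourier hm1).enorm.aemeasurable
    calc ∫⁻ ξ in S, ‖(𝓕 (E.indicator u) + g₂) ξ‖ₑ
        ≤ ∫⁻ ξ in S, (‖𝓕 (E.indicator u) ξ‖ₑ + ‖g₂ ξ‖ₑ) :=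
          lintegral_mono fun ξ => enorm_add_le _ _
      _ = (∫⁻ ξ in S, ‖𝓕 (E.indicator u) ξ‖ₑ) + ∫⁻ ξ in S, ‖g₂ ξ‖ₑ := lintegral_add_left' hc _
      _ ≤ _ := by
        gcongr
        · calc ∫⁻ ξ in S, ‖𝓕 (E.indicator u) ξ‖ₑ
              ≤ ∫⁻ ξ in S, (l ^ (1 - p) * ∫⁻ x, ‖u x‖ₑ ^ p) := by
                exact lintegral_mono fun ξ => (enorm_fourier_le _ _).trans hb1
            _ = _ := by rw [setLIntegral_const, mul_comm]
        · refine (setLIntegral_enorm_le_eLpNorm_two hg₂m.1 S).trans ?_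
          gcongr
          rw [hg₂n]
          rw [eLpNorm_two_eq]
          gcongr

theorem MemLp.lintegral_rpow_ne_top {u : Eu d → ℂ} {p : ℝ} (hp : 0 < p)
    (hu : MemLp u (ENNReal.ofReal p)) : ∫⁻ x, ‖u x‖ₑ ^ p ≠ ∞ := by
  rw [← eLpNorm_ofReal_rpow u hp]
  exact ENNReal.rpow_ne_top_of_nonneg hp.le hu.2.ne

theorem exists_hasFourier_of_memLp {u : Eu d → ℂ} {p : ℝ} (hp1 : 1 ≤ p) (hp2 : p ≤ 2)
    (hu : MemLp u (ENNReal.ofReal p)) : ∃ g, HasFourier u g := by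
  obtain ⟨g, hg, -⟩ := exists_hasFourier_of_split hp1 hp2 hu.1
    (MemLp.lintegral_rpow_ne_top (by linarith) hu) one_ne_zero ENNReal.one_ne_top
  exact ⟨g, hg⟩

/-- For `u ∈ L^p`, `1 ≤ p ≤ 2`, the integral of `|û|` over a ball of radius `R` is at most
`C R^{d/p} ‖u‖_p`. This replaces the Hausdorff-Young inequality; it results from splitting `u` at
the height `R^{d/p} ‖u‖_p`. -/
theorem setLIntegral_ball_hasFourier_le (d : ℕ) : ∃ C : ℝ≥0, ∀ (p : ℝ), 1 ≤ p → p ≤ 2 →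
    ∀ (u g : Eu d → ℂ), MemLp u (ENNReal.ofReal p) → HasFourier u g → ∀ R : ℝ, 0 < R →
      ∫⁻ ξ in Metric.ball 0 R, ‖g ξ‖ₑ ≤
        C * ENNReal.ofReal R ^ (d / p) * eLpNorm u (ENNReal.ofReal p) := by
  set V : ℝ≥0∞ := volume (Metric.ball (0 : Eu d) 1) with hV
  have hVt : V ≠ ∞ := measure_ball_lt_top.ne
  refine ⟨(V + V ^ (1 / 2 : ℝ)).toNNReal, fun p hp1 hp2 u g hu hg R hR => ?_⟩
  rw [ENNReal.coe_toNNReal (by finiteness)]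
  have hp0 : 0 < p := by linarith
  set N := eLpNorm u (ENNReal.ofReal p) with hN
  have hNt : N ≠ ∞ := hu.2.ne
  have hA : ∫⁻ x, ‖u x‖ₑ ^ p = N ^ p := (eLpNorm_ofReal_rpow u hp0).symm
  set r := ENNReal.ofReal R with hr
  have hr0 : r ≠ 0 := by simpa [hr] using hR
  have hrt : r ≠ ∞ := by simp [hr]
  have hball : volume (Metric.ball (0 : Eu d) R) = r ^ (d : ℝ) * V := by
    rw [volume_ball_eq _ hR, ENNReal.rpow_natCast]
  have key : ∀ l : ℝ≥0∞, l ≠ 0 → l ≠ ∞ → ∫⁻ ξ in Metric.ball 0 R, ‖g ξ‖ₑ ≤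
      volume (Metric.ball (0 : Eu d) R) * (l ^ (1 - p) * N ^ p) +
        volume (Metric.ball (0 : Eu d) R) ^ (1 / 2 : ℝ) *
          (l ^ (2 - p) * N ^ p) ^ (1 / 2 : ℝ) := by
    intro l hl0 hl
    obtain ⟨g', hg', hb⟩ := exists_hasFourier_of_split hp1 hp2 hu.1
      (by rw [hA]; exact ENNReal.rpow_ne_top_of_nonneg hp0.le hNt) hl0 hl
    rw [hA] at hb
    refine le_trans (le_of_eq ?_) (hb _)
    refine lintegral_congr_ae (ae_restrict_of_ae ?_)
    filter_upwards [hg.ae_eq hg'] with ξ hξ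
    rw [hξ]
  rcases eq_or_ne N 0 with h0 | h0
  · refine (key 1 one_ne_zero ENNReal.one_ne_top).trans ?_
    simp [h0, ENNReal.zero_rpow_of_pos hp0]
  · have hrr : r ^ (d / p) ≠ 0 := (ENNReal.rpow_pos (pos_iff_ne_zero.2 hr0) hrt).ne'
    have hrrt : r ^ (d / p) ≠ ∞ := ENNReal.rpow_ne_top_of_ne_zero hr0 hrt
    -- the height for which both terms scale like `R ^ (d / p) * N`
    refine (key (r ^ (d / p) * N) (mul_ne_zero hrr h0) (ENNReal.mul_ne_top hrrt hNt)).trans ?_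
    have e1 : (r ^ (d / p) * N) ^ (1 - p) * N ^ p = r ^ (d / p - d) * N := by
      rw [ENNReal.mul_rpow_of_ne_zero hrr h0, mul_assoc, ← ENNReal.rpow_add _ _ h0 hNt,
        ← ENNReal.rpow_mul]
      congr 2
      · field_simp
      · simp
    have e2 : (r ^ (d / p) * N) ^ (2 - p) * N ^ p = r ^ (2 * (d / p) - d) * N ^ (2 : ℝ) := by
      rw [ENNReal.mul_rpow_of_ne_zero hrr h0, mul_assoc, ← ENNReal.rpow_add _ _ h0 hNt,
        ← ENNReal.rpow_mul]
      congr 2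
      · field_simp
      · ring
    rw [hball, e1, e2, ENNReal.mul_rpow_of_nonneg _ _ (by norm_num : (0 : ℝ) ≤ 1 / 2),
      ENNReal.mul_rpow_of_nonneg _ _ (by norm_num : (0 : ℝ) ≤ 1 / 2), ← ENNReal.rpow_mul,
      ← ENNReal.rpow_mul, ← ENNReal.rpow_mul]
    have e3 : r ^ (d : ℝ) * V * (r ^ (d / p - d) * N) = V * r ^ (d / p) * N := by
      calc _ = V * (r ^ (d : ℝ) * r ^ (d / p - d)) * N := by ring
        _ = _ := by rw [← ENNReal.rpow_add _ _ hr0 hrt]; congr 3; ring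
    have e4 : r ^ (d * (1 / 2) : ℝ) * V ^ (1 / 2 : ℝ) *
        (r ^ ((2 * (d / p) - d) * (1 / 2)) * N ^ (2 * (1 / 2) : ℝ)) =
        V ^ (1 / 2 : ℝ) * r ^ (d / p) * N := by
      calc _ = V ^ (1 / 2 : ℝ) * (r ^ (d * (1 / 2) : ℝ) * r ^ ((2 * (d / p) - d) * (1 / 2)))
            * N ^ (2 * (1 / 2) : ℝ) := by ring
        _ = _ := by
          rw [← ENNReal.rpow_add _ _ hr0 hrt]
          congr 2
          · congr 1; ring_nf
          · norm_num
    rw [e3, e4, add_mul, add_mul]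

/-! ### Frequency annuli and translations -/

theorem norm_fourierChar_sub_one (t : ℝ) :
    ‖(Real.fourierChar t : ℂ) - 1‖ = 2 * |Real.sin (Real.pi * t)| := by
  rw [Real.fourierChar_apply, mul_comm, Complex.norm_exp_I_mul_ofReal_sub_one, norm_mul,
    Real.norm_eq_abs, Real.norm_eq_abs, abs_two]
  congr 3
  ring

theorem le_norm_fourierChar_sub_one {t : ℝ} (ht : |t| ≤ 1 / 2) :
    4 * |t| ≤ ‖(Real.fourierChar t : ℂ) - 1‖ := by
  have hpi := Real.pi_pos
  rw [norm_fourierChar_sub_one]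
  have h := Real.mul_abs_le_abs_sin (x := Real.pi * t) (by
    rw [abs_mul, abs_of_pos hpi]; nlinarith)
  rw [abs_mul, abs_of_pos hpi] at h
  have : 2 / Real.pi * (Real.pi * |t|) = 2 * |t| := by field_simp
  linarith

/-- The dyadic annulus `R ≤ |ξ| < 2R`. -/
def annulus (d : ℕ) (R : ℝ) : Set (Eu d) := {ξ | R ≤ ‖ξ‖ ∧ ‖ξ‖ < 2 * R}

theorem measurableSet_annulus (R : ℝ) : MeasurableSet (annulus d R) :=
  (measurableSet_le measurable_const measurable_norm).inter
    (measurableSet_lt measurable_norm measurable_const)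

/-- The shell of translations `r / 2 < |h| < r`, with `r = 1 / (4R)`, adapted to the frequencies
in `annulus d R`. -/
def shell (d : ℕ) (R : ℝ) : Set (Eu d) := {h | 1 / (8 * R) < ‖h‖ ∧ ‖h‖ < 1 / (4 * R)}

theorem measurableSet_shell (R : ℝ) : MeasurableSet (shell d R) :=
  (measurableSet_lt measurable_const measurable_norm).inter
    (measurableSet_lt measurable_norm measurable_const)

/-- On average over the translations `h` of the shell, the factor `|e^{2πi h·ξ} - 1|` is bounded
below for the frequencies `ξ` of the annulus. -/
theorem le_setLIntegral_shell {R : ℝ} (hR : 0 < R) {ξ : Eu d} (hξ : ξ ∈ annulus d R) :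
    ENNReal.ofReal (1 / 2) *
      (ENNReal.ofReal (1 / (16 * R)) ^ d * volume (Metric.ball (0 : Eu d) 1)) ≤
      ∫⁻ h in shell d R, ‖(Real.fourierChar (inner ℝ h ξ) : ℂ) - 1‖ₑ := by
  obtain ⟨h1, h2⟩ := hξ
  have hξ0 : 0 < ‖ξ‖ := hR.trans_le h1
  -- the ball of radius `1 / (16 * R)` in the middle of the shell in the direction of `ξ`, on which
  -- the phase `inner ℝ h ξ` lies between `1 / 8` and `1 / 2`
  rw [← volume_ball_eq ((3 / (16 * R) * ‖ξ‖⁻¹) • ξ) (by positivity : 0 < 1 / (16 * R)),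
    ← setLIntegral_const]
  have hcn : ‖(3 / (16 * R) * ‖ξ‖⁻¹) • ξ‖ = 3 / (16 * R) := by
    rw [norm_smul, Real.norm_of_nonneg (by positivity)]
    field_simp
  have hin : ∀ h ∈ Metric.ball ((3 / (16 * R) * ‖ξ‖⁻¹) • ξ) (1 / (16 * R)),
      h ∈ shell d R ∧ 1 / 8 ≤ inner ℝ h ξ := by
    intro h hh
    rw [mem_ball_iff_norm] at hh
    have e1 : 3 / (16 * R) = 1 / (16 * R) + 1 / (8 * R) := by field_simp; norm_num
    have e2 : 1 / (4 * R) = 1 / (16 * R) + 3 / (16 * R) := by field_simp; norm_num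
    refine ⟨⟨?_, ?_⟩, ?_⟩
    · have := norm_sub_norm_le ((3 / (16 * R) * ‖ξ‖⁻¹) • ξ) h
      rw [hcn, norm_sub_rev] at this
      linarith
    · have := norm_le_norm_sub_add h ((3 / (16 * R) * ‖ξ‖⁻¹) • ξ)
      rw [hcn] at this
      linarith
    · have e3 : h = (3 / (16 * R) * ‖ξ‖⁻¹) • ξ + (h - (3 / (16 * R) * ‖ξ‖⁻¹) • ξ) := by abel
      rw [e3, inner_add_left, inner_smul_left, real_inner_self_eq_norm_sq]
      have h4 := neg_le_of_abs_le (abs_real_inner_le_norm (h - (3 / (16 * R) * ‖ξ‖⁻¹) • ξ) ξ)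
      have h5 : ‖h - (3 / (16 * R) * ‖ξ‖⁻¹) • ξ‖ * ‖ξ‖ ≤ 1 / (16 * R) * ‖ξ‖ := by gcongr
      have h6 : (starRingEnd ℝ) (3 / (16 * R) * ‖ξ‖⁻¹) * ‖ξ‖ ^ 2 = 3 / (16 * R) * ‖ξ‖ := by
        simp; field_simp
      have h7 : 1 / 8 ≤ 1 / (8 * R) * ‖ξ‖ := by
        rw [div_mul_eq_mul_div, div_le_div_iff₀ (by norm_num) (by positivity)]
        linarith
      have h8 : 3 / (16 * R) * ‖ξ‖ = 1 / (16 * R) * ‖ξ‖ + 1 / (8 * R) * ‖ξ‖ := by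
        rw [e1, add_mul]
      rw [h6]
      linarith
  refine (setLIntegral_mono' measurableSet_ball fun h hh => ?_).trans
    (lintegral_mono_set fun h hh => (hin h hh).1)
  obtain ⟨⟨h3, h4⟩, h5⟩ := hin h hh
  rw [← ofReal_norm]
  refine ENNReal.ofReal_le_ofReal ?_
  refine le_trans ?_ (le_norm_fourierChar_sub_one ?_)
  · have := le_abs_self (inner ℝ h ξ)
    linarith
  · refine (abs_real_inner_le_norm h ξ).trans ?_
    have : ‖h‖ * ‖ξ‖ ≤ 1 / (4 * R) * (2 * R) := by gcongr
    refine this.trans (le_of_eq ?_)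
    field_simp
    norm_num

/-- The size of `û` on a dyadic annulus is controlled by the `L^p` modulus of continuity of `u`
at the dual scale. -/
theorem setLIntegral_annulus_hasFourier_le (d : ℕ) : ∃ C : ℝ≥0, ∀ (p : ℝ), 1 ≤ p → p ≤ 2 →
    ∀ (u g : Eu d → ℂ), MemLp u (ENNReal.ofReal p) → HasFourier u g → ∀ R : ℝ, 0 < R →
      ∫⁻ ξ in annulus d R, ‖g ξ‖ₑ ≤ C * ENNReal.ofReal R ^ (d + d / p : ℝ) *
        ∫⁻ h in shell d R, eLpNorm (fun x => u (x + h) - u x) (ENNReal.ofReal p) := by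
  obtain ⟨C, hC⟩ := setLIntegral_ball_hasFourier_le d
  set V : ℝ≥0∞ := volume (Metric.ball (0 : Eu d) 1) with hV
  have hVt : V ≠ ∞ := measure_ball_lt_top.ne
  have hV0 : V ≠ 0 := (Metric.measure_ball_pos _ _ one_pos).ne'
  refine ⟨(2 * 16 ^ d * V⁻¹).toNNReal * C * 2 ^ d, fun p hp1 hp2 u g hu hg R hR => ?_⟩
  have hp0 : 0 < p := by linarith
  set r := ENNReal.ofReal R with hr
  have hr0 : r ≠ 0 := by simpa [hr] using hR
  have hrt : r ≠ ∞ := by simp [hr]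
  set I := ∫⁻ h in shell d R, eLpNorm (fun x => u (x + h) - u x) (ENNReal.ofReal p) with hI
  -- the lower bound of the averaged multiplier
  set m : ℝ≥0∞ := ENNReal.ofReal (1 / 2) * (ENNReal.ofReal (1 / (16 * R)) ^ d * V) with hm
  have hgm : AEMeasurable g := hg.1.aestronglyMeasurable.aemeasurable
  have h1 : m * ∫⁻ ξ in annulus d R, ‖g ξ‖ₑ ≤ C * (2 * r) ^ (d / p) * I := by
    calc m * ∫⁻ ξ in annulus d R, ‖g ξ‖ₑ = ∫⁻ ξ in annulus d R, m * ‖g ξ‖ₑ := by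
          rw [lintegral_const_mul'']
          exact hgm.enorm.restrict
      _ ≤ ∫⁻ ξ in annulus d R, ∫⁻ h in shell d R,
            ‖(Real.fourierChar (inner ℝ h ξ) : ℂ) - 1‖ₑ * ‖g ξ‖ₑ := by
          refine setLIntegral_mono' (measurableSet_annulus R) fun ξ hξ => ?_
          rw [lintegral_mul_const']
          · gcongr
            exact le_setLIntegral_shell hR hξ
          · exact enorm_ne_top
      _ = ∫⁻ h in shell d R, ∫⁻ ξ in annulus d R,
            ‖(Real.fourierChar (inner ℝ h ξ) : ℂ) - 1‖ₑ * ‖g ξ‖ₑ := by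
          refine lintegral_lintegral_swap ?_
          have hc : Continuous (fun q : Eu d × Eu d =>
              ‖(Real.fourierChar (inner ℝ q.2 q.1) : ℂ) - 1‖ₑ) := by fun_prop
          exact hc.aemeasurable.mul (hgm.enorm.restrict (s := annulus d R)).comp_fst
      _ ≤ ∫⁻ h in shell d R, C * (2 * r) ^ (d / p) *
            eLpNorm (fun x => u (x + h) - u x) (ENNReal.ofReal p) := by
          refine lintegral_mono fun h => ?_
          have hF := (hg.comp_add_right h).sub hg
          have hM : MemLp (fun x => u (x + h)) (ENNReal.ofReal p) :=
            hu.comp_measurePreserving (measurePreserving_add_right volume h)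
          have hb := hC p hp1 hp2 _ _ (hM.sub hu) hF (2 * R) (by linarith)
          rw [ENNReal.ofReal_mul (by norm_num), ENNReal.ofReal_ofNat] at hb
          refine le_trans ?_ hb
          refine le_trans ?_ (lintegral_mono_set (s := annulus d R) fun ξ hξ => ?_)
          · refine le_of_eq (lintegral_congr fun ξ => ?_)
            rw [← enorm_mul]
            simp [sub_mul]
          · simpa using hξ.2
      _ = _ := by
          rw [lintegral_const_mul' _ _ ?_]
          finiteness
  have hmm : m⁻¹ = 2 * 16 ^ d * V⁻¹ * r ^ d := by
    have e1 : ENNReal.ofReal (1 / (16 * R)) = (16 * r)⁻¹ := by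
      rw [one_div, ENNReal.ofReal_inv_of_pos (by positivity), ENNReal.ofReal_mul (by norm_num),
        ENNReal.ofReal_ofNat]
    have e2 : ENNReal.ofReal (1 / 2) = 2⁻¹ := by
      rw [one_div, ENNReal.ofReal_inv_of_pos (by positivity), ENNReal.ofReal_ofNat]
    have hr16 : (16 * r)⁻¹ ^ d ≠ 0 := pow_ne_zero _ (ENNReal.inv_ne_zero.2 (by finiteness))
    rw [hm, e1, e2, ENNReal.mul_inv (Or.inr (by finiteness))
      (Or.inl (by simp)), inv_inv, ENNReal.mul_inv (Or.inr hVt) (Or.inr hV0),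
      ← ENNReal.inv_pow, inv_inv, mul_pow]
    ring
  have hm0 : m ≠ 0 := by
    intro h0
    rw [h0, ENNReal.inv_zero] at hmm
    have : 2 * 16 ^ d * V⁻¹ * r ^ d ≠ ∞ := by finiteness
    exact this hmm.symm
  have hmt : m ≠ ∞ := by rw [hm]; finiteness
  calc ∫⁻ ξ in annulus d R, ‖g ξ‖ₑ = m⁻¹ * (m * ∫⁻ ξ in annulus d R, ‖g ξ‖ₑ) := by
        rw [← mul_assoc, ENNReal.inv_mul_cancel hm0 hmt, one_mul]
    _ ≤ m⁻¹ * (C * (2 * r) ^ (d / p) * I) := by gcongr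
    _ ≤ (2 * 16 ^ d * V⁻¹ * r ^ d) * (C * (2 ^ d * r ^ (d / p)) * I) := by
        rw [hmm]
        gcongr
        rw [ENNReal.mul_rpow_of_nonneg _ _ (by positivity)]
        gcongr
        rw [← ENNReal.rpow_natCast]
        refine ENNReal.rpow_le_rpow_of_exponent_le (by norm_num) ?_
        exact div_le_self (by positivity) hp1
    _ = _ := by
        rw [ENNReal.coe_mul, ENNReal.coe_mul, ENNReal.coe_toNNReal (by finiteness),
          ENNReal.rpow_add _ _ hr0 hrt, ENNReal.rpow_natCast]
        push_cast
        ring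

/-! ### Weak gradients and dyadic decomposition -/

theorem IsRegular.congr_ae {f : 𝓢'(Eu d, ℂ)} {u v : Eu d → ℂ} (h : IsRegular f u)
    (huv : u =ᵐ[volume] v) : IsRegular f v := by
  refine ⟨fun x => ?_, fun φ => ?_⟩
  · obtain ⟨U, hU, hi⟩ := h.1 x
    exact ⟨U, hU, hi.congr (ae_restrict_of_ae huv)⟩
  · have he : (fun x => φ x * u x) =ᵐ[volume] fun x => φ x * v x := by
      filter_upwards [huv] with x hx
      rw [hx]
    exact ⟨(h.2 φ).1.congr he, by rw [(h.2 φ).2, integral_congr_ae he]⟩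

theorem IsWeakGradient.ae_eq {n : ℕ} {f : 𝓢'(Eu d, ℂ)}
    {G G' : Eu d → EuclideanSpace ℂ (Fin n → Fin d)} (h : IsWeakGradient n f G)
    (h' : IsWeakGradient n f G') : G =ᵐ[volume] G' := by
  have : ∀ᵐ x, ∀ i, G x i = G' x i := ae_all_iff.2 fun i => (h i).ae_eq (h' i)
  filter_upwards [this] with x hx
  ext i
  exact hx i

/-- The infimum defining `gradientLpNorm` is over functions that agree almost everywhere, so any weak
gradient computes it. -/
theorem gradientLpNorm_eq {n : ℕ} {f : 𝓢'(Eu d, ℂ)}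
    {G : Eu d → EuclideanSpace ℂ (Fin n → Fin d)} (h : IsWeakGradient n f G) (p : ℝ) :
    gradientLpNorm n p f = eLpNorm G (ENNReal.ofReal p) := by
  refine le_antisymm (iInf₂_le G h) (le_iInf₂ fun G' h' => ?_)
  exact (eLpNorm_congr_ae (h.ae_eq h')).le

theorem gagliardoSeminorm_eq {n : ℕ} {f : 𝓢'(Eu d, ℂ)}
    {G : Eu d → EuclideanSpace ℂ (Fin n → Fin d)} (h : IsWeakGradient n f G) (θ p : ℝ) :
    gagliardoSeminorm n θ p f =
      (∫⁻ x, ∫⁻ y, ‖G x - G y‖ₑ ^ p / ‖x - y‖ₑ ^ ((d : ℝ) + θ * p)) ^ (1 / p) := by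
  refine le_antisymm (iInf₂_le G h) (le_iInf₂ fun G' h' => le_of_eq ?_)
  congr 1
  refine lintegral_congr_ae ?_
  filter_upwards [h.ae_eq h'] with x hx
  refine lintegral_congr_ae ?_
  filter_upwards [h.ae_eq h'] with y hy
  rw [hx, hy]

theorem IsWeakGradient.aestronglyMeasurable {n : ℕ} {f : 𝓢'(Eu d, ℂ)}
    {G : Eu d → EuclideanSpace ℂ (Fin n → Fin d)} (h : IsWeakGradient n f G) :
    AEStronglyMeasurable G := by
  have h1 : AEMeasurable (fun x => (fun i => G x i : (Fin n → Fin d) → ℂ)) :=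
    aemeasurable_pi_iff.2 fun i => (h i).1.aestronglyMeasurable.aemeasurable
  have h2 : Continuous (fun v : (Fin n → Fin d) → ℂ => WithLp.toLp 2 v) :=
    PiLp.continuous_toLp 2 _
  exact (h2.comp_aestronglyMeasurable h1.aestronglyMeasurable)

/-- A distribution whose weak gradient has finite norm has a strongly measurable weak gradient. -/
theorem exists_isWeakGradient {n : ℕ} {p : ℝ} {f : 𝓢'(Eu d, ℂ)} (h : gradientLpNorm n p f < ∞) :
    ∃ G, IsWeakGradient n f G ∧ StronglyMeasurable G ∧ MemLp G (ENNReal.ofReal p) := by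
  obtain ⟨G, hG⟩ := iInf_lt_iff.1 h
  obtain ⟨hG, hlt⟩ := iInf_lt_iff.1 hG
  have hm := hG.aestronglyMeasurable
  refine ⟨hm.mk G, fun i => (hG i).congr_ae ?_, hm.stronglyMeasurable_mk, ?_⟩
  · filter_upwards [hm.ae_eq_mk] with x hx
    rw [← hx]
  · exact MemLp.ae_eq hm.ae_eq_mk ⟨hm, hlt⟩

theorem _root_.MeasureTheory.MemLp.euclideanSpace_apply {ι : Type*} [Fintype ι] {p : ℝ≥0∞}
    {G : Eu d → EuclideanSpace ℂ ι} (hG : MemLp G p) (i : ι) : MemLp (fun x => G x i) p := by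
  refine MemLp.mono hG ?_ (Filter.Eventually.of_forall fun x => PiLp.norm_apply_le (G x) i)
  have h2 : Continuous (fun v : EuclideanSpace ℂ ι => v i) := by fun_prop
  exact h2.comp_aestronglyMeasurable hG.1

/-- The symbol of `∂^i` with `i` a tuple of coordinate directions. -/
noncomputable def derivSymbol {n : ℕ} (i : Fin n → Fin d) (ξ : Eu d) : ℂ :=
  ∏ j, (2 * Real.pi * Complex.I * (ξ (i j) : ℝ))

theorem IsWeakGradient.hasFourier {n : ℕ} {f : 𝓢'(Eu d, ℂ)}
    {G : Eu d → EuclideanSpace ℂ (Fin n → Fin d)} (h : IsWeakGradient n f G) {g : Eu d → ℂ}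
    (hg : IsRegular (𝓕 f) g) (i : Fin n → Fin d) :
    HasFourier (fun x => G x i) (fun ξ => derivSymbol i ξ * g ξ) := by
  have := hg.fourier_iteratedLineDerivOp (fun j => EuclideanSpace.single (i j) (1 : ℝ))
  refine (h i).hasFourier ?_
  convert this using 4 with ξ
  simp [derivSymbol, EuclideanSpace.inner_single_right]

/-- The symbols of the derivatives of order `n` together dominate `|ξ|^n`. -/
theorem norm_pow_le_sum_derivSymbol (n : ℕ) (ξ : Eu d) :
    ‖ξ‖ ^ n ≤ ∑ i : Fin n → Fin d, ‖derivSymbol i ξ‖ := by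
  have h1 : ‖ξ‖ ≤ ∑ j, |ξ j| := by
    rw [EuclideanSpace.norm_eq]
    refine Real.sqrt_le_iff.2 ⟨Finset.sum_nonneg fun _ _ => abs_nonneg _, ?_⟩
    refine (Finset.sum_sq_le_sq_sum_of_nonneg fun i _ => ?_).trans (le_of_eq ?_)
    · exact norm_nonneg _
    · rfl
  calc ‖ξ‖ ^ n ≤ (∑ j, |ξ j|) ^ n := by gcongr
    _ = ∑ i : Fin n → Fin d, ∏ j, |ξ (i j)| := Fintype.sum_pow _ _
    _ ≤ _ := by
      refine Finset.sum_le_sum fun i _ => ?_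
      rw [derivSymbol, norm_prod]
      refine Finset.prod_le_prod (fun _ _ => abs_nonneg _) fun j _ => ?_
      have : 1 ≤ 2 * Real.pi := by linarith [Real.two_le_pi]
      simp only [norm_mul, Complex.norm_ofNat, Complex.norm_real, Complex.norm_I, mul_one,
        Real.norm_eq_abs, abs_of_pos Real.pi_pos]
      exact le_mul_of_one_le_left (abs_nonneg _) this

theorem enorm_pow_mul_le_sum (n : ℕ) (g : Eu d → ℂ) (ξ : Eu d) :
    ‖ξ‖ₑ ^ n * ‖g ξ‖ₑ ≤ ∑ i : Fin n → Fin d, ‖derivSymbol i ξ * g ξ‖ₑ := by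
  simp_rw [enorm_mul, ← Finset.sum_mul]
  gcongr
  simp_rw [← ofReal_norm]
  rw [← ENNReal.ofReal_pow (norm_nonneg _),
    ← ENNReal.ofReal_sum_of_nonneg fun _ _ => norm_nonneg _]
  exact ENNReal.ofReal_le_ofReal (norm_pow_le_sum_derivSymbol n ξ)

/-- On the unit ball the weight `|ξ|^s` is at most `1`, and outside of it dominates `1`. -/
theorem barronNorm_le {s : ℝ} (hs : 0 ≤ s) {f : 𝓢'(Eu d, ℂ)} {g : Eu d → ℂ}
    (hg : IsRegular (𝓕 f) g) :
    barronNorm s f ≤ 2 * ((∫⁻ ξ in Metric.ball 0 1, ‖g ξ‖ₑ) +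
      ∫⁻ ξ in (Metric.ball 0 1)ᶜ, ‖ξ‖ₑ ^ s * ‖g ξ‖ₑ) := by
  have key : ∀ t, 0 ≤ t → t ≤ s → spectralNorm t f ≤ (∫⁻ ξ in Metric.ball 0 1, ‖g ξ‖ₑ) +
      ∫⁻ ξ in (Metric.ball 0 1)ᶜ, ‖ξ‖ₑ ^ s * ‖g ξ‖ₑ := by
    intro t ht hts
    refine (iInf₂_le g hg).trans ?_
    rw [← lintegral_add_compl _ (measurableSet_ball (x := (0 : Eu d)) (ε := 1))]
    have hB : MeasurableSet (Metric.ball (0 : Eu d) 1) := measurableSet_ball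
    refine add_le_add (setLIntegral_mono' hB fun ξ hξ => ?_)
      (setLIntegral_mono' hB.compl fun ξ hξ => ?_)
    · have : ‖ξ‖ₑ ≤ 1 := by
        rw [← ofReal_norm ξ]
        exact ENNReal.ofReal_le_one.2 (by simpa using (Metric.mem_ball.1 hξ).le)
      exact mul_le_of_le_one_left zero_le (ENNReal.rpow_le_one this ht)
    · have : 1 ≤ ‖ξ‖ₑ := by
        rw [← ofReal_norm]
        exact ENNReal.one_le_ofReal.2 (by simpa using hξ)
      gcongr
  rw [two_mul]
  exact add_le_add (key 0 le_rfl hs) (key s hs le_rfl)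

theorem compl_ball_subset_iUnion_annulus :
    (Metric.ball (0 : Eu d) 1)ᶜ ⊆ ⋃ j : ℕ, annulus d (2 ^ j) := by
  intro ξ hξ
  have h1 : 1 ≤ ‖ξ‖ := by simpa using hξ
  obtain ⟨j, hj1, hj2⟩ := exists_nat_pow_near h1 one_lt_two
  exact Set.mem_iUnion.2 ⟨j, hj1, by rwa [pow_succ'] at hj2⟩

/-- Dyadic decomposition of the frequencies `|ξ| ≥ 1`, on which `n` powers of `|ξ|` are traded for
derivatives of order `n`. -/
theorem lintegral_compl_ball_le (s : ℝ) (n : ℕ) {g : Eu d → ℂ} (hg : AEStronglyMeasurable g) :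
    ∫⁻ ξ in (Metric.ball 0 1)ᶜ, ‖ξ‖ₑ ^ s * ‖g ξ‖ₑ ≤ 2 ^ |s - n| *
      ∑' j : ℕ, ((2 : ℝ≥0∞) ^ j) ^ (s - n) *
        ∑ i : Fin n → Fin d, ∫⁻ ξ in annulus d (2 ^ j), ‖derivSymbol i ξ * g ξ‖ₑ := by
  calc ∫⁻ ξ in (Metric.ball 0 1)ᶜ, ‖ξ‖ₑ ^ s * ‖g ξ‖ₑ
      ≤ ∫⁻ ξ in ⋃ j : ℕ, annulus d (2 ^ j), ‖ξ‖ₑ ^ s * ‖g ξ‖ₑ :=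
        lintegral_mono_set compl_ball_subset_iUnion_annulus
    _ ≤ ∑' j : ℕ, ∫⁻ ξ in annulus d (2 ^ j), ‖ξ‖ₑ ^ s * ‖g ξ‖ₑ := lintegral_iUnion_le _ _
    _ ≤ ∑' j : ℕ, 2 ^ |s - n| * (((2 : ℝ≥0∞) ^ j) ^ (s - n) *
        ∑ i : Fin n → Fin d, ∫⁻ ξ in annulus d (2 ^ j), ‖derivSymbol i ξ * g ξ‖ₑ) := by
        refine ENNReal.tsum_le_tsum fun j => ?_
        have hr0 : ((2 : ℝ≥0∞) ^ j) ≠ 0 := by positivity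
        have hrt : ((2 : ℝ≥0∞) ^ j) ≠ ∞ := by finiteness
        have hsym : ∀ i : Fin n → Fin d, Continuous (derivSymbol (d := d) i) := by
          intro i
          unfold derivSymbol
          fun_prop
        have hme : ∀ i : Fin n → Fin d, AEMeasurable (fun ξ => ‖derivSymbol i ξ * g ξ‖ₑ)
            (volume.restrict (annulus d (2 ^ j))) := fun i =>
          (((hsym i).aestronglyMeasurable).mul hg).enorm.restrict
        rw [← lintegral_finsetSum' _ fun i _ => hme i, ← mul_assoc,
          ← lintegral_const_mul' _ _ (by
            refine ENNReal.mul_ne_top (by finiteness) ?_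
            exact ENNReal.rpow_ne_top_of_ne_zero hr0 hrt)]
        refine setLIntegral_mono' (measurableSet_annulus _) fun ξ hξ => ?_
        have h1 : (2 : ℝ≥0∞) ^ j ≤ ‖ξ‖ₑ := by
          rw [← ofReal_norm, ← ofReal_two_pow]
          exact ENNReal.ofReal_le_ofReal hξ.1
        have h2 : ‖ξ‖ₑ ≤ 2 * 2 ^ j := by
          rw [← ofReal_norm, ← pow_succ', ← ofReal_two_pow, pow_succ']
          exact ENNReal.ofReal_le_ofReal hξ.2.le
        have h0 : ‖ξ‖ₑ ≠ 0 := fun h => hr0 (le_antisymm (h ▸ h1) zero_le)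
        have h3 : ‖ξ‖ₑ ^ (s - n) ≤ 2 ^ |s - n| * (2 ^ j) ^ (s - n) := by
          rcases le_total 0 (s - n) with h | h
          · rw [abs_of_nonneg h, ← ENNReal.mul_rpow_of_nonneg _ _ h]
            gcongr
          · calc ‖ξ‖ₑ ^ (s - n) ≤ (2 ^ j) ^ (s - n) := ennreal_rpow_anti h1 h
              _ ≤ _ := le_mul_of_one_le_left zero_le
                  (ENNReal.one_rpow |s - n| ▸
                    ENNReal.rpow_le_rpow (by norm_num) (abs_nonneg (s - n)))
        calc ‖ξ‖ₑ ^ s * ‖g ξ‖ₑ = ‖ξ‖ₑ ^ (s - n) * (‖ξ‖ₑ ^ n * ‖g ξ‖ₑ) := by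
              rw [← mul_assoc, ← ENNReal.rpow_natCast, ← ENNReal.rpow_add _ _ h0 enorm_ne_top]
              simp
          _ ≤ _ := mul_le_mul' h3 (enorm_pow_mul_le_sum n g ξ)
    _ = _ := ENNReal.tsum_mul_left

/-! ### High frequencies in terms of the gradient -/

theorem tsum_two_pow_rpow_ne_top {e : ℝ} (he : e < 0) : ∑' j : ℕ, ((2 : ℝ≥0∞) ^ j) ^ e ≠ ∞ := by
  have h : ∀ j : ℕ, ((2 : ℝ≥0∞) ^ j) ^ e = (2 ^ e) ^ j := fun j => by
    rw [← ENNReal.rpow_natCast, ← ENNReal.rpow_natCast, ← ENNReal.rpow_mul, ← ENNReal.rpow_mul,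
      mul_comm]
  simp_rw [h, ENNReal.tsum_geometric]
  have : (2 : ℝ≥0∞) ^ e < 1 := ENNReal.rpow_lt_one_of_one_lt_of_neg (by norm_num) he
  exact ENNReal.inv_ne_top.2 (tsub_pos_of_lt this).ne'

theorem gradientLpNorm_le_sobolevNorm {α p : ℝ} {n : ℕ} (hn : n ≤ ⌊α⌋₊) (f : 𝓢'(Eu d, ℂ)) :
    gradientLpNorm n p f ≤ sobolevNorm α p f := by
  refine le_trans ?_ le_self_add
  exact Finset.single_le_sum (f := fun n => gradientLpNorm n p f) (fun _ _ => zero_le)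
    (Finset.mem_range.2 (Nat.lt_succ_of_le hn))

theorem continuouslyEmbeds_barron_of_le {α p s : ℝ}
    (h : ∃ C : ℝ≥0, ∀ f ∈ sobolevSpace d α p, barronNorm s f ≤ C * sobolevNorm α p f) :
    ContinuouslyEmbeds (sobolevSpace d α p) (sobolevNorm α p) (barronSpace d s)
      (barronNorm s) := by
  obtain ⟨C, hC⟩ := h
  exact ⟨fun f hf => (hC f hf).trans_lt (ENNReal.mul_lt_top ENNReal.coe_lt_top hf), C, hC⟩

/-- The low frequencies of a function in `W^α_p` are controlled by its `L^p` norm. It remains to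
estimate the frequencies `|ξ| ≥ 1`, dyadically and in terms of the gradient of order `⌊α⌋`. -/
theorem continuouslyEmbeds_barron_of_high_frequency {α p s : ℝ} (hs : 0 ≤ s) (hp1 : 1 ≤ p)
    (hp2 : p ≤ 2)
    (h : ∃ C : ℝ≥0, ∀ (f : 𝓢'(Eu d, ℂ)) (g : Eu d → ℂ)
      (G : Eu d → EuclideanSpace ℂ (Fin ⌊α⌋₊ → Fin d)), f ∈ sobolevSpace d α p →
      IsRegular (𝓕 f) g → IsWeakGradient ⌊α⌋₊ f G → StronglyMeasurable G →
      MemLp G (ENNReal.ofReal p) →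
      ∫⁻ ξ in (Metric.ball 0 1)ᶜ, ‖ξ‖ₑ ^ s * ‖g ξ‖ₑ ≤ C * sobolevNorm α p f) :
    ContinuouslyEmbeds (sobolevSpace d α p) (sobolevNorm α p) (barronSpace d s)
      (barronNorm s) := by
  obtain ⟨C, hC⟩ := h
  obtain ⟨C₀, hC₀⟩ := setLIntegral_ball_hasFourier_le d
  refine continuouslyEmbeds_barron_of_le ⟨2 * (C₀ + C), fun f hf => ?_⟩
  have hfin : ∀ n ≤ ⌊α⌋₊, gradientLpNorm n p f < ∞ := fun n hn =>
    (gradientLpNorm_le_sobolevNorm hn f).trans_lt hf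
  obtain ⟨G₀, hG₀, -, hG₀p⟩ := exists_isWeakGradient (hfin 0 (Nat.zero_le _))
  obtain ⟨G, hG, hGm, hGp⟩ := exists_isWeakGradient (hfin _ le_rfl)
  have hreg : IsRegular f (fun x => G₀ x Fin.elim0) := hG₀ Fin.elim0
  have hmem := hG₀p.euclideanSpace_apply Fin.elim0
  obtain ⟨g, hg⟩ := exists_hasFourier_of_memLp hp1 hp2 hmem
  have hFg := hg.isRegular hreg
  refine (barronNorm_le hs hFg).trans ?_
  have h0 := hC₀ p hp1 hp2 _ _ hmem hg 1 one_pos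
  rw [ENNReal.ofReal_one, ENNReal.one_rpow, mul_one] at h0
  have h1 : eLpNorm (fun x => G₀ x Fin.elim0) (ENNReal.ofReal p) ≤ sobolevNorm α p f := by
    refine le_trans ?_ (gradientLpNorm_le_sobolevNorm (Nat.zero_le _) f)
    rw [gradientLpNorm_eq hG₀]
    exact eLpNorm_mono fun x => PiLp.norm_apply_le (G₀ x) _
  push_cast
  rw [mul_assoc, add_mul]
  gcongr
  · exact h0.trans (by gcongr)
  · exact hC f g G hf hFg hG hGm hGp

/-- The high-frequency estimate when the gradient of order `⌊α⌋` already suffices. -/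
theorem high_frequency_le_gradient {p s : ℝ} (hp1 : 1 ≤ p) (hp2 : p ≤ 2) {n : ℕ}
    (hn : s + d / p < n) : ∃ C : ℝ≥0, ∀ (f : 𝓢'(Eu d, ℂ)) (g : Eu d → ℂ)
      (G : Eu d → EuclideanSpace ℂ (Fin n → Fin d)),
      IsRegular (𝓕 f) g → IsWeakGradient n f G → MemLp G (ENNReal.ofReal p) →
      ∫⁻ ξ in (Metric.ball 0 1)ᶜ, ‖ξ‖ₑ ^ s * ‖g ξ‖ₑ ≤ C * eLpNorm G (ENNReal.ofReal p) := by
  obtain ⟨C₀, hC₀⟩ := setLIntegral_ball_hasFourier_le d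
  set K := ∑' j : ℕ, ((2 : ℝ≥0∞) ^ j) ^ (s - n + d / p) with hK
  have hKt : K ≠ ∞ := tsum_two_pow_rpow_ne_top (by linarith)
  set D : ℝ≥0∞ := 2 ^ |s - n| * (K * ((Fintype.card (Fin n → Fin d) : ℝ≥0∞) *
    (C₀ * 2 ^ (d / p : ℝ)))) with hD
  have hDt : D ≠ ∞ := by
    have : (0 : ℝ) ≤ d / p := by positivity
    finiteness
  refine ⟨D.toNNReal, fun f g G hg hG hGp => ?_⟩
  rw [ENNReal.coe_toNNReal hDt]
  refine (lintegral_compl_ball_le s n hg.1.aestronglyMeasurable).trans ?_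
  rw [hD, mul_assoc, mul_assoc K]
  refine mul_le_mul_right ?_ _
  rw [hK, ← ENNReal.tsum_mul_right]
  refine ENNReal.tsum_le_tsum fun j => ?_
  have hr0 : ((2 : ℝ≥0∞) ^ j) ≠ 0 := by positivity
  have hrt : ((2 : ℝ≥0∞) ^ j) ≠ ∞ := by finiteness
  rw [ENNReal.rpow_add _ _ hr0 hrt, mul_assoc]
  refine mul_le_mul_right ?_ _
  calc ∑ i : Fin n → Fin d, ∫⁻ ξ in annulus d (2 ^ j), ‖derivSymbol i ξ * g ξ‖ₑ
      ≤ ∑ i : Fin n → Fin d, C₀ * (2 * 2 ^ j) ^ (d / p) * eLpNorm G (ENNReal.ofReal p) := by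
        refine Finset.sum_le_sum fun i _ => ?_
        have h1 := hC₀ p hp1 hp2 _ _ (hGp.euclideanSpace_apply i) (hG.hasFourier hg i)
          (2 * 2 ^ j) (by positivity)
        rw [← pow_succ', ofReal_two_pow, pow_succ', pow_succ'] at h1
        refine (lintegral_mono_set fun ξ hξ => ?_).trans (h1.trans ?_)
        · simpa using hξ.2
        · gcongr
          exact eLpNorm_mono fun x => PiLp.norm_apply_le (G x) i
    _ = _ := by
        rw [Finset.sum_const, Finset.card_univ, nsmul_eq_mul,
          ENNReal.mul_rpow_of_nonneg _ _ (by positivity)]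
        ring

/-- The Gagliardo double integral in terms of translations. -/
theorem lintegral_gagliardo_eq {F : Type*} [NormedAddCommGroup F] {G : Eu d → F}
    (hG : StronglyMeasurable G) (p e : ℝ) :
    ∫⁻ x, ∫⁻ y, ‖G x - G y‖ₑ ^ p / ‖x - y‖ₑ ^ e =
      ∫⁻ h : Eu d, (∫⁻ x, ‖G (x + h) - G x‖ₑ ^ p) / ‖h‖ₑ ^ e := by
  have hm1 : Measurable (fun q : Eu d × Eu d => ‖G q.1 - G q.2‖ₑ ^ p / ‖q.1 - q.2‖ₑ ^ e) := by
    have : StronglyMeasurable (fun q : Eu d × Eu d => G q.1 - G q.2) :=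
      (hG.comp_measurable measurable_fst).sub (hG.comp_measurable measurable_snd)
    exact (this.enorm.pow_const p).div ((measurable_fst.sub measurable_snd).enorm.pow_const e)
  have hm3 : Measurable (fun q : Eu d × Eu d => ‖G (q.1 + q.2) - G q.1‖ₑ ^ p) := by
    have : StronglyMeasurable (fun q : Eu d × Eu d => G (q.1 + q.2) - G q.1) :=
      (hG.comp_measurable (measurable_fst.add measurable_snd)).sub
        (hG.comp_measurable measurable_fst)
    exact this.enorm.pow_const p
  have hm2 : Measurable (fun q : Eu d × Eu d => ‖G (q.1 + q.2) - G q.1‖ₑ ^ p / ‖q.2‖ₑ ^ e) :=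
    hm3.div (measurable_snd.enorm.pow_const e)
  rw [lintegral_lintegral_swap hm1.aemeasurable]
  calc ∫⁻ y, ∫⁻ x, ‖G x - G y‖ₑ ^ p / ‖x - y‖ₑ ^ e
      = ∫⁻ y, ∫⁻ h, ‖G (y + h) - G y‖ₑ ^ p / ‖h‖ₑ ^ e := by
        refine lintegral_congr fun y => ?_
        rw [← lintegral_add_left_eq_self _ y]
        simp
    _ = ∫⁻ h, ∫⁻ y, ‖G (y + h) - G y‖ₑ ^ p / ‖h‖ₑ ^ e := lintegral_lintegral_swap hm2.aemeasurable
    _ = _ := by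
        refine lintegral_congr fun h => ?_
        simp_rw [div_eq_mul_inv]
        rw [lintegral_mul_const]
        exact hm3.comp (measurable_id.prodMk measurable_const)

/-! ### High frequencies in terms of differences -/

/-- The high-frequency estimate in terms of the `L^p` modulus of continuity of the gradient of order
`n`, averaged over shells of translations. -/
theorem high_frequency_le_modulus (d : ℕ) (s : ℝ) {p : ℝ} (hp1 : 1 ≤ p) (hp2 : p ≤ 2) (n : ℕ) :
    ∃ C : ℝ≥0, ∀ (f : 𝓢'(Eu d, ℂ)) (g : Eu d → ℂ)
      (G : Eu d → EuclideanSpace ℂ (Fin n → Fin d)),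
      IsRegular (𝓕 f) g → IsWeakGradient n f G → MemLp G (ENNReal.ofReal p) →
      ∫⁻ ξ in (Metric.ball 0 1)ᶜ, ‖ξ‖ₑ ^ s * ‖g ξ‖ₑ ≤
        C * ∑' j : ℕ, ((2 : ℝ≥0∞) ^ j) ^ (s - n + d + d / p) *
          ∫⁻ h in shell d (2 ^ j), eLpNorm (fun x => G (x + h) - G x) (ENNReal.ofReal p) := by
  obtain ⟨C₀, hC₀⟩ := setLIntegral_annulus_hasFourier_le d
  set D : ℝ≥0∞ := 2 ^ |s - n| * ((Fintype.card (Fin n → Fin d) : ℝ≥0∞) * C₀) with hD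
  have hDt : D ≠ ∞ := by finiteness
  refine ⟨D.toNNReal, fun f g G hg hG hGp => ?_⟩
  rw [ENNReal.coe_toNNReal hDt]
  refine (lintegral_compl_ball_le s n hg.1.aestronglyMeasurable).trans ?_
  rw [hD, mul_assoc]
  refine mul_le_mul_right ?_ _
  rw [← ENNReal.tsum_mul_left]
  refine ENNReal.tsum_le_tsum fun j => ?_
  have hr0 : ((2 : ℝ≥0∞) ^ j) ≠ 0 := by positivity
  have hrt : ((2 : ℝ≥0∞) ^ j) ≠ ∞ := by finiteness
  rw [add_assoc, ENNReal.rpow_add _ _ hr0 hrt, mul_left_comm, mul_assoc]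
  refine mul_le_mul_right ?_ _
  calc ∑ i : Fin n → Fin d, ∫⁻ ξ in annulus d (2 ^ j), ‖derivSymbol i ξ * g ξ‖ₑ
      ≤ ∑ i : Fin n → Fin d, C₀ * (2 ^ j) ^ (d + d / p : ℝ) *
          ∫⁻ h in shell d (2 ^ j), eLpNorm (fun x => G (x + h) - G x) (ENNReal.ofReal p) := by
        refine Finset.sum_le_sum fun i _ => ?_
        have h1 := hC₀ p hp1 hp2 _ _ (hGp.euclideanSpace_apply i) (hG.hasFourier hg i)
          (2 ^ j) (by positivity)
        rw [ofReal_two_pow] at h1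
        refine h1.trans ?_
        gcongr with h
        exact eLpNorm_mono fun x => PiLp.norm_apply_le (G (x + h) - G x) i
    _ = _ := by
        rw [Finset.sum_const, Finset.card_univ, nsmul_eq_mul]
        ring

theorem enorm_le_of_mem_shell {j : ℕ} {h : Eu d} (hh : h ∈ shell d (2 ^ j)) :
    ‖h‖ₑ ≤ (2 ^ j)⁻¹ := by
  rw [← ofReal_norm, ← ofReal_two_pow, ← ENNReal.ofReal_inv_of_pos (by positivity)]
  refine ENNReal.ofReal_le_ofReal (hh.2.le.trans ?_)
  rw [← one_div]
  gcongr
  exact le_mul_of_one_le_left (by positivity) (by norm_num)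

/-- On the shell at scale `2^{-j}`, the weight `|h|^{-e}` is at least `2^{je}`. -/
theorem two_pow_mul_setLIntegral_shell_le {e : ℝ} (he : 0 ≤ e) (j : ℕ) (Φ : Eu d → ℝ≥0∞) :
    ((2 : ℝ≥0∞) ^ j) ^ e * ∫⁻ h in shell d (2 ^ j), Φ h ≤
      ∫⁻ h in shell d (2 ^ j), Φ h / ‖h‖ₑ ^ e := by
  rw [← lintegral_const_mul' _ _ (ENNReal.rpow_ne_top_of_nonneg he (by finiteness))]
  refine setLIntegral_mono' (measurableSet_shell _) fun h hh => ?_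
  rw [mul_comm, div_eq_mul_inv]
  gcongr
  rw [← ENNReal.inv_rpow]
  refine ENNReal.rpow_le_rpow ?_ he
  rw [ENNReal.le_inv_iff_le_inv]
  exact enorm_le_of_mem_shell hh

theorem pairwise_disjoint_shell : Pairwise (Function.onFun Disjoint fun j : ℕ => shell d (2 ^ j)) := by
  have key : ∀ i j : ℕ, i < j → Disjoint (shell d (2 ^ i)) (shell d (2 ^ j)) := by
    intro i j hij
    rw [Set.disjoint_left]
    rintro h ⟨h1, -⟩ ⟨-, h2⟩
    have h3 : (2 : ℝ) ^ (i + 1) ≤ 2 ^ j := pow_le_pow_right₀ (by norm_num) hij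
    have h4 : (1 : ℝ) / (4 * 2 ^ j) ≤ 1 / (8 * 2 ^ i) := by
      rw [pow_succ] at h3
      exact one_div_le_one_div_of_le (by positivity) (by linarith)
    linarith
  intro i j hij
  rcases lt_or_gt_of_ne hij with h | h
  · exact key i j h
  · exact (key j i h).symm

theorem measurable_eLpNorm_translate_sub {F : Type*} [NormedAddCommGroup F] {G : Eu d → F}
    (hG : StronglyMeasurable G) {p : ℝ} (hp : 0 < p) :
    Measurable (fun h : Eu d => eLpNorm (fun x => G (x + h) - G x) (ENNReal.ofReal p)) := by
  have hm3 : Measurable (fun q : Eu d × Eu d => ‖G (q.2 + q.1) - G q.2‖ₑ ^ p) := by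
    have : StronglyMeasurable (fun q : Eu d × Eu d => G (q.2 + q.1) - G q.2) :=
      (hG.comp_measurable (measurable_snd.add measurable_fst)).sub
        (hG.comp_measurable measurable_snd)
    exact this.enorm.pow_const p
  have he : ∀ h : Eu d, eLpNorm (fun x => G (x + h) - G x) (ENNReal.ofReal p) =
      (∫⁻ x, ‖G (x + h) - G x‖ₑ ^ p) ^ (1 / p) := by
    intro h
    rw [← eLpNorm_ofReal_rpow _ hp, ← ENNReal.rpow_mul, mul_one_div_cancel hp.ne',
      ENNReal.rpow_one]
  simp_rw [he]
  exact hm3.lintegral_prod_right'.pow_const _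

/-- Hölder's inequality on a set of finite measure. -/
theorem setLIntegral_le_measure_rpow_mul {Φ : Eu d → ℝ≥0∞} (hΦ : Measurable Φ) {p : ℝ}
    (hp : 1 ≤ p) (S : Set (Eu d)) :
    ∫⁻ h in S, Φ h ≤ volume S ^ (1 - 1 / p) * (∫⁻ h in S, Φ h ^ p) ^ (1 / p) := by
  rcases hp.eq_or_lt with rfl | hp
  · simp
  · have hpq := Real.HolderConjugate.conjExponent hp
    have h := ENNReal.lintegral_mul_le_Lp_mul_Lq (volume.restrict S) hpq hΦ.aemeasurable
      (aemeasurable_const (b := (1 : ℝ≥0∞)))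
    simp only [Pi.mul_apply, mul_one, ENNReal.one_rpow, lintegral_const, one_mul,
      Measure.restrict_apply_univ] at h
    rw [mul_comm]
    convert h using 3
    rw [one_div, one_div, hpq.one_sub_inv]

/-- The modulus of continuity of `G` at scale `2^{-j}` in terms of its Gagliardo seminorm. -/
theorem setLIntegral_shell_eLpNorm_le {F : Type*} [NormedAddCommGroup F] {G : Eu d → F}
    (hG : StronglyMeasurable G) {p θ : ℝ} (hp : 1 ≤ p) (hθ : 0 ≤ θ) (j : ℕ) :
    ∫⁻ h in shell d (2 ^ j), eLpNorm (fun x => G (x + h) - G x) (ENNReal.ofReal p) ≤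
      volume (Metric.ball (0 : Eu d) 1) ^ (1 - 1 / p) * ((2 : ℝ≥0∞) ^ j) ^ (-d - θ) *
        (∫⁻ x, ∫⁻ y, ‖G x - G y‖ₑ ^ p / ‖x - y‖ₑ ^ ((d : ℝ) + θ * p)) ^ (1 / p) := by
  have hp0 : 0 < p := by linarith
  have hr0 : ((2 : ℝ≥0∞) ^ j) ≠ 0 := by positivity
  have hrt : ((2 : ℝ≥0∞) ^ j) ≠ ∞ := by finiteness
  have he : 0 ≤ (d : ℝ) + θ * p := by positivity
  have h1p : 0 ≤ 1 - 1 / p := by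
    rw [sub_nonneg, div_le_one hp0]
    exact hp
  refine (setLIntegral_le_measure_rpow_mul (measurable_eLpNorm_translate_sub hG hp0) hp _).trans ?_
  simp_rw [eLpNorm_ofReal_rpow _ hp0]
  rw [lintegral_gagliardo_eq hG]
  have hvol : volume (shell d (2 ^ j)) ≤
      ((2 : ℝ≥0∞) ^ j) ^ (-d : ℝ) * volume (Metric.ball (0 : Eu d) 1) := by
    have hsub : shell d (2 ^ j) ⊆ Metric.ball 0 ((2 ^ j)⁻¹) := by
      intro h hh
      rw [mem_ball_zero_iff]
      refine hh.2.trans_le ?_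
      rw [← one_div]
      gcongr
      exact le_mul_of_one_le_left (by positivity) (by norm_num)
    refine (measure_mono hsub).trans (le_of_eq ?_)
    rw [volume_ball_eq _ (by positivity), ENNReal.ofReal_inv_of_pos (by positivity),
      ofReal_two_pow, ENNReal.rpow_neg, ENNReal.rpow_natCast, ← ENNReal.inv_pow (a := 2 ^ j)]
  set J := ∫⁻ h : Eu d, (∫⁻ x, ‖G (x + h) - G x‖ₑ ^ p) / ‖h‖ₑ ^ ((d : ℝ) + θ * p) with hJ
  have hint : ∫⁻ h in shell d (2 ^ j), ∫⁻ x, ‖G (x + h) - G x‖ₑ ^ p ≤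
      ((2 : ℝ≥0∞) ^ j) ^ (-(d + θ * p)) * J := by
    have h2 := (two_pow_mul_setLIntegral_shell_le he j
      (fun h : Eu d => ∫⁻ x, ‖G (x + h) - G x‖ₑ ^ p)).trans (setLIntegral_le_lintegral _ _)
    rw [← hJ] at h2
    rw [ENNReal.rpow_neg, mul_comm, ← div_eq_mul_inv, ENNReal.le_div_iff_mul_le, mul_comm]
    · exact h2
    · exact Or.inl (ENNReal.rpow_pos (pos_iff_ne_zero.2 hr0) hrt).ne'
    · exact Or.inl (ENNReal.rpow_ne_top_of_ne_zero hr0 hrt)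
  calc volume (shell d (2 ^ j)) ^ (1 - 1 / p) *
        (∫⁻ h in shell d (2 ^ j), ∫⁻ x, ‖G (x + h) - G x‖ₑ ^ p) ^ (1 / p)
      ≤ (((2 : ℝ≥0∞) ^ j) ^ (-d : ℝ) * volume (Metric.ball (0 : Eu d) 1)) ^ (1 - 1 / p) *
        (((2 : ℝ≥0∞) ^ j) ^ (-(d + θ * p)) * J) ^ (1 / p) := by
        gcongr
    _ = _ := by
        rw [ENNReal.mul_rpow_of_nonneg _ _ h1p, ENNReal.mul_rpow_of_nonneg _ _ (by positivity),
          ← ENNReal.rpow_mul, ← ENNReal.rpow_mul]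
        have : (-d - θ : ℝ) = -d * (1 - 1 / p) + -(d + θ * p) * (1 / p) := by
          field_simp
          ring
        rw [this, ENNReal.rpow_add _ _ hr0 hrt]
        ring

theorem gagliardoSeminorm_le_sobolevNorm {α p : ℝ} (hα : ¬ IsInteger α) (f : 𝓢'(Eu d, ℂ)) :
    gagliardoSeminorm ⌊α⌋₊ (α - ⌊α⌋₊) p f ≤ sobolevNorm α p f := by
  rw [sobolevNorm, if_neg hα]
  exact le_add_self

theorem natFloor_eq_of_isInteger {α : ℝ} (hα : 0 ≤ α) (h : IsInteger α) : (⌊α⌋₊ : ℝ) = α := by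
  obtain ⟨k, rfl⟩ := h
  lift k to ℕ using (by exact_mod_cast hα)
  simp

/-- `W^α_p ↪ 𝓑^s` for `α > s + d/p`. -/
theorem sobolev_continuouslyEmbeds_barron (d : ℕ) {s p α : ℝ} (hs : 0 ≤ s) (hp1 : 1 ≤ p)
    (hp2 : p ≤ 2) (hα : s + d / p < α) :
    ContinuouslyEmbeds (sobolevSpace d α p) (sobolevNorm α p) (barronSpace d s)
      (barronNorm s) := by
  have hp0 : 0 < p := by linarith
  have hα0 : 0 ≤ α := by
    have : (0 : ℝ) ≤ d / p := by positivity
    linarith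
  refine continuouslyEmbeds_barron_of_high_frequency hs hp1 hp2 ?_
  by_cases hint : IsInteger α
  · have hfl := natFloor_eq_of_isInteger hα0 hint
    obtain ⟨C, hC⟩ := high_frequency_le_gradient (d := d) (n := ⌊α⌋₊) hp1 hp2 (by rw [hfl]; exact hα)
    refine ⟨C, fun f g G hf hg hG hGm hGp => (hC f g G hg hG hGp).trans ?_⟩
    rw [← gradientLpNorm_eq hG]
    gcongr
    exact gradientLpNorm_le_sobolevNorm le_rfl f
  · set n := ⌊α⌋₊ with hn
    set θ := α - n with hθ
    have hθ0 : 0 ≤ θ := sub_nonneg.2 (Nat.floor_le hα0)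
    obtain ⟨C, hC⟩ := high_frequency_le_modulus d s hp1 hp2 n
    set K := ∑' j : ℕ, ((2 : ℝ≥0∞) ^ j) ^ (s + d / p - α) with hK
    have hKt : K ≠ ∞ := tsum_two_pow_rpow_ne_top (by linarith)
    set V := volume (Metric.ball (0 : Eu d) 1) with hV
    have hVt : V ≠ ∞ := measure_ball_lt_top.ne
    have h1p : 0 ≤ 1 - 1 / p := by
      rw [sub_nonneg, div_le_one hp0]
      exact hp1
    refine ⟨C * (K * V ^ (1 - 1 / p)).toNNReal, fun f g G hf hg hG hGm hGp =>
      (hC f g G hg hG hGp).trans ?_⟩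
    rw [ENNReal.coe_mul, ENNReal.coe_toNNReal (by finiteness), mul_assoc]
    refine mul_le_mul_right ?_ _
    rw [hK, mul_assoc, ← ENNReal.tsum_mul_right]
    refine ENNReal.tsum_le_tsum fun j => ?_
    have hr0 : ((2 : ℝ≥0∞) ^ j) ≠ 0 := by positivity
    have hrt : ((2 : ℝ≥0∞) ^ j) ≠ ∞ := by finiteness
    have hmod : ∫⁻ h in shell d (2 ^ j),
        eLpNorm (fun x => G (x + h) - G x) (ENNReal.ofReal p) ≤
          V ^ (1 - 1 / p) * ((2 : ℝ≥0∞) ^ j) ^ (-d - θ) * sobolevNorm α p f := by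
      refine (setLIntegral_shell_eLpNorm_le hGm hp1 hθ0 j).trans ?_
      rw [← gagliardoSeminorm_eq hG]
      exact mul_le_mul_right (gagliardoSeminorm_le_sobolevNorm hint f) _
    refine (mul_le_mul_right hmod _).trans (le_of_eq ?_)
    generalize sobolevNorm α p f = B
    have hexp : s + d / p - α = (s - n + d + d / p) + (-d - θ) := by rw [hθ]; ring
    rw [hexp, ENNReal.rpow_add (s - n + d + d / p) (-d - θ) hr0 hrt]
    ring

/-- `W^{s+d}_1 ↪ 𝓑^s` for non-integer `s`. Here the dyadic sum is not geometric; instead the shells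
of translations at the different scales are disjoint. -/
theorem sobolev_one_continuouslyEmbeds_barron_of_not_isInteger (d : ℕ) {s : ℝ} (hs : 0 ≤ s)
    (hint : ¬ IsInteger s) :
    ContinuouslyEmbeds (sobolevSpace d (s + d) 1) (sobolevNorm (s + d) 1) (barronSpace d s)
      (barronNorm s) := by
  have hα0 : 0 ≤ s + d := by positivity
  have hint' : ¬ IsInteger (s + d) := by
    rintro ⟨k, hk⟩
    exact hint ⟨k - d, by push_cast; linarith⟩
  refine continuouslyEmbeds_barron_of_high_frequency hs le_rfl one_le_two ?_
  set n := ⌊s + d⌋₊ with hn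
  set θ := s + d - n with hθ
  have hθ0 : 0 ≤ θ := sub_nonneg.2 (Nat.floor_le hα0)
  obtain ⟨C, hC⟩ := high_frequency_le_modulus d s le_rfl one_le_two n
  refine ⟨C, fun f g G hf hg hG hGm hGp => (hC f g G hg hG hGp).trans ?_⟩
  refine mul_le_mul_right ?_ _
  refine le_trans ?_ (gagliardoSeminorm_le_sobolevNorm hint' f)
  rw [gagliardoSeminorm_eq hG, lintegral_gagliardo_eq hGm]
  simp only [ENNReal.rpow_one, mul_one, ENNReal.ofReal_one, eLpNorm_one_eq_lintegral_enorm,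
    div_one]
  calc ∑' j : ℕ, ((2 : ℝ≥0∞) ^ j) ^ (s - n + d + d) *
        ∫⁻ h in shell d (2 ^ j), ∫⁻ x, ‖G (x + h) - G x‖ₑ
      ≤ ∑' j : ℕ, ∫⁻ h in shell d (2 ^ j), (∫⁻ x, ‖G (x + h) - G x‖ₑ) / ‖h‖ₑ ^ (d + θ) := by
        refine ENNReal.tsum_le_tsum fun j => ?_
        have : s - n + d + d = d + θ := by rw [hθ]; ring
        rw [this]
        exact two_pow_mul_setLIntegral_shell_le (by positivity) j _
    _ = ∫⁻ h in ⋃ j : ℕ, shell d (2 ^ j), (∫⁻ x, ‖G (x + h) - G x‖ₑ) / ‖h‖ₑ ^ (d + θ) :=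
        (lintegral_iUnion (fun j => measurableSet_shell _) pairwise_disjoint_shell _).symm
    _ ≤ _ := setLIntegral_le_lintegral _ _

/-! ### Embedding of the Barron space into classical spaces -/

theorem spectralNorm_eq {f : 𝓢'(Eu d, ℂ)} {g : Eu d → ℂ} (hg : IsRegular (𝓕 f) g) (t : ℝ) :
    spectralNorm t f = ∫⁻ ξ, ‖ξ‖ₑ ^ t * ‖g ξ‖ₑ := by
  refine le_antisymm (iInf₂_le g hg) (le_iInf₂ fun g' hg' => le_of_eq ?_)
  refine lintegral_congr_ae ?_
  filter_upwards [hg.ae_eq hg'] with ξ hξ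
  rw [hξ]

theorem rpow_le_one_add_rpow (x : ℝ≥0∞) {t s : ℝ} (ht : 0 ≤ t) (hts : t ≤ s) :
    x ^ t ≤ x ^ (0 : ℝ) + x ^ s := by
  rcases le_total x 1 with hx | hx
  · rw [ENNReal.rpow_zero]
    exact (ENNReal.rpow_le_one hx ht).trans le_self_add
  · exact (ENNReal.rpow_le_rpow_of_exponent_le hx hts).trans le_add_self

/-- Fourier inversion for a distribution with integrable Fourier transform. -/
theorem isRegular_of_fourier_integrable {f : 𝓢'(Eu d, ℂ)} {g : Eu d → ℂ}
    (hg : IsRegular (𝓕 f) g) (hi : Integrable g) : IsRegular f (𝓕 (fun ξ => g (-ξ))) := by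
  have hi' : Integrable (fun ξ => g (-ξ)) := hi.comp_neg
  have hF := hasFourier_of_integrable hi'
  refine ⟨hF.1, fun φ => ⟨hF.integrable_right φ, ?_⟩⟩
  rw [← hF.integral_eq φ, ← integral_neg_eq_self]
  have h1 : f φ = (𝓕 f) (𝓕⁻ φ) := by
    rw [TemperedDistribution.fourier_apply, fourier_fourierInv_eq]
  rw [h1, (hg.2 _).2]
  refine integral_congr_ae (Filter.Eventually.of_forall fun ξ => ?_)
  simp only [neg_neg]
  rw [SchwartzMap.fourierInv_coe, SchwartzMap.fourier_coe, Real.fourierInv_eq_fourier_neg]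

theorem uniformContinuous_fourier {F : Type*} [NormedAddCommGroup F] [NormedSpace ℂ F]
    [CompleteSpace F] {H : Eu d → F} (hH : Integrable H) : UniformContinuous (𝓕 H) :=
  (continuous_fourier hH).uniformContinuous_of_tendsto_cocompact
    (tendsto_integral_exp_inner_smul_cocompact H)

/-- Characters are Hölder continuous with any exponent `θ ∈ [0, 1]`: interpolate between the Lipschitz
bound and the trivial one. -/
theorem enorm_fourierChar_sub_le {θ : ℝ} (hθ0 : 0 ≤ θ) (hθ1 : θ ≤ 1) (a b : ℝ) :
    ‖(Real.fourierChar a : ℂ) - Real.fourierChar b‖ₑ ≤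
      2 * ENNReal.ofReal (Real.pi * |a - b|) ^ θ := by
  have hpi := Real.pi_pos
  have h1 : (Real.fourierChar a : ℂ) - Real.fourierChar b =
      Real.fourierChar b * ((Real.fourierChar (a - b) : ℂ) - 1) := by
    rw [mul_sub, mul_one, ← Circle.coe_mul, ← AddChar.map_add_eq_mul]
    congr 3
    ring
  have h0 : 0 ≤ Real.pi * |a - b| := by positivity
  have h2 : |Real.sin (Real.pi * (a - b))| ≤ (Real.pi * |a - b|) ^ θ := by
    rcases le_total (Real.pi * |a - b|) 1 with h | h
    · have h3 := Real.abs_sin_le_abs (x := Real.pi * (a - b))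
      rw [abs_mul, abs_of_pos hpi] at h3
      exact h3.trans (Real.self_le_rpow_of_le_one h0 h hθ1)
    · exact (Real.abs_sin_le_one _).trans (Real.one_le_rpow h hθ0)
  rw [h1, ← ofReal_norm, norm_mul, Circle.norm_coe, one_mul, norm_fourierChar_sub_one,
    ENNReal.ofReal_mul (by norm_num), ENNReal.ofReal_ofNat,
    ENNReal.ofReal_rpow_of_nonneg h0 hθ0]
  gcongr

/-- The Fourier integral of a function with finite moment of order `θ` is Hölder continuous. -/
theorem enorm_fourier_sub_le {F : Type*} [NormedAddCommGroup F] [NormedSpace ℂ F]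
    {H : Eu d → F} (hH : Integrable H) {θ : ℝ} (hθ0 : 0 ≤ θ) (hθ1 : θ ≤ 1) (x y : Eu d) :
    ‖𝓕 H x - 𝓕 H y‖ₑ ≤
      2 * ENNReal.ofReal Real.pi ^ θ * ‖x - y‖ₑ ^ θ * ∫⁻ ξ, ‖ξ‖ₑ ^ θ * ‖H ξ‖ₑ := by
  have hint : ∀ z : Eu d, Integrable (fun ξ => Real.fourierChar (-inner ℝ ξ z) • H ξ) := fun z =>
    (Real.fourierIntegral_convergent_iff z).2 hH
  rw [Real.fourier_eq, Real.fourier_eq, ← integral_sub (hint x) (hint y)]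
  refine (enorm_integral_le_lintegral_enorm _).trans ?_
  have hc : 2 * ENNReal.ofReal Real.pi ^ θ * ‖x - y‖ₑ ^ θ ≠ ∞ := by finiteness
  rw [← lintegral_const_mul' _ _ hc]
  refine lintegral_mono fun ξ => ?_
  have h1 : Real.fourierChar (-inner ℝ ξ x) • H ξ - Real.fourierChar (-inner ℝ ξ y) • H ξ =
      ((Real.fourierChar (-inner ℝ ξ x) : ℂ) - Real.fourierChar (-inner ℝ ξ y)) • H ξ := by
    rw [sub_smul]
    rfl
  simp only [h1, enorm_smul]
  refine (mul_le_mul_left (enorm_fourierChar_sub_le hθ0 hθ1 _ _) _).trans ?_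
  rw [← mul_assoc]
  refine mul_le_mul_left ?_ _
  rw [mul_assoc, mul_assoc]
  refine mul_le_mul_right ?_ _
  rw [← ENNReal.mul_rpow_of_nonneg _ _ hθ0, ← ENNReal.mul_rpow_of_nonneg _ _ hθ0]
  refine ENNReal.rpow_le_rpow ?_ hθ0
  rw [← ofReal_norm, ← ofReal_norm, ← ENNReal.ofReal_mul (norm_nonneg _),
    ← ENNReal.ofReal_mul Real.pi_pos.le]
  refine ENNReal.ofReal_le_ofReal ?_
  refine mul_le_mul_of_nonneg_left ?_ Real.pi_pos.le
  have h2 : -inner ℝ ξ x - -inner ℝ ξ y = inner ℝ (y - x) ξ := by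
    rw [inner_sub_left, real_inner_comm, real_inner_comm ξ y]
    ring
  rw [h2, ← norm_sub_rev y x]
  exact abs_real_inner_le_norm _ _

/-- `𝓑^s ↪ C^s`: differentiate the Fourier integral. -/
theorem barron_continuouslyEmbeds_holder (d : ℕ) {s : ℝ} (hs : 0 ≤ s) :
    ContinuouslyEmbeds (barronSpace d s) (barronNorm s) (holderSpace d s) (holderNorm s) := by
  set N := ⌊s⌋₊ with hN
  set θ := s - N with hθ
  have hθ0 : 0 ≤ θ := sub_nonneg.2 (Nat.floor_le hs)
  have hθ1 : θ ≤ 1 := by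
    have := Nat.lt_floor_add_one s
    rw [hθ]
    linarith
  set c : ℕ → ℝ≥0∞ := fun n => ENNReal.ofReal (2 * Real.pi) ^ n with hc
  set D : ℝ≥0∞ := (∑ n ∈ Finset.range (N + 1), c n) + 2 * ENNReal.ofReal Real.pi ^ θ * c N with hD
  have hDt : D ≠ ∞ := by
    have : ∀ n, c n ≠ ∞ := fun n => by simp only [hc]; finiteness
    refine ENNReal.add_ne_top.2 ⟨ENNReal.sum_ne_top.2 fun n _ => this n, ?_⟩
    exact ENNReal.mul_ne_top (by finiteness) (this N)
  suffices h : ∃ C : ℝ≥0, ∀ f ∈ barronSpace d s, holderNorm s f ≤ C * barronNorm s f by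
    obtain ⟨C, hC⟩ := h
    exact ⟨fun f hf => (hC f hf).trans_lt (ENNReal.mul_lt_top ENNReal.coe_lt_top hf), C, hC⟩
  refine ⟨D.toNNReal, fun f hf => ?_⟩
  rw [ENNReal.coe_toNNReal hDt]
  have h0 : spectralNorm 0 f < ∞ := lt_of_le_of_lt le_self_add hf
  obtain ⟨g, hg⟩ := iInf_lt_iff.1 h0
  obtain ⟨hg, hg0⟩ := iInf_lt_iff.1 hg
  have hgm : AEStronglyMeasurable g := hg.1.aestronglyMeasurable
  have hgi : Integrable g := ⟨hgm, by simpa [HasFiniteIntegral] using hg0⟩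
  -- by Fourier inversion `f` is the Fourier integral of `k`
  set k : Eu d → ℂ := fun ξ => g (-ξ) with hk
  have hki : Integrable k := hgi.comp_neg
  set A := barronNorm s f with hA
  have hmom : ∀ t, 0 ≤ t → t ≤ s → ∫⁻ ξ, ‖ξ‖ₑ ^ t * ‖k ξ‖ₑ ≤ A := by
    intro t ht hts
    have h1 : ∫⁻ ξ, ‖ξ‖ₑ ^ t * ‖k ξ‖ₑ = ∫⁻ ξ, ‖ξ‖ₑ ^ t * ‖g ξ‖ₑ := by
      rw [← lintegral_neg_eq_self]
      simp [hk]
    rw [h1, hA, barronNorm, spectralNorm_eq hg, spectralNorm_eq hg,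
      ← lintegral_add_left' (by fun_prop)]
    refine lintegral_mono fun ξ => ?_
    rw [← add_mul]
    gcongr
    exact rpow_le_one_add_rpow _ ht hts
  have hnN : ∀ n : ℕ, n ≤ N → (n : ℝ) ≤ s := fun n hn =>
    (Nat.cast_le.2 hn).trans (Nat.floor_le hs)
  have hpow : ∀ n : ℕ, (n : ℕ∞) ≤ (N : ℕ∞) → Integrable (fun ξ => ‖ξ‖ ^ n * ‖k ξ‖) := by
    intro n hn
    refine ⟨(by fun_prop : Continuous fun ξ : Eu d => ‖ξ‖ ^ n).aestronglyMeasurable.mul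
      hki.1.norm, ?_⟩
    refine lt_of_le_of_lt ?_ ((hmom n (by positivity) (hnN n (by exact_mod_cast hn))).trans_lt hf)
    refine le_of_eq (lintegral_congr fun ξ => ?_)
    rw [enorm_mul, enorm_pow, enorm_norm, enorm_norm, ENNReal.rpow_natCast]
  set H : (n : ℕ) → Eu d → (Eu d [×n]→L[ℝ] ℂ) := fun n ξ =>
    VectorFourier.fourierPowSMulRight (innerSL ℝ) k ξ n with hH
  have hder : ∀ n ≤ N, iteratedFDeriv ℝ n (𝓕 k) = 𝓕 (H n) := fun n hn =>
    Real.iteratedFDeriv_fourier (N := N) hpow hki.1 (by exact_mod_cast hn)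
  have hHi : ∀ n ≤ N, Integrable (H n) := fun n hn =>
    VectorFourier.integrable_fourierPowSMulRight _ (hpow n (by exact_mod_cast hn)) hki.1
  have hHb : ∀ n (ξ : Eu d), ‖H n ξ‖ₑ ≤ c n * (‖ξ‖ₑ ^ (n : ℝ) * ‖k ξ‖ₑ) := by
    intro n ξ
    rw [ENNReal.rpow_natCast, ← ofReal_norm, ← ofReal_norm, ← ofReal_norm, hc]
    simp only
    rw [← ENNReal.ofReal_pow (norm_nonneg _), ← ENNReal.ofReal_mul (by positivity),
      ← ENNReal.ofReal_pow (by positivity), ← ENNReal.ofReal_mul (by positivity)]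
    refine ENNReal.ofReal_le_ofReal ?_
    refine (VectorFourier.norm_fourierPowSMulRight_le (innerSL ℝ) k ξ n).trans ?_
    rw [mul_assoc]
    have h2 : 2 * Real.pi * ‖innerSL (E := Eu d) ℝ‖ ≤ 2 * Real.pi :=
      mul_le_of_le_one_right (by positivity) (norm_innerSL_le ℝ)
    gcongr
  have hcl : IsClassicalFunction s f (𝓕 k) := by
    refine ⟨isRegular_of_fourier_integrable hg hgi, ?_, fun n hn => ?_⟩
    · exact Real.contDiff_fourier (N := N) hpow
    · rw [hder n hn]
      exact uniformContinuous_fourier (hHi n hn)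
  refine (iInf₂_le (𝓕 k) hcl).trans ?_
  rw [classicalNorm, hD, add_mul, Finset.sum_mul]
  refine add_le_add (Finset.sum_le_sum fun n hn => ?_) ?_
  · have hn' : n ≤ N := Nat.lt_succ_iff.1 (Finset.mem_range.1 hn)
    refine iSup_le fun x => ?_
    rw [hder n hn']
    refine (enorm_fourier_le _ _).trans ((lintegral_mono (hHb n)).trans ?_)
    rw [lintegral_const_mul' _ _ (by simp only [hc]; finiteness)]
    gcongr
    exact hmom n (by positivity) (hnN n hn')
  · split_ifs with hint
    · exact zero_le
    · refine iSup_le fun x => iSup_le fun y => iSup_le fun hxy => ?_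
      have hxy0 : ‖x - y‖ₑ ≠ 0 := by simpa [sub_eq_zero] using hxy
      rw [← hN, hder N le_rfl]
      refine ENNReal.div_le_of_le_mul ?_
      refine (enorm_fourier_sub_le (hHi N le_rfl) hθ0 hθ1 x y).trans ?_
      have h2 : ∫⁻ ξ, ‖ξ‖ₑ ^ θ * ‖H N ξ‖ₑ ≤ c N * A := by
        calc ∫⁻ ξ, ‖ξ‖ₑ ^ θ * ‖H N ξ‖ₑ ≤ ∫⁻ ξ, c N * (‖ξ‖ₑ ^ s * ‖k ξ‖ₑ) := by
              refine lintegral_mono fun ξ => ?_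
              refine (mul_le_mul_right (hHb N ξ) _).trans (le_of_eq ?_)
              have : s = θ + N := by rw [hθ]; ring
              rw [this, ENNReal.rpow_add_of_nonneg _ _ hθ0 (by positivity)]
              ring
          _ ≤ _ := by
              rw [lintegral_const_mul' _ _ (by simp only [hc]; finiteness)]
              gcongr
              exact hmom s hs le_rfl
      calc 2 * ENNReal.ofReal Real.pi ^ θ * ‖x - y‖ₑ ^ θ * ∫⁻ ξ, ‖ξ‖ₑ ^ θ * ‖H N ξ‖ₑ
          ≤ 2 * ENNReal.ofReal Real.pi ^ θ * ‖x - y‖ₑ ^ θ * (c N * A) := by gcongr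
        _ = _ := by ring

/-! ### Fourier decay of bounded functions of bounded variation -/

/-- Plancherel's identity for the Fourier integral. -/
theorem lintegral_enorm_fourier_sq {w : Eu d → ℂ} (h1 : Integrable w) (h2 : MemLp w 2) :
    ∫⁻ ξ, ‖𝓕 w ξ‖ₑ ^ 2 = ∫⁻ x, ‖w x‖ₑ ^ 2 := by
  obtain ⟨g, hg, -, hn⟩ := exists_hasFourier_of_memLp_two h2
  rw [← eLpNorm_two_sq, ← eLpNorm_two_sq, ← hn,
    eLpNorm_congr_ae ((hasFourier_of_integrable h1).ae_eq hg)]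

theorem fourier_comp_add_right {v : Eu d → ℂ} (hv : Integrable v) (a : Eu d) :
    𝓕 (fun x => v (x + a) - v x) =ᵐ[volume]
      fun ξ => ((Real.fourierChar (inner ℝ a ξ) : ℂ) - 1) * 𝓕 v ξ := by
  have h := hasFourier_of_integrable hv
  have h1 := (h.comp_add_right a).sub h
  have h2 := hasFourier_of_integrable ((hv.comp_add_right a).sub hv)
  filter_upwards [h2.ae_eq h1] with ξ hξ
  rw [sub_mul, one_mul]
  exact hξ

/-- For `ξ` in a dyadic annulus, one of the translations by `1 / (4R)` along the axes is seen
by `ξ`. -/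
theorem one_le_sum_enorm_fourierChar_sub_one {R : ℝ} (hR : 0 < R) {ξ : Eu d}
    (hξ : ξ ∈ annulus d R) :
    1 ≤ ∑ j, ‖(Real.fourierChar (inner ℝ (EuclideanSpace.single j (1 / (4 * R))) ξ) : ℂ) - 1‖ₑ
      ^ 2 := by
  obtain ⟨h1, h2⟩ := hξ
  have hin : ∀ j, inner ℝ (EuclideanSpace.single j (1 / (4 * R))) ξ = ξ j / (4 * R) := by
    intro j
    rw [EuclideanSpace.inner_single_left]
    simp
    ring
  simp_rw [hin, ← ofReal_norm, ← ENNReal.ofReal_pow (norm_nonneg _)]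
  rw [← ENNReal.ofReal_sum_of_nonneg fun _ _ => by positivity, ENNReal.one_le_ofReal]
  have hterm : ∀ j, ξ j ^ 2 / R ^ 2 ≤ ‖(Real.fourierChar (ξ j / (4 * R)) : ℂ) - 1‖ ^ 2 := by
    intro j
    have hj : |ξ j| ≤ ‖ξ‖ := PiLp.norm_apply_le ξ j
    have h3 : |ξ j / (4 * R)| ≤ 1 / 2 := by
      rw [abs_div, abs_of_pos (by positivity : 0 < 4 * R), div_le_div_iff₀ (by positivity)
        (by norm_num)]
      linarith
    have h4 := le_norm_fourierChar_sub_one h3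
    calc ξ j ^ 2 / R ^ 2 = (4 * |ξ j / (4 * R)|) ^ 2 := by
          rw [mul_pow, sq_abs]
          field_simp
      _ ≤ _ := by gcongr
  refine le_trans ?_ (Finset.sum_le_sum fun j _ => hterm j)
  rw [← Finset.sum_div, one_le_div (by positivity)]
  have h5 : ∑ j, ξ j ^ 2 = ‖ξ‖ ^ 2 := by
    rw [EuclideanSpace.norm_sq_eq]
    simp
  rw [h5]
  gcongr

/-- A bounded function with an integrable gradient (here: with an `L¹` modulus of continuity of
order one) has some Fourier decay in the mean square sense. -/
theorem setLIntegral_annulus_enorm_fourier_sq_le {v : Eu d → ℂ} (hv : Integrable v) {M : ℝ≥0}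
    (hM : ∀ x, ‖v x‖ₑ ≤ M) {P : ℝ≥0∞}
    (hP : ∀ (j : Fin d) (t : ℝ), 0 < t →
      ∫⁻ x, ‖v (x + EuclideanSpace.single j t) - v x‖ₑ ≤ ENNReal.ofReal t * P)
    {R : ℝ} (hR : 0 < R) :
    ∫⁻ ξ in annulus d R, ‖𝓕 v ξ‖ₑ ^ 2 ≤ d * (M * P) * (ENNReal.ofReal R)⁻¹ := by
  set t := 1 / (4 * R) with ht
  have ht0 : 0 < t := by positivity
  set a : Fin d → Eu d := fun j => EuclideanSpace.single j t with ha
  have hFm : AEMeasurable (fun ξ => ‖𝓕 v ξ‖ₑ) := (continuous_fourier hv).enorm.aemeasurable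
  have hcm : ∀ j, Continuous (fun ξ => ‖(Real.fourierChar (inner ℝ (a j) ξ) : ℂ) - 1‖ₑ) := by
    intro j
    fun_prop
  have hone : ∀ j, ∫⁻ ξ, ‖(Real.fourierChar (inner ℝ (a j) ξ) : ℂ) - 1‖ₑ ^ 2 * ‖𝓕 v ξ‖ₑ ^ 2 ≤
      M * P * (ENNReal.ofReal R)⁻¹ := by
    intro j
    set w : Eu d → ℂ := fun x => v (x + a j) - v x with hw
    have hwi : Integrable w := (hv.comp_add_right (a j)).sub hv
    have hwb : ∀ x, ‖w x‖ₑ ≤ 2 * M := fun x => by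
      rw [two_mul]
      exact enorm_sub_le.trans (add_le_add (hM _) (hM _))
    have hsq : ∫⁻ x, ‖w x‖ₑ ^ 2 ≤ 2 * M * (ENNReal.ofReal t * P) := by
      calc ∫⁻ x, ‖w x‖ₑ ^ 2 ≤ ∫⁻ x, 2 * M * ‖w x‖ₑ := by
            refine lintegral_mono fun x => ?_
            rw [sq]
            gcongr
            exact hwb x
        _ = 2 * M * ∫⁻ x, ‖w x‖ₑ := lintegral_const_mul' _ _ (by finiteness)
        _ ≤ _ := by
            gcongr
            exact hP j t ht0
    have hw2 : MemLp w 2 := by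
      refine ⟨hwi.1, ?_⟩
      rw [eLpNorm_two_eq]
      refine ENNReal.rpow_lt_top_of_nonneg (by norm_num) (ne_of_lt ?_)
      calc ∫⁻ x, ‖w x‖ₑ ^ 2 ≤ ∫⁻ x, 2 * M * ‖w x‖ₑ := by
            refine lintegral_mono fun x => ?_
            rw [sq]
            gcongr
            exact hwb x
        _ = 2 * M * ∫⁻ x, ‖w x‖ₑ := lintegral_const_mul' _ _ (by finiteness)
        _ < ∞ := ENNReal.mul_lt_top (by finiteness) hwi.2
    have hae := fourier_comp_add_right hv (a j)
    calc ∫⁻ ξ, ‖(Real.fourierChar (inner ℝ (a j) ξ) : ℂ) - 1‖ₑ ^ 2 * ‖𝓕 v ξ‖ₑ ^ 2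
        = ∫⁻ ξ, ‖𝓕 w ξ‖ₑ ^ 2 := by
          refine lintegral_congr_ae ?_
          filter_upwards [hae] with ξ hξ
          rw [hξ, enorm_mul, mul_pow]
      _ ≤ 2 * M * (ENNReal.ofReal t * P) := by
          rw [lintegral_enorm_fourier_sq hwi hw2]
          exact hsq
      _ ≤ M * P * (ENNReal.ofReal R)⁻¹ := by
          have h2t : 2 * ENNReal.ofReal t ≤ (ENNReal.ofReal R)⁻¹ := by
            rw [← ENNReal.ofReal_ofNat, ← ENNReal.ofReal_mul (by norm_num),
              ← ENNReal.ofReal_inv_of_pos hR]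
            refine ENNReal.ofReal_le_ofReal ?_
            rw [ht, mul_one_div, inv_eq_one_div, div_le_div_iff₀ (by positivity) hR]
            linarith
          calc 2 * M * (ENNReal.ofReal t * P) = M * P * (2 * ENNReal.ofReal t) := by ring
            _ ≤ _ := by gcongr
  calc ∫⁻ ξ in annulus d R, ‖𝓕 v ξ‖ₑ ^ 2
      ≤ ∫⁻ ξ in annulus d R,
          ∑ j, ‖(Real.fourierChar (inner ℝ (a j) ξ) : ℂ) - 1‖ₑ ^ 2 * ‖𝓕 v ξ‖ₑ ^ 2 := by
        refine setLIntegral_mono' (measurableSet_annulus R) fun ξ hξ => ?_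
        rw [← Finset.sum_mul]
        exact le_mul_of_one_le_left zero_le (one_le_sum_enorm_fourierChar_sub_one hR hξ)
    _ ≤ ∫⁻ ξ, ∑ j, ‖(Real.fourierChar (inner ℝ (a j) ξ) : ℂ) - 1‖ₑ ^ 2 * ‖𝓕 v ξ‖ₑ ^ 2 :=
        setLIntegral_le_lintegral _ _
    _ = ∑ j, ∫⁻ ξ, ‖(Real.fourierChar (inner ℝ (a j) ξ) : ℂ) - 1‖ₑ ^ 2 * ‖𝓕 v ξ‖ₑ ^ 2 :=
        lintegral_finsetSum' _ fun j _ =>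
          ((hcm j).measurable.aemeasurable.pow_const 2).mul (hFm.pow_const 2)
    _ ≤ ∑ j : Fin d, M * P * (ENNReal.ofReal R)⁻¹ := Finset.sum_le_sum fun j _ => hone j
    _ = _ := by
        rw [Finset.sum_const, Finset.card_univ, Fintype.card_fin, nsmul_eq_mul]
        ring

theorem annulus_subset_ball (R : ℝ) : annulus d R ⊆ Metric.ball 0 (2 * R) := fun ξ hξ => by
  simpa using hξ.2

theorem volume_annulus_le {R : ℝ} (hR : 0 < R) : volume (annulus d R) ≤
    2 ^ d * volume (Metric.ball (0 : Eu d) 1) * ENNReal.ofReal R ^ (d : ℝ) := by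
  refine (measure_mono (annulus_subset_ball R)).trans (le_of_eq ?_)
  rw [volume_ball_eq _ (by positivity), ENNReal.ofReal_mul (by norm_num), ENNReal.ofReal_ofNat,
    ENNReal.rpow_natCast, mul_pow]
  ring

theorem setLIntegral_annulus_weight_le (hd : 1 ≤ d) {R : ℝ} (F : Eu d → ℝ≥0∞) (hR : 0 < R) :
    ∫⁻ ξ in annulus d R, ‖ξ‖ₑ ^ (1 - d : ℝ) * F ξ ≤
      ENNReal.ofReal R ^ (1 - d : ℝ) * ∫⁻ ξ in annulus d R, F ξ := by
  have hd' : (1 : ℝ) ≤ d := by exact_mod_cast hd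
  rw [← lintegral_const_mul' _ _ (ENNReal.rpow_ne_top_of_ne_zero (by simpa using hR) (by simp))]
  refine setLIntegral_mono' (measurableSet_annulus R) fun ξ hξ => ?_
  refine mul_le_mul_left (ennreal_rpow_anti ?_ (by linarith)) _
  rw [← ofReal_norm]
  exact ENNReal.ofReal_le_ofReal hξ.1

/-- The bound for low frequencies, from `|v̂| ≤ ‖v‖₁`. -/
theorem setLIntegral_annulus_low_le (hd : 1 ≤ d) (v : Eu d → ℂ) {R : ℝ} (hR : 0 < R) :
    ∫⁻ ξ in annulus d R, ‖ξ‖ₑ ^ (1 - d : ℝ) * ‖𝓕 v ξ‖ₑ ≤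
      2 ^ d * volume (Metric.ball (0 : Eu d) 1) * (ENNReal.ofReal R * ∫⁻ x, ‖v x‖ₑ) := by
  have hr0 : ENNReal.ofReal R ≠ 0 := by simpa using hR
  refine (setLIntegral_annulus_weight_le hd _ hR).trans ?_
  calc ENNReal.ofReal R ^ (1 - d : ℝ) * ∫⁻ ξ in annulus d R, ‖𝓕 v ξ‖ₑ
      ≤ ENNReal.ofReal R ^ (1 - d : ℝ) * ∫⁻ ξ in annulus d R, ∫⁻ x, ‖v x‖ₑ := by
        gcongr with ξ
        exact enorm_fourier_le v ξ
    _ = ENNReal.ofReal R ^ (1 - d : ℝ) * ((∫⁻ x, ‖v x‖ₑ) * volume (annulus d R)) := by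
        rw [setLIntegral_const]
    _ ≤ ENNReal.ofReal R ^ (1 - d : ℝ) * ((∫⁻ x, ‖v x‖ₑ) *
          (2 ^ d * volume (Metric.ball (0 : Eu d) 1) * ENNReal.ofReal R ^ (d : ℝ))) := by
        gcongr
        exact volume_annulus_le hR
    _ = 2 ^ d * volume (Metric.ball (0 : Eu d) 1) *
          ((ENNReal.ofReal R ^ (1 - d : ℝ) * ENNReal.ofReal R ^ (d : ℝ)) * ∫⁻ x, ‖v x‖ₑ) := by
        ring
    _ = _ := by
        rw [← ENNReal.rpow_add _ _ hr0 (by simp)]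
        simp

/-- The bound for high frequencies, from the mean square decay and the Cauchy–Schwarz inequality. -/
theorem setLIntegral_annulus_high_le (hd : 1 ≤ d) {v : Eu d → ℂ} (hv : Integrable v) {M : ℝ≥0}
    (hM : ∀ x, ‖v x‖ₑ ≤ M) {P : ℝ≥0∞}
    (hP : ∀ (j : Fin d) (t : ℝ), 0 < t →
      ∫⁻ x, ‖v (x + EuclideanSpace.single j t) - v x‖ₑ ≤ ENNReal.ofReal t * P)
    {R : ℝ} (hR : 0 < R) :
    ∫⁻ ξ in annulus d R, ‖ξ‖ₑ ^ (1 - d : ℝ) * ‖𝓕 v ξ‖ₑ ≤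
      (2 ^ d * volume (Metric.ball (0 : Eu d) 1) * d) ^ (1 / 2 : ℝ) *
        (ENNReal.ofReal R ^ ((1 - d) / 2 : ℝ) * (M * P) ^ (1 / 2 : ℝ)) := by
  have hr0 : ENNReal.ofReal R ≠ 0 := by simpa using hR
  have hrt : ENNReal.ofReal R ≠ ∞ := by simp
  have hh : (0 : ℝ) ≤ 1 / 2 := by norm_num
  refine (setLIntegral_annulus_weight_le hd _ hR).trans ?_
  have hcs : ∫⁻ ξ in annulus d R, ‖𝓕 v ξ‖ₑ ≤
      volume (annulus d R) ^ (1 / 2 : ℝ) *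
        (∫⁻ ξ in annulus d R, ‖𝓕 v ξ‖ₑ ^ 2) ^ (1 / 2 : ℝ) := by
    have := setLIntegral_le_measure_rpow_mul (Φ := fun ξ => ‖𝓕 v ξ‖ₑ)
      (continuous_fourier hv).enorm.measurable one_le_two (annulus d R)
    norm_num at this ⊢
    exact this
  set r := ENNReal.ofReal R with hr
  set V := volume (Metric.ball (0 : Eu d) 1) with hV
  calc r ^ (1 - d : ℝ) * ∫⁻ ξ in annulus d R, ‖𝓕 v ξ‖ₑ
      ≤ r ^ (1 - d : ℝ) * ((2 ^ d * V * r ^ (d : ℝ)) ^ (1 / 2 : ℝ) *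
          (d * (M * P) * r⁻¹) ^ (1 / 2 : ℝ)) := by
        refine mul_le_mul_right (hcs.trans (mul_le_mul' ?_ ?_)) _
        · exact ENNReal.rpow_le_rpow (volume_annulus_le hR) hh
        · exact ENNReal.rpow_le_rpow (setLIntegral_annulus_enorm_fourier_sq_le hv hM hP hR) hh
    _ = (2 ^ d * V * d) ^ (1 / 2 : ℝ) *
        (r ^ (1 - d : ℝ) * (r ^ (d : ℝ)) ^ (1 / 2 : ℝ) * (r⁻¹) ^ (1 / 2 : ℝ) *
          (M * P) ^ (1 / 2 : ℝ)) := by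
        simp only [ENNReal.mul_rpow_of_nonneg _ _ hh]
        ring
    _ = _ := by
        rw [← ENNReal.rpow_mul, ← ENNReal.rpow_neg_one, ← ENNReal.rpow_mul,
          ← ENNReal.rpow_add _ _ hr0 hrt, ← ENNReal.rpow_add _ _ hr0 hrt]
        congr 3
        ring

theorem compl_zero_subset_iUnion_annulus {R : ℝ} (hR : 0 < R) :
    ({0} : Set (Eu d))ᶜ ⊆
      (⋃ j : ℕ, annulus d (R * 2⁻¹ ^ (j + 1))) ∪ ⋃ j : ℕ, annulus d (R * 2 ^ j) := by
  intro ξ hξ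
  have h0 : 0 < ‖ξ‖ / R := div_pos (norm_pos_iff.2 hξ) hR
  obtain ⟨n, hn1, hn2⟩ := exists_mem_Ico_zpow h0 one_lt_two
  rw [le_div_iff₀ hR] at hn1
  rw [div_lt_iff₀ hR, zpow_add_one₀ two_ne_zero] at hn2
  obtain ⟨k, rfl | rfl⟩ := n.eq_nat_or_neg
  · refine Or.inr (Set.mem_iUnion.2 ⟨k, ?_, ?_⟩)
    · rw [zpow_natCast] at hn1
      linarith
    · rw [zpow_natCast] at hn2
      linarith
  · rcases k with _ | k
    · refine Or.inr (Set.mem_iUnion.2 ⟨0, ?_, ?_⟩)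
      · simp at hn1 ⊢
        linarith
      · simp at hn2 ⊢
        linarith
    · refine Or.inl (Set.mem_iUnion.2 ⟨k, ?_, ?_⟩)
      · rw [zpow_neg, zpow_natCast, ← inv_pow] at hn1
        linarith
      · rw [zpow_neg, zpow_natCast, ← inv_pow] at hn2
        linarith

/-- Below the frequency `R` use `|v̂| ≤ ‖v‖₁`, above it use the mean square decay. In dimension
`d ≥ 2` the second contribution is a convergent geometric series. -/
theorem lintegral_weight_fourier_le (hd : 2 ≤ d) : ∃ C : ℝ≥0, ∀ (v : Eu d → ℂ), Integrable v →
    ∀ (M : ℝ≥0), (∀ x, ‖v x‖ₑ ≤ M) → ∀ P : ℝ≥0∞, (∀ (j : Fin d) (t : ℝ), 0 < t →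
      ∫⁻ x, ‖v (x + EuclideanSpace.single j t) - v x‖ₑ ≤ ENNReal.ofReal t * P) →
    ∀ R : ℝ, 0 < R → ∫⁻ ξ, ‖ξ‖ₑ ^ (1 - d : ℝ) * ‖𝓕 v ξ‖ₑ ≤
      C * (ENNReal.ofReal R * (∫⁻ x, ‖v x‖ₑ) +
        ENNReal.ofReal R ^ ((1 - d) / 2 : ℝ) * (M * P) ^ (1 / 2 : ℝ)) := by
  have hd1 : 1 ≤ d := by omega
  have hd' : (2 : ℝ) ≤ d := by exact_mod_cast hd
  have : Nonempty (Fin d) := ⟨⟨0, by omega⟩⟩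
  set V := volume (Metric.ball (0 : Eu d) 1) with hV
  have hVt : V ≠ ∞ := measure_ball_lt_top.ne
  set K := ∑' j : ℕ, ((2 : ℝ≥0∞) ^ j) ^ ((1 - d) / 2 : ℝ) with hK
  have hKt : K ≠ ∞ := tsum_two_pow_rpow_ne_top (by linarith)
  set A : ℝ≥0∞ := 2 ^ d * V with hA
  have hAt : A ≠ ∞ := by finiteness
  set B : ℝ≥0∞ := (2 ^ d * V * d) ^ (1 / 2 : ℝ) * K with hB
  have hBt : B ≠ ∞ := by finiteness
  refine ⟨(A + B).toNNReal, fun v hv M hM P hP R hR => ?_⟩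
  rw [ENNReal.coe_toNNReal (by finiteness)]
  set r := ENNReal.ofReal R with hr
  set F : Eu d → ℝ≥0∞ := fun ξ => ‖ξ‖ₑ ^ (1 - d : ℝ) * ‖𝓕 v ξ‖ₑ with hF
  have hlow : ∑' j : ℕ, ∫⁻ ξ in annulus d (R * 2⁻¹ ^ (j + 1)), F ξ ≤
      A * (r * ∫⁻ x, ‖v x‖ₑ) := by
    calc ∑' j : ℕ, ∫⁻ ξ in annulus d (R * 2⁻¹ ^ (j + 1)), F ξ
        ≤ ∑' j : ℕ, (2 : ℝ≥0∞)⁻¹ ^ (j + 1) * (A * (r * ∫⁻ x, ‖v x‖ₑ)) := by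
          refine ENNReal.tsum_le_tsum fun j => ?_
          refine (setLIntegral_annulus_low_le hd1 v (by positivity)).trans (le_of_eq ?_)
          rw [ENNReal.ofReal_mul hR.le, ENNReal.ofReal_pow (by norm_num),
            ENNReal.ofReal_inv_of_pos (by norm_num), ENNReal.ofReal_ofNat]
          ring
      _ = _ := by
          rw [ENNReal.tsum_mul_right, ENNReal.tsum_geometric_add_one]
          simp
          rw [ENNReal.inv_mul_cancel (by norm_num) (by norm_num), one_mul]
  have hhigh : ∑' j : ℕ, ∫⁻ ξ in annulus d (R * 2 ^ j), F ξ ≤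
      B * (r ^ ((1 - d) / 2 : ℝ) * (M * P) ^ (1 / 2 : ℝ)) := by
    calc ∑' j : ℕ, ∫⁻ ξ in annulus d (R * 2 ^ j), F ξ
        ≤ ∑' j : ℕ, ((2 : ℝ≥0∞) ^ j) ^ ((1 - d) / 2 : ℝ) * ((2 ^ d * V * d) ^ (1 / 2 : ℝ) *
          (r ^ ((1 - d) / 2 : ℝ) * (M * P) ^ (1 / 2 : ℝ))) := by
          refine ENNReal.tsum_le_tsum fun j => ?_
          refine (setLIntegral_annulus_high_le hd1 hv hM hP (by positivity)).trans (le_of_eq ?_)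
          rw [ENNReal.ofReal_mul hR.le, ofReal_two_pow,
            ENNReal.mul_rpow_of_ne_top (x := ENNReal.ofReal R) (y := 2 ^ j) (by simp) (by finiteness)]
          ring
      _ = _ := by
          rw [ENNReal.tsum_mul_right, hB]
          ring
  calc ∫⁻ ξ, F ξ = ∫⁻ ξ in ({0} : Set (Eu d))ᶜ, F ξ := by
        rw [Measure.restrict_eq_self_of_ae_mem]
        exact compl_mem_ae_iff.2 (measure_singleton 0)
    _ ≤ ∫⁻ ξ in (⋃ j : ℕ, annulus d (R * 2⁻¹ ^ (j + 1))) ∪ ⋃ j : ℕ, annulus d (R * 2 ^ j), F ξ :=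
        lintegral_mono_set (compl_zero_subset_iUnion_annulus hR)
    _ ≤ (∫⁻ ξ in (⋃ j : ℕ, annulus d (R * 2⁻¹ ^ (j + 1))), F ξ) +
          ∫⁻ ξ in ⋃ j : ℕ, annulus d (R * 2 ^ j), F ξ := lintegral_union_le _ _ _
    _ ≤ A * (r * (∫⁻ x, ‖v x‖ₑ)) + B * (r ^ ((1 - d) / 2 : ℝ) * (M * P) ^ (1 / 2 : ℝ)) :=
        add_le_add ((lintegral_iUnion_le _ _).trans hlow) ((lintegral_iUnion_le _ _).trans hhigh)
    _ ≤ _ := by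
        rw [mul_add]
        gcongr
        · exact le_self_add
        · exact le_add_self

/-! ### Smooth truncations of the values of a function -/

/-- The primitive of the positive part. -/
noncomputable def halfSqPos (t : ℝ) : ℝ := max t 0 ^ 2 / 2

theorem halfSqPos_of_nonneg {t : ℝ} (ht : 0 ≤ t) : halfSqPos t = t ^ 2 / 2 := by
  rw [halfSqPos, max_eq_left ht]

theorem halfSqPos_of_nonpos {t : ℝ} (ht : t ≤ 0) : halfSqPos t = 0 := by
  rw [halfSqPos, max_eq_right ht]
  simp

theorem hasDerivAt_halfSqPos (t : ℝ) : HasDerivAt halfSqPos (max t 0) t := by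
  rcases lt_trichotomy t 0 with h | rfl | h
  · rw [max_eq_right h.le]
    refine (hasDerivAt_const t (0 : ℝ)).congr_of_eventuallyEq ?_
    filter_upwards [gt_mem_nhds h] with y hy
    exact halfSqPos_of_nonpos hy.le
  · rw [max_self, hasDerivAt_iff_isLittleO_nhds_zero]
    have h0 : (fun h : ℝ => halfSqPos (0 + h) - halfSqPos 0 - h • (0 : ℝ)) =O[nhds 0]
        fun h : ℝ => h ^ 2 := by
      refine Asymptotics.IsBigO.of_bound 1 (Filter.Eventually.of_forall fun h => ?_)
      rw [zero_add, halfSqPos_of_nonpos le_rfl, smul_zero, sub_zero, sub_zero, Real.norm_eq_abs,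
        Real.norm_eq_abs, one_mul, abs_of_nonneg (sq_nonneg h)]
      rcases le_total h 0 with h1 | h1
      · rw [halfSqPos_of_nonpos h1, abs_zero]
        positivity
      · rw [halfSqPos_of_nonneg h1, abs_of_nonneg (by positivity)]
        linarith [sq_nonneg h]
    exact h0.trans_isLittleO (Asymptotics.isLittleO_pow_id one_lt_two)
  · rw [max_eq_left h.le]
    have h1 : HasDerivAt (fun y : ℝ => y ^ 2 / 2) t t :=
      ((hasDerivAt_pow 2 t).div_const 2).congr_deriv (by simp)
    refine h1.congr_of_eventuallyEq ?_
    filter_upwards [lt_mem_nhds h] with y hy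
    exact halfSqPos_of_nonneg hy.le

/-- The trapezoidal cutoff: `1` on `[-1, 1]`, `0` outside `[-2, 2]`, and linear in between. -/
noncomputable def trapezoid (t : ℝ) : ℝ :=
  1 - max (t - 1) 0 + max (t - 2) 0 - max (-t - 1) 0 + max (-t - 2) 0

/-- The odd primitive of the trapezoidal cutoff, a `C¹` truncation of the identity: it is the
identity on `[-1, 1]` and constant on either side of `[-2, 2]`. -/
noncomputable def truncation (t : ℝ) : ℝ :=
  t - halfSqPos (t - 1) + halfSqPos (t - 2) + halfSqPos (-t - 1) - halfSqPos (-t - 2)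

theorem continuous_trapezoid : Continuous trapezoid := by
  unfold trapezoid
  fun_prop

theorem trapezoid_nonneg (t : ℝ) : 0 ≤ trapezoid t := by
  simp only [trapezoid, max_def]
  split_ifs <;> linarith

theorem trapezoid_le_one (t : ℝ) : trapezoid t ≤ 1 := by
  simp only [trapezoid, max_def]
  split_ifs <;> linarith

theorem trapezoid_eq (t : ℝ) : trapezoid t = max 0 (min 1 (2 - |t|)) := by
  rcases abs_cases t with ⟨h, h0⟩ | ⟨h, h0⟩ <;> rw [h, trapezoid] <;>
    simp only [max_def, min_def] <;> split_ifs <;> linarith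

theorem trapezoid_le_half (t : ℝ) : trapezoid t ≤ trapezoid (t / 2) := by
  have h : |t / 2| ≤ |t| := by
    rw [abs_div, abs_two]
    linarith [abs_nonneg t]
  rw [trapezoid_eq, trapezoid_eq]
  gcongr

theorem hasDerivAt_truncation (t : ℝ) : HasDerivAt truncation (trapezoid t) t := by
  have h1 : ∀ c : ℝ, HasDerivAt (fun y => halfSqPos (y - c)) (max (t - c) 0) t := fun c =>
    (hasDerivAt_halfSqPos (t - c)).comp_sub_const t c
  have h2 : ∀ c : ℝ, HasDerivAt (fun y => halfSqPos (-y - c)) (-max (-t - c) 0) t := fun c => by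
    have h := (hasDerivAt_halfSqPos (-t - c)).comp t ((hasDerivAt_neg t).sub_const c)
    exact h.congr_deriv (by simp)
  refine (((((hasDerivAt_id t).sub (h1 1)).add (h1 2)).add (h2 1)).sub (h2 2)).congr_deriv ?_
  simp only [trapezoid]
  ring

theorem truncation_of_abs_le_one {t : ℝ} (ht : |t| ≤ 1) : truncation t = t := by
  obtain ⟨h1, h2⟩ := abs_le.1 ht
  rw [truncation, halfSqPos_of_nonpos (by linarith), halfSqPos_of_nonpos (by linarith),
    halfSqPos_of_nonpos (by linarith), halfSqPos_of_nonpos (by linarith)]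
  ring

theorem truncation_of_two_le {t : ℝ} (ht : 2 ≤ t) : truncation t = 3 / 2 := by
  rw [truncation, halfSqPos_of_nonneg (by linarith), halfSqPos_of_nonneg (by linarith),
    halfSqPos_of_nonpos (by linarith), halfSqPos_of_nonpos (by linarith)]
  ring

theorem truncation_of_le_neg_two {t : ℝ} (ht : t ≤ -2) : truncation t = -(3 / 2) := by
  rw [truncation, halfSqPos_of_nonpos (by linarith), halfSqPos_of_nonpos (by linarith),
    halfSqPos_of_nonneg (by linarith), halfSqPos_of_nonneg (by linarith)]
  ring

theorem truncation_zero : truncation 0 = 0 := truncation_of_abs_le_one (by simp)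

theorem abs_truncation_le_abs (t : ℝ) : |truncation t| ≤ |t| := by
  have h : LipschitzWith 1 truncation :=
    lipschitzWith_of_nnnorm_deriv_le (fun y => (hasDerivAt_truncation y).differentiableAt)
      fun y => by
        rw [(hasDerivAt_truncation y).deriv, ← NNReal.coe_le_coe, coe_nnnorm, Real.norm_eq_abs,
          abs_of_nonneg (trapezoid_nonneg y)]
        exact trapezoid_le_one y
  have := h.dist_le_mul t 0
  simpa [truncation_zero, Real.dist_eq] using this

theorem abs_truncation_le (t : ℝ) : |truncation t| ≤ 3 / 2 := by
  have hm : Monotone truncation :=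
    monotone_of_deriv_nonneg (fun y => (hasDerivAt_truncation y).differentiableAt) fun y => by
      rw [(hasDerivAt_truncation y).deriv]
      exact trapezoid_nonneg y
  rw [abs_le]
  constructor
  · have := hm (min_le_left t (-2))
    rwa [truncation_of_le_neg_two (min_le_right _ _)] at this
  · have := hm (le_max_left t 2)
    rwa [truncation_of_two_le (le_max_right _ _)] at this

/-- The truncation of `t` at the level `a`. -/
noncomputable def truncAt (a t : ℝ) : ℝ := a * truncation (t / a)

/-- The layer of `t` between the levels `a` and `4a`. -/
noncomputable def layer (a t : ℝ) : ℝ := truncAt (2 * a) t - truncAt a t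

/-- The derivative of `layer a`. -/
noncomputable def layerDeriv (a t : ℝ) : ℝ := trapezoid (t / (2 * a)) - trapezoid (t / a)

theorem hasDerivAt_truncAt {a : ℝ} (ha : 0 < a) (t : ℝ) :
    HasDerivAt (truncAt a) (trapezoid (t / a)) t := by
  have h := ((hasDerivAt_truncation (t / a)).comp t ((hasDerivAt_id t).div_const a)).const_mul a
  exact h.congr_deriv (by field_simp)

theorem hasDerivAt_layer {a : ℝ} (ha : 0 < a) (t : ℝ) :
    HasDerivAt (layer a) (layerDeriv a t) t :=
  (hasDerivAt_truncAt (by positivity) t).sub (hasDerivAt_truncAt ha t)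

theorem layerDeriv_nonneg (a t : ℝ) : 0 ≤ layerDeriv a t := by
  have := trapezoid_le_half (t / a)
  rw [div_div, mul_comm a 2] at this
  exact sub_nonneg.2 this

theorem continuous_layerDeriv (a : ℝ) : Continuous (layerDeriv a) :=
  (continuous_trapezoid.comp (continuous_id.div_const _)).sub
    (continuous_trapezoid.comp (continuous_id.div_const _))

theorem sum_layerDeriv_le_one (b t : ℝ) (K : ℕ) :
    ∑ k ∈ Finset.range K, layerDeriv (b * 2 ^ k) t ≤ 1 := by
  have h : ∀ k : ℕ, layerDeriv (b * 2 ^ k) t =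
      trapezoid (t / (b * 2 ^ (k + 1))) - trapezoid (t / (b * 2 ^ k)) := fun k => by
    rw [layerDeriv, pow_succ]
    congr 3
    ring
  simp_rw [h]
  rw [Finset.sum_range_sub fun k => trapezoid (t / (b * 2 ^ k))]
  linarith [trapezoid_le_one (t / (b * 2 ^ K)), trapezoid_nonneg (t / (b * 2 ^ 0))]

theorem sum_layer (b t : ℝ) (K : ℕ) :
    ∑ k ∈ Finset.range K, layer (b * 2 ^ k) t = truncAt (b * 2 ^ K) t - truncAt b t := by
  have h : ∀ k : ℕ, layer (b * 2 ^ k) t =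
      truncAt (b * 2 ^ (k + 1)) t - truncAt (b * 2 ^ k) t := fun k => by
    rw [layer, pow_succ]
    congr 2
    ring
  simp_rw [h]
  rw [Finset.sum_range_sub fun k => truncAt (b * 2 ^ k) t]
  simp

theorem contDiff_layer {a : ℝ} (ha : 0 < a) : ContDiff ℝ 1 (layer a) := by
  rw [contDiff_one_iff_deriv]
  refine ⟨fun t => (hasDerivAt_layer ha t).differentiableAt, ?_⟩
  rw [show deriv (layer a) = layerDeriv a from funext fun t => (hasDerivAt_layer ha t).deriv]
  exact continuous_layerDeriv a

theorem truncAt_of_abs_le {a t : ℝ} (ha : 0 < a) (ht : |t| ≤ a) : truncAt a t = t := by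
  rw [truncAt, truncation_of_abs_le_one]
  · field_simp
  · rw [abs_div, abs_of_pos ha, div_le_one ha]
    exact ht

theorem abs_truncAt_le_abs {a : ℝ} (ha : 0 < a) (t : ℝ) : |truncAt a t| ≤ |t| := by
  rw [truncAt, abs_mul, abs_of_pos ha]
  calc a * |truncation (t / a)| ≤ a * |t / a| := by
        exact mul_le_mul_of_nonneg_left (abs_truncation_le_abs _) ha.le
    _ = |t| := by
        rw [abs_div, abs_of_pos ha]
        field_simp

theorem abs_truncAt_le {a : ℝ} (ha : 0 < a) (t : ℝ) : |truncAt a t| ≤ 3 / 2 * a := by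
  rw [truncAt, abs_mul, abs_of_pos ha, mul_comm]
  exact mul_le_mul_of_nonneg_right (abs_truncation_le _) ha.le

theorem layer_of_abs_le {a t : ℝ} (ha : 0 < a) (ht : |t| ≤ a) : layer a t = 0 := by
  rw [layer, truncAt_of_abs_le ha ht, truncAt_of_abs_le (by positivity) (by linarith), sub_self]

theorem abs_layer_le {a : ℝ} (ha : 0 < a) (t : ℝ) : |layer a t| ≤ 9 / 2 * a := by
  refine (abs_sub _ _).trans ?_
  linarith [abs_truncAt_le ha t, abs_truncAt_le (by positivity : 0 < 2 * a) t]

theorem abs_layer_of_le {a t : ℝ} (ha : 0 < a) (ht : 4 * a ≤ |t|) : |layer a t| = 3 / 2 * a := by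
  rw [layer, truncAt, truncAt]
  rcases le_total 0 t with h | h
  · rw [abs_of_nonneg h] at ht
    rw [truncation_of_two_le, truncation_of_two_le]
    · rw [abs_of_nonneg] <;> linarith
    · rw [le_div_iff₀ ha]
      linarith
    · rw [le_div_iff₀ (by positivity)]
      linarith
  · rw [abs_of_nonpos h] at ht
    rw [truncation_of_le_neg_two, truncation_of_le_neg_two]
    · rw [abs_of_nonpos] <;> linarith
    · rw [div_le_iff₀ ha]
      linarith
    · rw [div_le_iff₀ (by positivity)]
      linarith

/-! ### Layers of a function and the isoperimetric inequality -/

/-- Translating a `C¹` function by `h` moves it in `L¹` by at most `|h|` times the `L¹` norm of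
its gradient. -/
theorem lintegral_enorm_comp_add_sub_le {g : Eu d → ℝ} (hg : ContDiff ℝ 1 g) (h : Eu d) :
    ∫⁻ x, ‖g (x + h) - g x‖ₑ ≤ ‖h‖ₑ * ∫⁻ x, ‖fderiv ℝ g x‖ₑ := by
  have hc : Continuous (fderiv ℝ g) := hg.continuous_fderiv one_ne_zero
  have hpt : ∀ x, ‖g (x + h) - g x‖ₑ ≤
      ∫⁻ t in Set.Icc (0 : ℝ) 1, ‖fderiv ℝ g (x + t • h)‖ₑ * ‖h‖ₑ := by
    intro x
    have hl : ContDiff ℝ 1 fun t : ℝ => g (x + t • h) := by fun_prop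
    have h1 := enorm_sub_le_lintegral_deriv_of_contDiffOn_Icc hl.contDiffOn zero_le_one
    simp only [one_smul, zero_smul, add_zero] at h1
    refine h1.trans (lintegral_mono fun t => ?_)
    have h2 : HasDerivAt (fun t : ℝ => x + t • h) h t := by
      simpa using ((hasDerivAt_id t).smul_const h).const_add x
    have h3 : HasDerivAt (fun t : ℝ => g (x + t • h)) (fderiv ℝ g (x + t • h) h) t :=
      ((hg.differentiable one_ne_zero) (x + t • h)).hasFDerivAt.comp_hasDerivAt t h2
    rw [h3.deriv]
    exact (fderiv ℝ g (x + t • h)).le_opENorm h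
  have hm : Measurable (Function.uncurry fun (x : Eu d) (t : ℝ) =>
      ‖fderiv ℝ g (x + t • h)‖ₑ * ‖h‖ₑ) := by
    have : Continuous fun z : Eu d × ℝ => ‖fderiv ℝ g (z.1 + z.2 • h)‖ₑ := by fun_prop
    exact this.measurable.mul_const _
  calc ∫⁻ x, ‖g (x + h) - g x‖ₑ
      ≤ ∫⁻ x, ∫⁻ t in Set.Icc (0 : ℝ) 1, ‖fderiv ℝ g (x + t • h)‖ₑ * ‖h‖ₑ := lintegral_mono hpt
    _ = ∫⁻ t in Set.Icc (0 : ℝ) 1, ∫⁻ x, ‖fderiv ℝ g (x + t • h)‖ₑ * ‖h‖ₑ :=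
        lintegral_lintegral_swap hm.aemeasurable
    _ = ∫⁻ t in Set.Icc (0 : ℝ) 1, ‖h‖ₑ * ∫⁻ x, ‖fderiv ℝ g x‖ₑ := by
        refine lintegral_congr fun t => ?_
        rw [lintegral_mul_const' _ _ enorm_ne_top, mul_comm,
          lintegral_add_right_eq_self (fun x => ‖fderiv ℝ g x‖ₑ)]
    _ = _ := by simp

theorem fderiv_layer_comp {g : Eu d → ℝ} (hg : ContDiff ℝ 1 g) {a : ℝ} (ha : 0 < a) (x : Eu d) :
    ‖fderiv ℝ (fun x => layer a (g x)) x‖ₑ =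
      ENNReal.ofReal (layerDeriv a (g x)) * ‖fderiv ℝ g x‖ₑ := by
  have h : HasFDerivAt (fun x => layer a (g x)) (layerDeriv a (g x) • fderiv ℝ g x) x :=
    (hasDerivAt_layer ha (g x)).comp_hasFDerivAt x
      ((hg.differentiable one_ne_zero) x).hasFDerivAt
  rw [h.fderiv, enorm_smul, Real.enorm_eq_ofReal (layerDeriv_nonneg a _)]

theorem hasCompactSupport_layer_comp {g : Eu d → ℝ}
    (h0 : Filter.Tendsto g (Filter.cocompact _) (nhds 0)) {a : ℝ} (ha : 0 < a) :
    HasCompactSupport fun x => layer a (g x) := by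
  have h1 : ∀ᶠ x in Filter.cocompact (Eu d), |g x| < a := by
    simpa using h0.norm.eventually (gt_mem_nhds (by simpa using ha : ‖(0 : ℝ)‖ < a))
  obtain ⟨K, hK, hKs⟩ := Filter.mem_cocompact.1 h1
  exact HasCompactSupport.intro hK fun x hx => layer_of_abs_le ha (hKs hx).le

/-- The isoperimetric estimate for superlevel sets: the Gagliardo–Nirenberg–Sobolev inequality
applied to a layer of `g`. -/
theorem measure_superlevel_le (hd : 2 ≤ d) : ∃ C : ℝ≥0, ∀ g : Eu d → ℝ, ContDiff ℝ 1 g →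
    Filter.Tendsto g (Filter.cocompact _) (nhds 0) → ∀ a : ℝ, 0 < a →
    ENNReal.ofReal a * volume {x | 4 * a ≤ |g x|} ^ ((d - 1) / d : ℝ) ≤
      C * ∫⁻ x, ENNReal.ofReal (layerDeriv a (g x)) * ‖fderiv ℝ g x‖ₑ := by
  have hd' : (2 : ℝ) ≤ d := by exact_mod_cast hd
  set p : ℝ := Real.conjExponent d with hp
  have hpe : p = d / (d - 1) := rfl
  have hconj : Real.HolderConjugate (Module.finrank ℝ (Eu d)) p := by
    rw [finrank_euclideanSpace_fin]
    exact Real.HolderConjugate.conjExponent (by linarith)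
  have hp0 : 0 < p := hconj.symm.pos
  have hip : p⁻¹ = (d - 1) / d := by rw [hpe, inv_div]
  refine ⟨lintegralPowLePowLIntegralFDerivConst (volume : Measure (Eu d)) p ^ p⁻¹,
    fun g hg h0 a ha => ?_⟩
  set K := lintegralPowLePowLIntegralFDerivConst (volume : Measure (Eu d)) p with hK
  have h1 := lintegral_pow_le_pow_lintegral_fderiv (volume : Measure (Eu d))
    ((contDiff_layer ha).comp hg) (hasCompactSupport_layer_comp h0 ha) hconj
  have h2 : ∫⁻ x, ‖fderiv ℝ (layer a ∘ g) x‖ₑ =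
      ∫⁻ x, ENNReal.ofReal (layerDeriv a (g x)) * ‖fderiv ℝ g x‖ₑ :=
    lintegral_congr fun x => fderiv_layer_comp hg ha x
  rw [h2] at h1
  set P := ∫⁻ x, ENNReal.ofReal (layerDeriv a (g x)) * ‖fderiv ℝ g x‖ₑ with hP
  have hE : MeasurableSet {x | 4 * a ≤ |g x|} :=
    measurableSet_le measurable_const hg.continuous.abs.measurable
  have h3 : ENNReal.ofReal a ^ p * volume {x | 4 * a ≤ |g x|} ≤
      ∫⁻ x, ‖(layer a ∘ g) x‖ₑ ^ p := by
    rw [← setLIntegral_const]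
    refine (setLIntegral_mono' hE fun x hx => ?_).trans (setLIntegral_le_lintegral _ _)
    refine ENNReal.rpow_le_rpow ?_ hp0.le
    rw [Real.enorm_eq_ofReal_abs]
    refine ENNReal.ofReal_le_ofReal ?_
    rw [Function.comp_apply, abs_layer_of_le ha hx]
    linarith
  have h4 := ENNReal.rpow_le_rpow (h3.trans h1) (inv_nonneg.2 hp0.le)
  rw [ENNReal.mul_rpow_of_nonneg _ _ (inv_nonneg.2 hp0.le),
    ENNReal.mul_rpow_of_nonneg _ _ (inv_nonneg.2 hp0.le), ENNReal.rpow_rpow_inv hp0.ne',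
    ENNReal.rpow_rpow_inv hp0.ne', hip] at h4
  rw [hip, ENNReal.coe_rpow_of_nonneg _ (by rw [← hip]; positivity)]
  exact h4

/-- A single layer of `g`: its Fourier transform is controlled by the part of the gradient of `g`
on that layer and on the one two levels below. The frequency that balances the two contributions
is the inverse of the linear size of the superlevel set. -/
theorem lintegral_weight_fourier_layer_le (hd : 2 ≤ d) : ∃ C : ℝ≥0, ∀ g : Eu d → ℝ,
    ContDiff ℝ 1 g → Integrable g → Filter.Tendsto g (Filter.cocompact _) (nhds 0) →
    ∀ a : ℝ, 0 < a →
    ∫⁻ ξ, ‖ξ‖ₑ ^ (1 - d : ℝ) * ‖𝓕 (fun x => (layer a (g x) : ℂ)) ξ‖ₑ ≤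
      C * ((∫⁻ x, ENNReal.ofReal (layerDeriv a (g x)) * ‖fderiv ℝ g x‖ₑ) +
        ∫⁻ x, ENNReal.ofReal (layerDeriv (a / 4) (g x)) * ‖fderiv ℝ g x‖ₑ) := by
  have hd' : (2 : ℝ) ≤ d := by exact_mod_cast hd
  have hd0 : (d : ℝ) ≠ 0 := by positivity
  obtain ⟨C₁, hC₁⟩ := lintegral_weight_fourier_le hd
  obtain ⟨C₂, hC₂⟩ := measure_superlevel_le hd
  refine ⟨C₁ * (18 * C₂ + (18 * C₂) ^ (1 / 2 : ℝ)), fun g hg hgi h0 a ha => ?_⟩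
  set P := ∫⁻ x, ENNReal.ofReal (layerDeriv a (g x)) * ‖fderiv ℝ g x‖ₑ with hP
  set Q := ∫⁻ x, ENNReal.ofReal (layerDeriv (a / 4) (g x)) * ‖fderiv ℝ g x‖ₑ with hQ
  set E := {x | a ≤ |g x|} with hE
  have hEm : MeasurableSet E := measurableSet_le measurable_const hg.continuous.abs.measurable
  set v : Eu d → ℂ := fun x => (layer a (g x) : ℂ) with hv
  have hvr : ContDiff ℝ 1 fun x => layer a (g x) := (contDiff_layer ha).comp hg
  have hvi : Integrable v :=
    (hvr.continuous.integrable_of_hasCompactSupport (hasCompactSupport_layer_comp h0 ha)).ofReal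
  set α : ℝ≥0∞ := ENNReal.ofReal a with hα
  set M : ℝ≥0 := (9 / 2 * a).toNNReal with hM
  have hMα : (M : ℝ≥0∞) ≤ 18 * ENNReal.ofReal (a / 4) := by
    rw [← ENNReal.ofReal_ofNat, ← ENNReal.ofReal_mul (by norm_num)]
    refine ENNReal.ofReal_le_ofReal ?_
    linarith
  have hvM : ∀ x, ‖v x‖ₑ ≤ M := fun x => by
    rw [← ofReal_norm, Complex.norm_real, Real.norm_eq_abs]
    exact ENNReal.ofReal_le_ofReal (abs_layer_le ha _)
  have hv0 : ∀ x, x ∉ E → v x = 0 := fun x hx => by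
    have hx' : |g x| < a := not_le.1 hx
    simp only [hv, layer_of_abs_le ha hx'.le, Complex.ofReal_zero]
  have hv1 : ∫⁻ x, ‖v x‖ₑ ≤ M * volume E := by
    calc ∫⁻ x, ‖v x‖ₑ = ∫⁻ x in E, ‖v x‖ₑ := by
          rw [← lintegral_indicator hEm]
          refine lintegral_congr fun x => ?_
          by_cases hx : x ∈ E
          · simp [hx]
          · simp [hx, hv0 x hx]
      _ ≤ ∫⁻ x in E, M := lintegral_mono fun x => hvM x
      _ = _ := setLIntegral_const _ _
  have hvP : ∀ (j : Fin d) (t : ℝ), 0 < t →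
      ∫⁻ x, ‖v (x + EuclideanSpace.single j t) - v x‖ₑ ≤ ENNReal.ofReal t * P := by
    intro j t ht
    have h1 := lintegral_enorm_comp_add_sub_le hvr (EuclideanSpace.single j t)
    have h2 : ‖EuclideanSpace.single j t‖ₑ = ENNReal.ofReal t := by
      rw [← ofReal_norm, PiLp.norm_single, Real.norm_eq_abs, abs_of_pos ht]
    have h3 : ∫⁻ x, ‖fderiv ℝ (fun x => layer a (g x)) x‖ₑ = P :=
      lintegral_congr fun x => fderiv_layer_comp hg ha x
    rw [h2, h3] at h1
    refine le_trans (le_of_eq (lintegral_congr fun x => ?_)) h1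
    rw [hv, ← Complex.ofReal_sub, ← ofReal_norm, Complex.norm_real, ofReal_norm]
  have hiso : ENNReal.ofReal (a / 4) * volume E ^ ((d - 1) / d : ℝ) ≤ C₂ * Q := by
    have := hC₂ g hg h0 (a / 4) (by positivity)
    rwa [mul_div_cancel₀ a (by norm_num : (4 : ℝ) ≠ 0)] at this
  have hEt : volume E ≠ ∞ := by
    have := hgi.norm.measure_ge_lt_top ha
    simpa [hE] using this.ne
  rcases eq_or_ne (volume E) 0 with hE0 | hE0
  · have hz : v =ᵐ[volume] 0 := by
      have : ∀ᵐ x, x ∉ E := measure_eq_zero_iff_ae_notMem.1 hE0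
      filter_upwards [this] with x hx
      exact hv0 x hx
    have hF : ∀ ξ, 𝓕 v ξ = 0 := fun ξ => by
      rw [← enorm_eq_zero, ← nonpos_iff_eq_zero]
      refine (enorm_fourier_le v ξ).trans (le_of_eq ?_)
      rw [lintegral_congr_ae (hz.mono fun x hx => by rw [hx])]
      simp
    simp [hF]
  -- for this `R` the bound for the low frequencies is of the order of `a * volume E ^ ((d - 1) / d)`,
  -- and the one for the high frequencies is the geometric mean of that quantity and `P`
  set R := (volume E ^ (-(1 / d) : ℝ)).toReal with hR
  have hr : ENNReal.ofReal R = volume E ^ (-(1 / d) : ℝ) :=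
    ENNReal.ofReal_toReal (ENNReal.rpow_ne_top_of_ne_zero hE0 hEt)
  have hR0 : 0 < R := ENNReal.toReal_pos (ENNReal.rpow_pos (pos_iff_ne_zero.2 hE0) hEt).ne'
    (ENNReal.rpow_ne_top_of_ne_zero hE0 hEt)
  have hlow : ENNReal.ofReal R * ∫⁻ x, ‖v x‖ₑ ≤ 18 * C₂ * Q := by
    calc ENNReal.ofReal R * ∫⁻ x, ‖v x‖ₑ
        ≤ volume E ^ (-(1 / d) : ℝ) * ((18 * ENNReal.ofReal (a / 4)) * volume E) := by
          rw [hr]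
          refine mul_le_mul_right (hv1.trans ?_) _
          exact mul_le_mul_left hMα _
      _ = 18 * (ENNReal.ofReal (a / 4) * (volume E ^ (-(1 / d) : ℝ) * volume E)) := by ring
      _ = 18 * (ENNReal.ofReal (a / 4) * volume E ^ ((d - 1) / d : ℝ)) := by
          nth_rw 2 [← ENNReal.rpow_one (volume E)]
          rw [← ENNReal.rpow_add _ _ hE0 hEt]
          congr 3
          field_simp
          ring
      _ ≤ 18 * (C₂ * Q) := by gcongr
      _ = _ := by ring
  have hhigh : ENNReal.ofReal R ^ ((1 - d) / 2 : ℝ) * (M * P) ^ (1 / 2 : ℝ) ≤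
      (18 * C₂) ^ (1 / 2 : ℝ) * (P + Q) := by
    calc ENNReal.ofReal R ^ ((1 - d) / 2 : ℝ) * (M * P) ^ (1 / 2 : ℝ)
        = (volume E ^ ((d - 1) / d : ℝ) * (M * P)) ^ (1 / 2 : ℝ) := by
          rw [ENNReal.mul_rpow_of_nonneg _ (M * P : ℝ≥0∞) (by norm_num), hr, ← ENNReal.rpow_mul,
            ← ENNReal.rpow_mul]
          congr 2
          field_simp
          ring
      _ ≤ (18 * C₂ * (Q * P)) ^ (1 / 2 : ℝ) := by
          refine ENNReal.rpow_le_rpow ?_ (by norm_num)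
          calc volume E ^ ((d - 1) / d : ℝ) * (M * P)
              ≤ volume E ^ ((d - 1) / d : ℝ) * (18 * ENNReal.ofReal (a / 4) * P) := by gcongr
            _ = 18 * (ENNReal.ofReal (a / 4) * volume E ^ ((d - 1) / d : ℝ)) * P := by ring
            _ ≤ 18 * (C₂ * Q) * P := by gcongr
            _ = _ := by ring
      _ ≤ (18 * C₂ * (P + Q) ^ 2) ^ (1 / 2 : ℝ) := by
          refine ENNReal.rpow_le_rpow ?_ (by norm_num)
          rw [sq]
          gcongr
          · exact le_add_self
          · exact le_self_add
      _ = _ := by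
          rw [ENNReal.mul_rpow_of_nonneg _ _ (by norm_num), ← ENNReal.rpow_natCast,
            ← ENNReal.rpow_mul]
          norm_num
  calc ∫⁻ ξ, ‖ξ‖ₑ ^ (1 - d : ℝ) * ‖𝓕 v ξ‖ₑ
      ≤ C₁ * (ENNReal.ofReal R * (∫⁻ x, ‖v x‖ₑ) +
          ENNReal.ofReal R ^ ((1 - d) / 2 : ℝ) * (M * P) ^ (1 / 2 : ℝ)) :=
        hC₁ v hvi M hvM P hvP R hR0
    _ ≤ C₁ * (18 * C₂ * (P + Q) + (18 * C₂) ^ (1 / 2 : ℝ) * (P + Q)) := by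
        refine mul_le_mul_right (add_le_add (hlow.trans ?_) hhigh) _
        exact mul_le_mul_right le_add_self _
    _ = _ := by
        push_cast
        rw [ENNReal.coe_rpow_of_nonneg _ (by norm_num)]
        push_cast
        ring

/-! ### A Hardy type inequality for regular functions -/

/-- A form of Fatou's lemma. -/
theorem lintegral_le_of_ae_tendsto {f : ℕ → Eu d → ℝ≥0∞} {F : Eu d → ℝ≥0∞} {B : ℝ≥0∞}
    (hf : ∀ n, AEMeasurable (f n))
    (hF : ∀ᵐ x, Filter.Tendsto (fun n => f n x) Filter.atTop (nhds (F x)))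
    (hB : ∀ n, ∫⁻ x, f n x ≤ B) : ∫⁻ x, F x ≤ B := by
  calc ∫⁻ x, F x = ∫⁻ x, Filter.liminf (fun n => f n x) Filter.atTop :=
        lintegral_congr_ae (hF.mono fun x hx => hx.liminf_eq.symm)
    _ ≤ Filter.liminf (fun n => ∫⁻ x, f n x) Filter.atTop := lintegral_liminf_le' hf
    _ ≤ Filter.liminf (fun _ : ℕ => B) Filter.atTop :=
        Filter.liminf_le_liminf (Filter.Eventually.of_forall hB)
    _ = B := Filter.liminf_const B

theorem fourier_sum {ι : Type*} (S : Finset ι) (v : ι → Eu d → ℂ)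
    (hv : ∀ k ∈ S, Integrable (v k)) (ξ : Eu d) :
    𝓕 (fun x => ∑ k ∈ S, v k x) ξ = ∑ k ∈ S, 𝓕 (v k) ξ := by
  simp only [Real.fourier_eq, Finset.smul_sum]
  exact integral_finsetSum _ fun k hk => (Real.fourierIntegral_convergent_iff ξ).2 (hv k hk)

theorem tendsto_fourier {v : ℕ → Eu d → ℂ} {g : Eu d → ℂ} {b : Eu d → ℝ}
    (hv : ∀ n, Integrable (v n)) (hb : Integrable b) (hvb : ∀ n x, ‖v n x‖ ≤ b x)
    (hlim : ∀ x, Filter.Tendsto (fun n => v n x) Filter.atTop (nhds (g x))) (ξ : Eu d) :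
    Filter.Tendsto (fun n => 𝓕 (v n) ξ) Filter.atTop (nhds (𝓕 g ξ)) := by
  simp only [Real.fourier_eq]
  refine tendsto_integral_of_dominated_convergence b
    (fun n => ((Real.fourierIntegral_convergent_iff ξ).2 (hv n)).1) hb (fun n => ?_) ?_
  · refine Filter.Eventually.of_forall fun x => ?_
    rw [Circle.norm_smul]
    exact hvb n x
  · refine Filter.Eventually.of_forall fun x => ?_
    exact (hlim x).const_smul _

theorem ae_tendsto_weight_mul {F : ℕ → Eu d → ℂ} {G : Eu d → ℂ}
    (h : ∀ ξ, Filter.Tendsto (fun n => F n ξ) Filter.atTop (nhds (G ξ))) (hd : 1 ≤ d) (s : ℝ) :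
    ∀ᵐ ξ, Filter.Tendsto (fun n => ‖ξ‖ₑ ^ s * ‖F n ξ‖ₑ) Filter.atTop
      (nhds (‖ξ‖ₑ ^ s * ‖G ξ‖ₑ)) := by
  have : Nonempty (Fin d) := ⟨⟨0, hd⟩⟩
  have h0 : ∀ᵐ ξ : Eu d, ξ ≠ 0 := compl_mem_ae_iff.2 (measure_singleton 0)
  filter_upwards [h0] with ξ hξ
  refine ENNReal.Tendsto.const_mul (h ξ).enorm (Or.inr ?_)
  exact ENNReal.rpow_ne_top_of_ne_zero (by simpa using hξ) enorm_ne_top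

theorem tendsto_truncAt_sub (t : ℝ) :
    Filter.Tendsto (fun m : ℕ => truncAt (2 ^ m) t - truncAt (2 ^ m)⁻¹ t) Filter.atTop
      (nhds t) := by
  have h1 : Filter.Tendsto (fun m : ℕ => truncAt (2 ^ m) t) Filter.atTop (nhds t) := by
    refine tendsto_const_nhds.congr' ?_
    have h2 : Filter.Tendsto (fun m : ℕ => (2 : ℝ) ^ m) Filter.atTop Filter.atTop :=
      tendsto_pow_atTop_atTop_of_one_lt one_lt_two
    filter_upwards [h2.eventually_ge_atTop |t|] with m hm
    exact (truncAt_of_abs_le (by positivity) hm).symm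
  have h3 : Filter.Tendsto (fun m : ℕ => truncAt (2 ^ m)⁻¹ t) Filter.atTop (nhds 0) := by
    have h4 : Filter.Tendsto (fun m : ℕ => (3 / 2 : ℝ) * (2⁻¹ : ℝ) ^ m) Filter.atTop
        (nhds 0) := by
      simpa using (tendsto_pow_atTop_nhds_zero_of_lt_one (r := (2⁻¹ : ℝ)) (by norm_num)
        (by norm_num)).const_mul (3 / 2)
    refine squeeze_zero_norm (fun m => ?_) h4
    rw [Real.norm_eq_abs, inv_pow]
    exact abs_truncAt_le (by positivity) t
  simpa using h1.sub h3

/-- The layers of the gradient overlap only boundedly often. -/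
theorem sum_lintegral_layerDeriv_le {g : Eu d → ℝ} (hg : ContDiff ℝ 1 g) (b : ℝ) (K : ℕ) :
    ∑ k ∈ Finset.range K,
      ∫⁻ x, ENNReal.ofReal (layerDeriv (b * 2 ^ k) (g x)) * ‖fderiv ℝ g x‖ₑ ≤
        ∫⁻ x, ‖fderiv ℝ g x‖ₑ := by
  rw [← lintegral_finsetSum]
  · refine lintegral_mono fun x => ?_
    rw [← Finset.sum_mul, ← ENNReal.ofReal_sum_of_nonneg fun k _ => layerDeriv_nonneg _ _]
    exact mul_le_of_le_one_left zero_le (ENNReal.ofReal_le_one.2 (sum_layerDeriv_le_one b _ K))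
  · intro k _
    have h1 : Continuous (fderiv ℝ g) := hg.continuous_fderiv one_ne_zero
    exact ((continuous_layerDeriv _).comp hg.continuous).measurable.ennreal_ofReal.mul
      h1.enorm.measurable

/-- The Hardy type inequality `∫ |ξ| ^ (1 - d) |ĝ(ξ)| dξ ≤ C ‖∇g‖₁` for regular real functions,
obtained by summing the estimates for the dyadic layers of `g`. -/
theorem lintegral_weight_fourier_le_fderiv (hd : 2 ≤ d) : ∃ C : ℝ≥0, ∀ g : Eu d → ℝ,
    ContDiff ℝ 1 g → Integrable g → Filter.Tendsto g (Filter.cocompact _) (nhds 0) →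
    ∫⁻ ξ, ‖ξ‖ₑ ^ (1 - d : ℝ) * ‖𝓕 (fun x => (g x : ℂ)) ξ‖ₑ ≤ C * ∫⁻ x, ‖fderiv ℝ g x‖ₑ := by
  obtain ⟨C, hC⟩ := lintegral_weight_fourier_layer_le hd
  refine ⟨C * 2, fun g hg hgi h0 => ?_⟩
  set D := ∫⁻ x, ‖fderiv ℝ g x‖ₑ with hD
  have hli : ∀ a : ℝ, 0 < a → Integrable fun x => (layer a (g x) : ℂ) := fun a ha =>
    (((contDiff_layer ha).comp hg).continuous.integrable_of_hasCompactSupport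
      (hasCompactSupport_layer_comp h0 ha)).ofReal
  -- `g` between the levels `2 ^ (-m)` and `2 ^ m`
  set w : ℕ → Eu d → ℂ := fun m x =>
    ((truncAt (2 ^ m) (g x) - truncAt (2 ^ m)⁻¹ (g x) : ℝ) : ℂ) with hw
  have hws : ∀ m, w m = fun x =>
      ∑ k ∈ Finset.range (2 * m), (layer ((2 ^ m)⁻¹ * 2 ^ k) (g x) : ℂ) := fun m => by
    funext x
    rw [← Complex.ofReal_sum, sum_layer, two_mul m, pow_add, ← mul_assoc,
      inv_mul_cancel₀ (by positivity), one_mul]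
  have hwi : ∀ m, Integrable (w m) := fun m => by
    rw [hws]
    exact integrable_finsetSum _ fun k _ => hli _ (by positivity)
  have hbound : ∀ m, ∫⁻ ξ, ‖ξ‖ₑ ^ (1 - d : ℝ) * ‖𝓕 (w m) ξ‖ₑ ≤ (C * 2 : ℝ≥0) * D := by
    intro m
    have hmeas : ∀ k ∈ Finset.range (2 * m), Measurable fun ξ =>
        ‖ξ‖ₑ ^ (1 - d : ℝ) * ‖𝓕 (fun x => (layer ((2 ^ m)⁻¹ * 2 ^ k) (g x) : ℂ)) ξ‖ₑ :=
      fun k _ => (measurable_enorm.pow_const _).mul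
        (continuous_fourier (hli _ (by positivity))).enorm.measurable
    calc ∫⁻ ξ, ‖ξ‖ₑ ^ (1 - d : ℝ) * ‖𝓕 (w m) ξ‖ₑ
        ≤ ∫⁻ ξ, ∑ k ∈ Finset.range (2 * m),
            ‖ξ‖ₑ ^ (1 - d : ℝ) * ‖𝓕 (fun x => (layer ((2 ^ m)⁻¹ * 2 ^ k) (g x) : ℂ)) ξ‖ₑ := by
          refine lintegral_mono fun ξ => ?_
          rw [hws, fourier_sum _ _ fun k _ => hli _ (by positivity), ← Finset.mul_sum]
          exact mul_le_mul_right (enorm_sum_le _ _) _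
      _ = ∑ k ∈ Finset.range (2 * m), ∫⁻ ξ,
            ‖ξ‖ₑ ^ (1 - d : ℝ) * ‖𝓕 (fun x => (layer ((2 ^ m)⁻¹ * 2 ^ k) (g x) : ℂ)) ξ‖ₑ :=
          lintegral_finsetSum _ hmeas
      _ ≤ ∑ k ∈ Finset.range (2 * m), C *
            ((∫⁻ x, ENNReal.ofReal (layerDeriv ((2 ^ m)⁻¹ * 2 ^ k) (g x)) * ‖fderiv ℝ g x‖ₑ) +
              ∫⁻ x, ENNReal.ofReal (layerDeriv ((2 ^ m)⁻¹ / 4 * 2 ^ k) (g x)) *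
                ‖fderiv ℝ g x‖ₑ) := by
          refine Finset.sum_le_sum fun k _ => ?_
          have := hC g hg hgi h0 ((2 ^ m)⁻¹ * 2 ^ k) (by positivity)
          rwa [mul_div_right_comm] at this
      _ ≤ C * (D + D) := by
          rw [← Finset.mul_sum, Finset.sum_add_distrib]
          exact mul_le_mul_right (add_le_add (sum_lintegral_layerDeriv_le hg _ _)
            (sum_lintegral_layerDeriv_le hg _ _)) _
      _ = _ := by
          push_cast
          ring
  refine lintegral_le_of_ae_tendsto (fun m => ?_)
    (ae_tendsto_weight_mul (tendsto_fourier (b := fun x => 2 * |g x|) hwi (hgi.abs.const_mul 2)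
      (fun m x => ?_) fun x => ?_) (by omega) _) hbound
  · exact ((measurable_enorm.pow_const _).mul
      (continuous_fourier (hwi m)).enorm.measurable).aemeasurable
  · rw [hw, Complex.norm_real, Real.norm_eq_abs, two_mul]
    exact (abs_sub _ _).trans (add_le_add (abs_truncAt_le_abs (by positivity) _)
      (abs_truncAt_le_abs (by positivity) _))
  · exact (Complex.continuous_ofReal.tendsto _).comp (tendsto_truncAt_sub (g x))

/-! ### A Hardy type inequality for weakly differentiable functions -/

/-- The Hardy type inequality for regular complex functions, by splitting into real and imaginary
parts. -/
theorem lintegral_weight_fourier_le_fderiv_complex (hd : 2 ≤ d) : ∃ C : ℝ≥0, ∀ g : Eu d → ℂ,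
    ContDiff ℝ 1 g → Integrable g → Filter.Tendsto g (Filter.cocompact _) (nhds 0) →
    ∫⁻ ξ, ‖ξ‖ₑ ^ (1 - d : ℝ) * ‖𝓕 g ξ‖ₑ ≤ C * ∫⁻ x, ‖fderiv ℝ g x‖ₑ := by
  obtain ⟨C, hC⟩ := lintegral_weight_fourier_le_fderiv hd
  have key : ∀ L : ℂ →L[ℝ] ℝ, ‖L‖ ≤ 1 → ∀ g : Eu d → ℂ, ContDiff ℝ 1 g → Integrable g →
      Filter.Tendsto g (Filter.cocompact _) (nhds 0) →
      ∫⁻ ξ, ‖ξ‖ₑ ^ (1 - d : ℝ) * ‖𝓕 (fun x => (L (g x) : ℂ)) ξ‖ₑ ≤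
        C * ∫⁻ x, ‖fderiv ℝ g x‖ₑ := by
    intro L hL g hg hgi h0
    refine (hC (fun x => L (g x)) (L.contDiff.comp hg) (L.integrable_comp hgi) ?_).trans ?_
    · simpa [Function.comp_def] using (L.continuous.tendsto 0).comp h0
    · refine mul_le_mul_right (lintegral_mono fun x => ?_) _
      have h1 : HasFDerivAt (fun x => L (g x)) (L ∘L fderiv ℝ g x) x :=
        L.hasFDerivAt.comp x ((hg.differentiable one_ne_zero) x).hasFDerivAt
      rw [h1.fderiv, ← ofReal_norm, ← ofReal_norm]
      refine ENNReal.ofReal_le_ofReal ((L.opNorm_comp_le _).trans ?_)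
      exact mul_le_of_le_one_left (norm_nonneg _) hL
  refine ⟨C + C, fun g hg hgi h0 => ?_⟩
  have hre : Integrable fun x => ((g x).re : ℂ) := hgi.re.ofReal
  have him : Integrable fun x => ((g x).im : ℂ) := hgi.im.ofReal
  have hsplit : ∀ ξ, 𝓕 g ξ =
      𝓕 (fun x => ((g x).re : ℂ)) ξ + Complex.I * 𝓕 (fun x => ((g x).im : ℂ)) ξ := by
    intro ξ
    simp only [Real.fourier_eq]
    rw [← integral_const_mul, ← integral_add]
    · refine integral_congr_ae (Filter.Eventually.of_forall fun x => ?_)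
      simp only [Circle.smul_def, smul_eq_mul]
      nth_rw 1 [← Complex.re_add_im (g x)]
      ring
    · exact (Real.fourierIntegral_convergent_iff ξ).2 hre
    · exact ((Real.fourierIntegral_convergent_iff ξ).2 him).const_mul _
  calc ∫⁻ ξ, ‖ξ‖ₑ ^ (1 - d : ℝ) * ‖𝓕 g ξ‖ₑ
      ≤ ∫⁻ ξ, (‖ξ‖ₑ ^ (1 - d : ℝ) * ‖𝓕 (fun x => ((g x).re : ℂ)) ξ‖ₑ +
          ‖ξ‖ₑ ^ (1 - d : ℝ) * ‖𝓕 (fun x => ((g x).im : ℂ)) ξ‖ₑ) := by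
        refine lintegral_mono fun ξ => ?_
        rw [hsplit, ← mul_add]
        refine mul_le_mul_right ((enorm_add_le _ _).trans_eq ?_) _
        rw [enorm_mul, ← ofReal_norm Complex.I, Complex.norm_I, ENNReal.ofReal_one, one_mul]
    _ = (∫⁻ ξ, ‖ξ‖ₑ ^ (1 - d : ℝ) * ‖𝓕 (fun x => ((g x).re : ℂ)) ξ‖ₑ) +
          ∫⁻ ξ, ‖ξ‖ₑ ^ (1 - d : ℝ) * ‖𝓕 (fun x => ((g x).im : ℂ)) ξ‖ₑ :=
        lintegral_add_left ((measurable_enorm.pow_const _).mul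
          (continuous_fourier hre).enorm.measurable) _
    _ ≤ C * (∫⁻ x, ‖fderiv ℝ g x‖ₑ) + C * ∫⁻ x, ‖fderiv ℝ g x‖ₑ :=
        add_le_add (key Complex.reCLM Complex.reCLM_norm.le g hg hgi h0)
          (key Complex.imCLM Complex.imCLM_norm.le g hg hgi h0)
    _ = _ := by
        push_cast
        ring

/-- Convolution with a compactly supported continuous function makes an integrable function vanish
at infinity. -/
theorem tendsto_convolution_cocompact {G ρ : Eu d → ℂ} (hG : Integrable G) (hρ : Continuous ρ)
    (hc : HasCompactSupport ρ) :
    Filter.Tendsto (G ⋆[ContinuousLinearMap.mul ℝ ℂ] ρ) (Filter.cocompact _) (nhds 0) := by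
  have : (Filter.cocompact (Eu d)).IsCountablyGenerated := by
    rw [← Metric.cobounded_eq_cocompact, ← comap_norm_atTop]
    infer_instance
  obtain ⟨K, hK⟩ := hρ.bounded_above_of_compact_support hc
  have h0 : ∫ t, G t * (0 : ℂ) = 0 := by simp
  rw [← h0]
  refine tendsto_integral_filter_of_dominated_convergence (fun t => ‖G t‖ * K)
    (Filter.Eventually.of_forall fun x => ?_) (Filter.Eventually.of_forall fun x => ?_)
    (hG.norm.mul_const K) (Filter.Eventually.of_forall fun t => ?_)
  · exact hG.1.mul (hρ.comp (continuous_const.sub continuous_id)).aestronglyMeasurable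
  · refine Filter.Eventually.of_forall fun t => ?_
    simp only [ContinuousLinearMap.mul_apply', norm_mul]
    exact mul_le_mul_of_nonneg_left (hK _) (norm_nonneg _)
  · refine Filter.Tendsto.const_mul _ ?_
    exact hc.is_zero_at_infty.comp (Homeomorph.subRight t).isClosedEmbedding.tendsto_cocompact

/-- Mollification does not increase the `L¹` norm. -/
theorem lintegral_enorm_convolution_le {G ρ : Eu d → ℂ} (hG : Integrable G)
    (hρ : Continuous ρ) (h1 : ∫⁻ x, ‖ρ x‖ₑ ≤ 1) :
    ∫⁻ x, ‖(G ⋆[ContinuousLinearMap.mul ℝ ℂ] ρ) x‖ₑ ≤ ∫⁻ x, ‖G x‖ₑ := by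
  have hm : AEMeasurable (Function.uncurry fun x t : Eu d => ‖G t‖ₑ * ‖ρ (x - t)‖ₑ)
      (volume.prod volume) := by
    have h2 : AEMeasurable (fun z : Eu d × Eu d => ‖G z.2‖ₑ) (volume.prod volume) :=
      hG.1.enorm.comp_snd
    have h3 : Continuous fun z : Eu d × Eu d => ‖ρ (z.1 - z.2)‖ₑ := by fun_prop
    exact h2.mul h3.measurable.aemeasurable
  calc ∫⁻ x, ‖(G ⋆[ContinuousLinearMap.mul ℝ ℂ] ρ) x‖ₑ
      ≤ ∫⁻ x, ∫⁻ t, ‖G t‖ₑ * ‖ρ (x - t)‖ₑ := by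
        refine lintegral_mono fun x => (enorm_integral_le_lintegral_enorm _).trans_eq ?_
        simp only [ContinuousLinearMap.mul_apply', enorm_mul]
    _ = ∫⁻ t, ∫⁻ x, ‖G t‖ₑ * ‖ρ (x - t)‖ₑ := lintegral_lintegral_swap hm
    _ ≤ ∫⁻ t, ‖G t‖ₑ := by
        refine lintegral_mono fun t => ?_
        rw [lintegral_const_mul' _ _ enorm_ne_top, lintegral_sub_right_eq_self (fun x => ‖ρ x‖ₑ)]
        exact mul_le_of_le_one_right zero_le h1

/-- Mollification commutes with weak differentiation. -/
theorem fderiv_convolution_single {F : 𝓢'(Eu d, ℂ)} {G D ρ : Eu d → ℂ} {j : Fin d}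
    (hF : IsRegular F G) (hD : IsRegular (∂_{EuclideanSpace.single j (1 : ℝ)} F) D)
    (hρ : ContDiff ℝ (⊤ : ℕ∞) ρ) (hc : HasCompactSupport ρ) (x : Eu d) :
    fderiv ℝ (G ⋆[ContinuousLinearMap.mul ℝ ℂ] ρ) x (EuclideanSpace.single j 1) =
      (D ⋆[ContinuousLinearMap.mul ℝ ℂ] ρ) x := by
  have hρ1 : ContDiff ℝ 1 ρ := hρ.of_le (by exact_mod_cast le_top)
  have hs : ContDiff ℝ (⊤ : ℕ∞) fun t => ρ (x - t) := hρ.comp (contDiff_const.sub contDiff_id)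
  have hcs : HasCompactSupport fun t => ρ (x - t) :=
    hc.comp_homeomorph (Homeomorph.subLeft x)
  -- the convolution at `x` is the pairing with the test function `ρ (x - ·)`
  set φ : 𝓢(Eu d, ℂ) := hcs.toSchwartzMap hs with hφ
  have hφa : ∀ t, φ t = ρ (x - t) := fun t => rfl
  have hdφ : ∀ t, (∂_{EuclideanSpace.single j (1 : ℝ)} φ) t =
      -(fderiv ℝ ρ (x - t) (EuclideanSpace.single j 1)) := by
    intro t
    have h1 : HasFDerivAt (φ : Eu d → ℂ)
        ((fderiv ℝ ρ (x - t)) ∘L (-ContinuousLinearMap.id ℝ (Eu d))) t :=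
      ((hρ1.differentiable one_ne_zero) (x - t)).hasFDerivAt.comp t
        ((hasFDerivAt_id t).const_sub x)
    rw [SchwartzMap.lineDerivOp_apply_eq_fderiv, h1.fderiv]
    simp
  have hfd := (hc.hasFDerivAt_convolution_right (ContinuousLinearMap.mul ℝ ℂ) hF.1 hρ1 x).fderiv
  rw [hfd, convolution_precompR_apply _ hF.1 (hc.fderiv ℝ) (hρ1.continuous_fderiv one_ne_zero)]
  have h2 := (hD.2 φ).2
  rw [TemperedDistribution.lineDerivOp_apply_apply, map_neg, (hF.2 _).2, ← integral_neg] at h2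
  calc ∫ t, G t * fderiv ℝ ρ (x - t) (EuclideanSpace.single j 1)
      = ∫ t, -((∂_{EuclideanSpace.single j (1 : ℝ)} φ) t * G t) := by
        refine integral_congr_ae (Filter.Eventually.of_forall fun t => ?_)
        simp only [hdφ]
        ring
    _ = ∫ t, φ t * D t := h2
    _ = ∫ t, D t * ρ (x - t) := by
        refine integral_congr_ae (Filter.Eventually.of_forall fun t => ?_)
        simp only [hφa]
        ring

/-- A functional is bounded by its values on the standard basis. -/
theorem norm_le_sum_norm_apply_single (L : Eu d →L[ℝ] ℂ) :
    ‖L‖ ≤ ∑ j, ‖L (EuclideanSpace.single j 1)‖ := by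
  refine L.opNorm_le_bound (Finset.sum_nonneg fun _ _ => norm_nonneg _) fun v => ?_
  have hv : v = ∑ j, v j • EuclideanSpace.single j (1 : ℝ) := by
    ext i
    simp [Finset.sum_apply, Pi.single_apply]
  calc ‖L v‖ = ‖∑ j, v j • L (EuclideanSpace.single j 1)‖ := by
        conv_lhs => rw [hv]
        simp only [map_sum, map_smul]
    _ ≤ ∑ j, ‖v j • L (EuclideanSpace.single j 1)‖ := norm_sum_le _ _
    _ ≤ ∑ j, ‖L (EuclideanSpace.single j 1)‖ * ‖v‖ := by
        refine Finset.sum_le_sum fun j _ => ?_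
        rw [norm_smul, mul_comm]
        exact mul_le_mul_of_nonneg_left (PiLp.norm_apply_le v j) (norm_nonneg _)
    _ = _ := by rw [Finset.sum_mul]

/-- The Fourier transforms of an approximate identity converge to `1`. -/
theorem tendsto_fourier_normed_bump {b : ℕ → ContDiffBump (0 : Eu d)}
    (hb : Filter.Tendsto (fun n => (b n).rOut) Filter.atTop (nhds 0)) (ξ : Eu d) :
    Filter.Tendsto (fun n => 𝓕 (fun x => ((b n).normed volume x : ℂ)) ξ) Filter.atTop
      (nhds 1) := by
  have hcont : Continuous fun t : Eu d => (Real.fourierChar (inner ℝ t ξ) : ℂ) := by fun_prop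
  have h := ContDiffBump.convolution_tendsto_right_of_continuous (μ := volume) hb hcont 0
  simp only [inner_zero_left, AddChar.map_zero_eq_one, Circle.coe_one] at h
  refine h.congr fun n => ?_
  rw [Real.fourier_eq]
  refine integral_congr_ae (Filter.Eventually.of_forall fun t => ?_)
  simp [Circle.smul_def, mul_comm]

/-- The inequality `∫ |ξ| ^ (1 - d) |Ĝ(ξ)| dξ ≤ C ‖∇G‖₁` for `G ∈ W¹₁(ℝᵈ)`, `d ≥ 2`. -/
theorem lintegral_weight_fourier_le_weak (hd : 2 ≤ d) : ∃ C : ℝ≥0, ∀ (F : 𝓢'(Eu d, ℂ))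
    (G : Eu d → ℂ) (D : Fin d → Eu d → ℂ), IsRegular F G → Integrable G →
    (∀ j, IsRegular (∂_{EuclideanSpace.single j (1 : ℝ)} F) (D j)) → (∀ j, Integrable (D j)) →
    ∫⁻ ξ, ‖ξ‖ₑ ^ (1 - d : ℝ) * ‖𝓕 G ξ‖ₑ ≤ C * ∑ j, ∫⁻ x, ‖D j x‖ₑ := by
  obtain ⟨C, hC⟩ := lintegral_weight_fourier_le_fderiv_complex hd
  refine ⟨C, fun F G D hF hG hD hDi => ?_⟩
  set b : ℕ → ContDiffBump (0 : Eu d) := fun n =>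
    ⟨1 / (2 * (n + 1)), 1 / (n + 1), by positivity, by
      refine one_div_lt_one_div_of_lt (by positivity) ?_
      have : (0 : ℝ) < n + 1 := by positivity
      linarith⟩ with hb
  have hb0 : Filter.Tendsto (fun n => (b n).rOut) Filter.atTop (nhds 0) :=
    tendsto_one_div_add_atTop_nhds_zero_nat
  set ρ : ℕ → Eu d → ℂ := fun n x => ((b n).normed volume x : ℂ) with hρ
  have hρs : ∀ n, ContDiff ℝ (⊤ : ℕ∞) (ρ n) := fun n =>
    Complex.ofRealCLM.contDiff.comp (b n).contDiff_normed
  have hρc : ∀ n, HasCompactSupport (ρ n) := fun n =>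
    (b n).hasCompactSupport_normed.comp_left (g := fun r : ℝ => (r : ℂ)) Complex.ofReal_zero
  have hρi : ∀ n, Integrable (ρ n) := fun n =>
    (hρs n).continuous.integrable_of_hasCompactSupport (hρc n)
  have hρ1 : ∀ n, ∫⁻ x, ‖ρ n x‖ₑ ≤ 1 := fun n => by
    have h1 : ∫⁻ x, ‖ρ n x‖ₑ = ENNReal.ofReal (∫ x, (b n).normed volume x) := by
      rw [ofReal_integral_eq_lintegral_ofReal (b n).integrable_normed
        (Filter.Eventually.of_forall fun x => (b n).nonneg_normed x)]
      refine lintegral_congr fun x => ?_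
      rw [← ofReal_norm, Complex.norm_real, Real.norm_of_nonneg ((b n).nonneg_normed x)]
    rw [h1, (b n).integral_normed, ENNReal.ofReal_one]
  set g : ℕ → Eu d → ℂ := fun n => G ⋆[ContinuousLinearMap.mul ℝ ℂ] ρ n with hg
  have hgi : ∀ n, Integrable (g n) := fun n => hG.integrable_convolution _ (hρi n)
  have hgd : ∀ n, ContDiff ℝ 1 (g n) := fun n =>
    ((hρc n).contDiff_convolution_right (ContinuousLinearMap.mul ℝ ℂ) hF.1 (hρs n)).of_le
      (by exact_mod_cast le_top)
  have hgF : ∀ n ξ, 𝓕 (g n) ξ = 𝓕 G ξ * 𝓕 (ρ n) ξ := fun n ξ =>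
    Real.fourier_mul_convolution_eq hG (hρi n) ξ
  have hbound : ∀ n, ∫⁻ ξ, ‖ξ‖ₑ ^ (1 - d : ℝ) * ‖𝓕 (g n) ξ‖ₑ ≤ C * ∑ j, ∫⁻ x, ‖D j x‖ₑ := by
    intro n
    refine (hC (g n) (hgd n) (hgi n)
      (tendsto_convolution_cocompact hG (hρs n).continuous (hρc n))).trans ?_
    refine mul_le_mul_right ?_ _
    calc ∫⁻ x, ‖fderiv ℝ (g n) x‖ₑ
        ≤ ∫⁻ x, ∑ j, ‖(D j ⋆[ContinuousLinearMap.mul ℝ ℂ] ρ n) x‖ₑ := by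
          refine lintegral_mono fun x => ?_
          simp_rw [← fderiv_convolution_single hF (hD _) (hρs n) (hρc n) x, ← ofReal_norm]
          rw [← ENNReal.ofReal_sum_of_nonneg fun _ _ => norm_nonneg _]
          exact ENNReal.ofReal_le_ofReal (norm_le_sum_norm_apply_single _)
      _ = ∑ j, ∫⁻ x, ‖(D j ⋆[ContinuousLinearMap.mul ℝ ℂ] ρ n) x‖ₑ :=
          lintegral_finsetSum' _ fun j _ => ((hDi j).integrable_convolution _ (hρi n)).1.enorm
      _ ≤ _ := Finset.sum_le_sum fun j _ =>
          lintegral_enorm_convolution_le (hDi j) (hρs n).continuous (hρ1 n)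
  refine lintegral_le_of_ae_tendsto (fun n => ?_)
    (ae_tendsto_weight_mul (fun ξ => ?_) (by omega) _) hbound
  · exact ((measurable_enorm.pow_const _).mul
      (continuous_fourier (hgi n)).enorm.measurable).aemeasurable
  · simp_rw [hgF]
    simpa using (tendsto_fourier_normed_bump hb0 ξ).const_mul (𝓕 G ξ)

/-! ### The endpoint for integer order -/

/-- `W^{s+d}_1 ↪ 𝓑^s` for an integer `s` in dimension `d ≥ 2`: the derivatives of order `s + d - 1`
belong to `W¹₁`, and their Fourier transforms are integrable against `|ξ| ^ (1 - d)`. -/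
theorem sobolev_one_continuouslyEmbeds_barron_of_isInteger (hd : 2 ≤ d) {s : ℝ} (hs : 0 ≤ s)
    (hint : IsInteger s) :
    ContinuouslyEmbeds (sobolevSpace d (s + d) 1) (sobolevNorm (s + d) 1) (barronSpace d s)
      (barronNorm s) := by
  have hα0 : 0 ≤ s + d := by positivity
  have hd' : (2 : ℝ) ≤ d := by exact_mod_cast hd
  have hint' : IsInteger (s + d) := by
    obtain ⟨k, hk⟩ := hint
    exact ⟨k + d, by push_cast; linarith⟩
  have hfl := natFloor_eq_of_isInteger hα0 hint'
  obtain ⟨n, hn⟩ : ∃ n, ⌊s + d⌋₊ = n + 1 := Nat.exists_eq_add_one.2 (Nat.floor_pos.2 (by linarith))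
  have hsn : s = (1 - d) + n := by
    rw [hn] at hfl
    push_cast at hfl
    linarith
  obtain ⟨C, hC⟩ := lintegral_weight_fourier_le_weak hd
  refine continuouslyEmbeds_barron_of_high_frequency hs le_rfl one_le_two
    ⟨C * d * Fintype.card (Fin n → Fin d), fun f g _ hf hg _ _ _ => ?_⟩
  have hfin : ∀ m ≤ ⌊s + d⌋₊, gradientLpNorm m 1 f < ∞ := fun m hm =>
    (gradientLpNorm_le_sobolevNorm hm f).trans_lt hf
  obtain ⟨H, hH, -, hH1⟩ := exists_isWeakGradient (hfin n (by omega))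
  obtain ⟨G, hG, -, hG1⟩ := exists_isWeakGradient (hfin (n + 1) hn.ge)
  have hGB : eLpNorm G 1 ≤ sobolevNorm (s + d) 1 f := by
    have h1 := gradientLpNorm_le_sobolevNorm (p := 1) hn.ge f
    rwa [gradientLpNorm_eq hG, ENNReal.ofReal_one] at h1
  rw [ENNReal.ofReal_one] at hH1 hG1
  set B := sobolevNorm (s + d) 1 f with hB
  have hHi : ∀ i, Integrable fun x => H x i := fun i =>
    memLp_one_iff_integrable.1 (hH1.euclideanSpace_apply i)
  have hGi : ∀ i, Integrable fun x => G x i := fun i =>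
    memLp_one_iff_integrable.1 (hG1.euclideanSpace_apply i)
  have hone : ∀ i : Fin n → Fin d,
      ∫⁻ ξ, ‖ξ‖ₑ ^ (1 - d : ℝ) * ‖𝓕 (fun x => H x i) ξ‖ₑ ≤ C * (d * B) := by
    intro i
    refine (hC _ (fun x => H x i) (fun j x => G x (Fin.cons j i)) (hH i) (hHi i)
      (fun j => ?_) fun j => hGi _).trans ?_
    · have h1 := hG (Fin.cons j i)
      rw [iteratedLineDerivOp_succ_left] at h1
      exact h1
    · refine mul_le_mul_right ?_ _
      calc ∑ j : Fin d, ∫⁻ x, ‖G x (Fin.cons j i)‖ₑ ≤ ∑ _j : Fin d, B := by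
            refine Finset.sum_le_sum fun j _ => ?_
            rw [← eLpNorm_one_eq_lintegral_enorm]
            exact (eLpNorm_mono fun x => PiLp.norm_apply_le (G x) _).trans hGB
        _ = d * B := by simp
  have hmeas : ∀ i : Fin n → Fin d, Measurable fun ξ =>
      ‖ξ‖ₑ ^ (1 - d : ℝ) * ‖𝓕 (fun x => H x i) ξ‖ₑ := fun i =>
    (measurable_enorm.pow_const _).mul (continuous_fourier (hHi i)).enorm.measurable
  have hae : ∀ᵐ ξ, ∀ i : Fin n → Fin d, derivSymbol i ξ * g ξ = 𝓕 (fun x => H x i) ξ :=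
    ae_all_iff.2 fun i => (hH.hasFourier hg i).ae_eq (hasFourier_of_integrable (hHi i))
  calc ∫⁻ ξ in (Metric.ball 0 1)ᶜ, ‖ξ‖ₑ ^ s * ‖g ξ‖ₑ
      ≤ ∫⁻ ξ in (Metric.ball 0 1)ᶜ,
          ∑ i : Fin n → Fin d, ‖ξ‖ₑ ^ (1 - d : ℝ) * ‖𝓕 (fun x => H x i) ξ‖ₑ := by
        refine lintegral_mono_ae ?_
        filter_upwards [ae_restrict_of_ae hae, ae_restrict_mem measurableSet_ball.compl]
          with ξ hξ hξ1
        have h0 : ‖ξ‖ₑ ≠ 0 := by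
          rw [enorm_ne_zero]
          rintro rfl
          simp at hξ1
        calc ‖ξ‖ₑ ^ s * ‖g ξ‖ₑ = ‖ξ‖ₑ ^ (1 - d : ℝ) * (‖ξ‖ₑ ^ n * ‖g ξ‖ₑ) := by
              rw [← mul_assoc, ← ENNReal.rpow_natCast, ← ENNReal.rpow_add _ _ h0 enorm_ne_top,
                ← hsn]
          _ ≤ ‖ξ‖ₑ ^ (1 - d : ℝ) * ∑ i : Fin n → Fin d, ‖derivSymbol i ξ * g ξ‖ₑ :=
              mul_le_mul_right (enorm_pow_mul_le_sum n g ξ) _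
          _ = _ := by
              rw [Finset.mul_sum]
              simp_rw [hξ]
    _ ≤ ∫⁻ ξ, ∑ i : Fin n → Fin d, ‖ξ‖ₑ ^ (1 - d : ℝ) * ‖𝓕 (fun x => H x i) ξ‖ₑ :=
        setLIntegral_le_lintegral _ _
    _ = ∑ i : Fin n → Fin d, ∫⁻ ξ, ‖ξ‖ₑ ^ (1 - d : ℝ) * ‖𝓕 (fun x => H x i) ξ‖ₑ :=
        lintegral_finsetSum _ fun i _ => hmeas i
    _ ≤ ∑ _i : Fin n → Fin d, C * (d * B) := Finset.sum_le_sum fun i _ => hone i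
    _ = _ := by
        rw [Finset.sum_const, Finset.card_univ, nsmul_eq_mul]
        push_cast
        ring

end SpectralBarron

theorem corollary2p9 (d : ℕ) (hd : 1 ≤ d) (s : ℝ) (hs : 0 ≤ s) :
    (∀ p α : ℝ, 1 ≤ p → p ≤ 2 → s + d / p < α →
      SpectralBarron.ContinuouslyEmbeds
        (SpectralBarron.sobolevSpace d α p) (SpectralBarron.sobolevNorm α p)
        (SpectralBarron.barronSpace d s) (SpectralBarron.barronNorm s) ∧
      SpectralBarron.ContinuouslyEmbeds
        (SpectralBarron.barronSpace d s) (SpectralBarron.barronNorm s)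
        (SpectralBarron.holderSpace d s) (SpectralBarron.holderNorm s)) ∧
    (¬ SpectralBarron.IsInteger s ∨ (SpectralBarron.IsInteger s ∧ 2 ≤ d) →
      SpectralBarron.ContinuouslyEmbeds
        (SpectralBarron.sobolevSpace d (s + d) 1) (SpectralBarron.sobolevNorm (s + d) 1)
        (SpectralBarron.barronSpace d s) (SpectralBarron.barronNorm s)) := by
  refine ⟨fun p α hp1 hp2 hα => ⟨SpectralBarron.sobolev_continuouslyEmbeds_barron d hs hp1 hp2 hα,
    SpectralBarron.barron_continuouslyEmbeds_holder d hs⟩, ?_⟩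
  rintro (h | ⟨h, h2⟩)
  · exact SpectralBarron.sobolev_one_continuouslyEmbeds_barron_of_not_isInteger d hs h
  · exact SpectralBarron.sobolev_one_continuouslyEmbeds_barron_of_isInteger h2 hs h
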